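/- \textbf{Notation.} Let $\mathbb B=\{x\in\mathbb R^d:|x|\le 1\}$ and let $\widehat F(\xi)=\int_{\mathbb R^d}e^{-2\pi i x\cdot\xi}F(x)\,dx$. For $q>3$ let $K_q:\mathbb R^d\to\mathbb R$ be the continuous function with $\widehat{K_q}=|\widehat{1_{\mathbb B}}|^{q-2}\,\widehat{1_{\mathbb B}}$, i.e. the inverse Fourier transform of the integrable function $|\widehat{1_{\mathbb B}}|^{q-2}\,\widehat{1_{\mathbb B}}$; when $q\ge4$ is an even integer, $K_q>0$ on $\mathbb B$. For an even integer $\overline q\ge 4$ let $\mathcal H\subset L^2(\mathbb B)=L^2(\mathbb B;\mathbb R)$ be the finite-dimensional subspace of the functions $K_{\overline q}^{1/2}(x)\,(\alpha\cdot x+b)$ with $\alpha\in\mathbb R^d$, $b\in\mathbb R$, and let $P_{\mathcal H}$ be the orthogonal projection of $L^2(\mathbb B)$ onto $\mathcal H$. \textbf{Theorem.} Let $d\ge 1$ and let $\overline q\ge 4$ be an even integer. There exist constants $\delta_0,\rho,c,C>0$ and a function $\omega:\mathbb R\to\mathbb R$ with $\omega(t)\to\omega(0)=0$ as $t\to0$,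 all depending only on $d$ and $\overline q$, such that the following holds. Let $q\in(3,\infty)$ with $|q-\overline q|<\rho$, and let $f,g$ be real-valued measurable functions on $\mathbb B$ such that, almost everywhere on $\mathbb B$, $0\le f\le 1$ and $|g|\le \frac{5\pi}{4}$. If $\|f-1\|_{L^1(\mathbb B)}\le\delta_0$ and $\|g\|_{L^2(\mathbb B)}\le\delta_0$, then $\widehat{fe^{ig}1_{\mathbb B}}$ and $\widehat{1_{\mathbb B}}$ belong to $L^q(\mathbb R^d)$ and \begin{align*} \|\widehat{fe^{ig}1_{\mathbb B}}\|_q^q\le{}& \|\widehat{1_{\mathbb B}}\|_q^q-c\,\|(I-P_{\mathcal H})(K_{\overline q}^{1/2}g)\|_{L^2(\mathbb B)}^2+\omega(q-\overline q)\,\|g\|_{L^2(\mathbb B)}^2\\ &+C\,\|f-1\|_{L^1(\mathbb B)}\|g\|_{L^2(\mathbb B)}+C\left(\|f-1\|_{L^1(\mathbb B)}^2+\|g\|_{L^2(\mathbb B)}^{5/2}\right). \end{align*} -/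

import Mathlib

open MeasureTheory
open scoped FourierTransform ENNReal Topology

noncomputable section

namespace BallFourier

/-- The closed unit ball of `ℝ^d`. -/
def unitBall (d : ℕ) : Set (EuclideanSpace ℝ (Fin d)) := Metric.closedBall 0 1

/-- Lebesgue measure on the unit ball. -/
def ballMeasure (d : ℕ) : Measure (EuclideanSpace ℝ (Fin d)) := volume.restrict (unitBall d)

/-- The indicator function of the unit ball, as a complex-valued function on `ℝ^d`. -/
def ballIndicator (d : ℕ) : EuclideanSpace ℝ (Fin d) → ℂ := (unitBall d).indicator (fun _ => 1)

/-- The function `f e^{ig} 1_B` on `ℝ^d`. -/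
def modulated (d : ℕ) (f g : EuclideanSpace ℝ (Fin d) → ℝ) : EuclideanSpace ℝ (Fin d) → ℂ :=
  (unitBall d).indicator (fun x => (f x : ℂ) * Complex.exp (Complex.I * (g x : ℂ)))

/-- The function `|F|^{q-2} F` with `F` the Fourier transform of the indicator of the ball. -/
def kernelHat (d : ℕ) (q : ℝ) : EuclideanSpace ℝ (Fin d) → ℂ :=
  fun ξ => ((‖𝓕 (ballIndicator d) ξ‖ ^ (q - 2) : ℝ) : ℂ) * 𝓕 (ballIndicator d) ξ

/-- The kernel `K_q`, whose Fourier transform is `kernelHat d q`. The function `kernelHat d q` is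
real and even, so that its inverse Fourier transform is real; `re` only changes the codomain. -/
def kernel (d : ℕ) (q : ℝ) : EuclideanSpace ℝ (Fin d) → ℝ :=
  fun x => (𝓕⁻ (kernelHat d q) x).re

theorem continuous_kernel (d : ℕ) (q : ℝ) : Continuous (kernel d q) := by
  refine Complex.continuous_re.comp ?_
  by_cases h : Integrable (kernelHat d q)
  · have : Continuous (𝓕 (kernelHat d q)) :=
      VectorFourier.fourierIntegral_continuous Real.continuous_fourierChar
        (by exact continuous_inner) h
    have h2 : 𝓕⁻ (kernelHat d q) = fun x => 𝓕 (kernelHat d q) (-x) := by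
      funext x
      exact Real.fourierInv_eq_fourier_neg _ _
    rw [h2]
    exact this.comp continuous_neg
  · have h2 : 𝓕⁻ (kernelHat d q) = fun _ => 0 := by
      funext x
      rw [Real.fourierInv_eq_fourier_neg, Real.fourier_eq]
      apply integral_undef
      rwa [Real.fourierIntegral_convergent_iff]
    rw [h2]
    exact continuous_const

theorem memLp_sqrt_kernel_mul (d : ℕ) (q : ℝ) {g : EuclideanSpace ℝ (Fin d) → ℝ}
    (hg : MemLp g 2 (ballMeasure d)) :
    MemLp (fun x => √(kernel d q x) * g x) 2 (ballMeasure d) := by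
  have hc : Continuous fun x => √(kernel d q x) := (continuous_kernel d q).sqrt
  obtain ⟨C, hC⟩ := (isCompact_closedBall (0 : EuclideanSpace ℝ (Fin d)) 1).exists_bound_of_continuousOn
    hc.continuousOn
  have htop : MemLp (fun x => √(kernel d q x)) ∞ (ballMeasure d) :=
    memLp_top_of_bound hc.aestronglyMeasurable C
      ((ae_restrict_mem Metric.isClosed_closedBall.measurableSet).mono fun x hx => hC x hx)
  exact hg.mul htop

theorem memLp_affine (d : ℕ) (p : EuclideanSpace ℝ (Fin d) × ℝ) :
    MemLp (fun x => inner ℝ p.1 x + p.2) 2 (ballMeasure d) := by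
  have hc : Continuous fun x : EuclideanSpace ℝ (Fin d) => inner ℝ p.1 x + p.2 := by fun_prop
  obtain ⟨C, hC⟩ := (isCompact_closedBall (0 : EuclideanSpace ℝ (Fin d)) 1).exists_bound_of_continuousOn
    hc.continuousOn
  have : IsFiniteMeasure (ballMeasure d) :=
    ⟨by simpa [ballMeasure, unitBall] using measure_closedBall_lt_top⟩
  exact MemLp.of_bound hc.aestronglyMeasurable C
      ((ae_restrict_mem Metric.isClosed_closedBall.measurableSet).mono fun x hx => hC x hx)

/-- The product `K_q^{1/2} g` as an element of the real Hilbert space `L²(B)`. -/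
def weighted (d : ℕ) (q : ℝ) (g : EuclideanSpace ℝ (Fin d) → ℝ) (hg : MemLp g 2 (ballMeasure d)) :
    Lp ℝ 2 (ballMeasure d) :=
  (memLp_sqrt_kernel_mul d q hg).toLp _

/-- The linear map sending `(a, b)` to `K_q^{1/2} (a · x + b)` in `L²(B)`. -/
def weightedAffine (d : ℕ) (q : ℝ) :
    (EuclideanSpace ℝ (Fin d) × ℝ) →ₗ[ℝ] Lp ℝ 2 (ballMeasure d) where
  toFun p := weighted d q (fun x => inner ℝ p.1 x + p.2) (memLp_affine d p)
  map_add' p r := by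
    rw [weighted, weighted, weighted, ← MemLp.toLp_add]
    congr 1
    funext x
    simp only [Prod.fst_add, Prod.snd_add, inner_add_left, Pi.add_apply]
    ring
  map_smul' c p := by
    rw [weighted, weighted, RingHom.id_apply, ← MemLp.toLp_const_smul]
    congr 1
    funext x
    simp only [Prod.smul_fst, Prod.smul_snd, real_inner_smul_left, Pi.smul_apply, smul_eq_mul]
    ring

/-- The subspace `H` of `L²(B)` of the functions `K_q^{1/2} (a · x + b)`. -/
def affineSubspace (d : ℕ) (q : ℝ) : Submodule ℝ (Lp ℝ 2 (ballMeasure d)) :=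
  LinearMap.range (weightedAffine d q)

instance finiteDimensional_affineSubspace (d : ℕ) (q : ℝ) : FiniteDimensional ℝ (affineSubspace d q) :=
  inferInstanceAs (FiniteDimensional ℝ (LinearMap.range (weightedAffine d q)))

end BallFourier

end

/-! Write F for the Fourier transform of the ball indicator, f e^{ig} = 1 + u on the ball, and a =
‖f - 1‖₁. Expanding |F + û|^q at the real number F gives a linear term q ∫ K_q Re u, a quadratic
term (q/2) ∫ |F|^{q-2} ((q-1)(Re û)² + (Im û)²), and a cubic remainder of size ‖u‖₁ ‖u‖₂²
(`exists_integral_norm_add_rpow_le`). Here Re u = f cos g - 1 is roughly -(1-f) - g²/2, and u is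
roughly ig. The two terms therefore combine into -(q/2) Q(g), with Q(g) = ∫ K_q g² - ∫ |F|^{q-2}
((q-1)(Im ĝ)² + (Re ĝ)²), together with a gain proportional to a, because K_q is bounded below on
the ball.

Coercivity of Q is proved at the even exponent 2m = 2r + 4. There the powers of |F| are polynomials
in F, and 2m Q(g) is the integral of (-∑ g(-w_j) + ∑ g(z_j))², with m terms in each sum, over the
fibre ∑ w_j + ∑ z_j = 0 of the product of balls (`fiberQuad_signedSeq_eq`). So Q is nonnegative and
vanishes on affine functions. If Q(g) = 0, Cauchy–Schwarz in all variables but two shows that g(z) +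
g(w) depends only on z + w; Cauchy's functional equation then makes g affine
(`exists_affine_of_quadForm_eq_zero`). In the variable G = K^{1/2} g one has Q = ‖G‖² - B(G) with B
weakly continuous, so positivity off the affine space improves to a spectral gap
(`exists_quadForm_gap`).

For q near 2m, both |F|^{q-2} and K_q depend on q in a Lipschitz way, which produces ω(t) = L|t|
(`secondOrder_I_mul_le`). The expansion in g is used only where |g| ≤ η; elsewhere the crude bound
on f cos g - 1 still gains a multiple of g², enough to pay for the part of g that was cut away. With
η = ‖g‖₂^{1/2}, the terms a^{3/2} and a^{1/2} ‖g‖₂^{3/2}, which the conclusion does not allow, are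
absorbed by the linear gain in a (`remainder_le`). -/

noncomputable section

open Filter

namespace BallFourier

variable {d : ℕ}

/-! ### Plancherel and the multiplication formula for Fourier integrals. -/

section Plancherel

variable {V : Type*} [NormedAddCommGroup V] [InnerProductSpace ℝ V] [FiniteDimensional ℝ V]
  [MeasurableSpace V] [BorelSpace V]

theorem continuous_fourier {u : V → ℂ} (hu : Integrable u) : Continuous (𝓕 u) :=
  VectorFourier.fourierIntegral_continuous Real.continuous_fourierChar
    (by exact continuous_inner) hu

theorem norm_fourier_le (u : V → ℂ) (ξ : V) : ‖𝓕 u ξ‖ ≤ ∫ x, ‖u x‖ := by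
  rw [Real.fourier_eq]
  refine (norm_integral_le_integral_norm _).trans_eq ?_
  simp

theorem integral_fourier_mul_eq {u v : V → ℂ} (hu : Integrable u) (hv : Integrable v) :
    ∫ ξ, 𝓕 u ξ * v ξ = ∫ x, u x * 𝓕 v x := by
  have := VectorFourier.integral_fourierIntegral_smul_eq_flip (L := innerₗ V)
    Real.continuous_fourierChar (by exact continuous_inner) hu hv
  rw [flip_innerₗ] at this
  exact this

/-- The Fourier transform on `L²` is given by the Fourier integral on `L¹ ∩ L²`. -/
theorem fourier_toLp_ae_eq {u : V → ℂ} (hu : Integrable u) (hu2 : MemLp u 2) :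
    (𝓕 (hu2.toLp u) : Lp ℂ 2 (volume : Measure V)) =ᵐ[volume] 𝓕 u := by
  -- Both sides are tested against smooth compactly supported functions. These are Schwartz, so the
  -- transform moves onto the test function by duality of tempered distributions on one side and by
  -- Fubini on the other.
  refine ae_eq_of_integral_contDiff_smul_eq
    ((Lp.memLp _).locallyIntegrable (by norm_num)) (continuous_fourier hu).locallyIntegrable ?_
  intro φ hφ hφc
  have hφ' : ContDiff ℝ ((⊤ : ℕ∞) : WithTop ℕ∞) (fun x => (φ x : ℂ)) :=
    Complex.ofRealCLM.contDiff.comp hφ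
  have hφc' : HasCompactSupport (fun x => (φ x : ℂ)) :=
    hφc.comp_left (g := fun r : ℝ => (r : ℂ)) (by simp)
  set Φ : SchwartzMap V ℂ := hφc'.toSchwartzMap hφ' with hΦ
  have hΦx : ∀ x, Φ x = (φ x : ℂ) := fun x => rfl
  have h1 := congrArg (fun T => T Φ) (Lp.fourier_toTemperedDistribution_eq (hu2.toLp u))
  simp only [TemperedDistribution.fourier_apply, Lp.toTemperedDistribution_apply] at h1
  have h2 : ∫ x, (𝓕 Φ) x • (hu2.toLp u) x = ∫ x, u x * 𝓕 (fun y => Φ y) x := by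
    refine integral_congr_ae ?_
    filter_upwards [hu2.coeFn_toLp] with x hx
    rw [hx, smul_eq_mul, mul_comm]
    rfl
  rw [h2, ← integral_fourier_mul_eq hu Φ.integrable] at h1
  have h3 : ∀ x (z : ℂ), φ x • z = Φ x * z := fun x z => by
    rw [hΦx]; simp
  simp only [h3]
  simp only [smul_eq_mul] at h1
  rw [← h1]
  simp only [mul_comm]

theorem memLp_two_fourier {u : V → ℂ} (hu : Integrable u) (hu2 : MemLp u 2) :
    MemLp (𝓕 u) 2 :=
  (memLp_congr_ae (fourier_toLp_ae_eq hu hu2)).1 (Lp.memLp _)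

theorem integral_fourier_mul_conj_fourier {u v : V → ℂ} (hu : Integrable u) (hu2 : MemLp u 2)
    (hv : Integrable v) (hv2 : MemLp v 2) :
    ∫ ξ, 𝓕 u ξ * starRingEnd ℂ (𝓕 v ξ) = ∫ x, u x * starRingEnd ℂ (v x) := by
  have h := Lp.inner_fourier_eq (hv2.toLp v) (hu2.toLp u)
  rw [L2.inner_def, L2.inner_def] at h
  have e1 : ∫ ξ, 𝓕 u ξ * starRingEnd ℂ (𝓕 v ξ) = ∫ a, inner ℂ
      ((𝓕 (hv2.toLp v) : Lp ℂ 2 (volume : Measure V)) a)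
      ((𝓕 (hu2.toLp u) : Lp ℂ 2 (volume : Measure V)) a) := by
    refine integral_congr_ae ?_
    filter_upwards [fourier_toLp_ae_eq hu hu2, fourier_toLp_ae_eq hv hv2] with x h1 h2
    rw [h1, h2]; simp
  have e2 : ∫ x, u x * starRingEnd ℂ (v x) = ∫ a, inner ℂ (hv2.toLp v a) (hu2.toLp u a) := by
    refine integral_congr_ae ?_
    filter_upwards [hu2.coeFn_toLp, hv2.coeFn_toLp] with x h1 h2
    rw [h1, h2]; simp
  rw [e1, e2, h]

theorem integral_norm_sq_fourier {u : V → ℂ} (hu : Integrable u) (hu2 : MemLp u 2) :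
    ∫ ξ, ‖𝓕 u ξ‖ ^ 2 = ∫ x, ‖u x‖ ^ 2 := by
  have h := integral_fourier_mul_conj_fourier hu hu2 hu hu2
  simp only [Complex.mul_conj, Complex.normSq_eq_norm_sq] at h
  have h1 := integral_ofReal (𝕜 := ℂ) (f := fun ξ : V => ‖𝓕 u ξ‖ ^ 2) (μ := volume)
  have h2 := integral_ofReal (𝕜 := ℂ) (f := fun ξ : V => ‖u ξ‖ ^ 2) (μ := volume)
  have := (h1.symm.trans h).trans h2
  exact_mod_cast this

end Plancherel

/-! ### Fourier transforms of functions living on the ball. -/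

/-- The Euclidean space `ℝ^d`. -/
abbrev Space (d : ℕ) := EuclideanSpace ℝ (Fin d)


instance isFiniteMeasure_ballMeasure : IsFiniteMeasure (ballMeasure d) :=
  ⟨by simpa [ballMeasure, unitBall] using measure_closedBall_lt_top⟩

theorem measurableSet_unitBall : MeasurableSet (unitBall d) :=
  Metric.isClosed_closedBall.measurableSet

theorem neg_mem_unitBall {x : Space d} : -x ∈ unitBall d ↔ x ∈ unitBall d := by
  simp [unitBall]

/-- The Fourier transform of the extension by zero of a function on the unit ball. -/
def hat (u : Space d → ℂ) : Space d → ℂ := 𝓕 ((unitBall d).indicator u)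

/-- The Fourier transform of a real function on the unit ball. -/
def rhat (h : Space d → ℝ) : Space d → ℂ := hat fun x => (h x : ℂ)

theorem hat_apply (u : Space d → ℂ) (ξ : Space d) :
    hat u ξ = ∫ x, Real.fourierChar (-inner ℝ x ξ) • u x ∂(ballMeasure d) := by
  rw [hat, Real.fourier_eq, ballMeasure, ← integral_indicator measurableSet_unitBall]
  congr 1
  funext x
  by_cases hx : x ∈ unitBall d <;> simp [hx]

theorem integrable_indicator_of_integrable {u : Space d → ℂ} (hu : Integrable u (ballMeasure d)) :
    Integrable ((unitBall d).indicator u) :=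
  (integrable_indicator_iff measurableSet_unitBall).2 hu

theorem memLp_indicator_of_memLp {u : Space d → ℂ} {p : ℝ≥0∞} (hu : MemLp u p (ballMeasure d)) :
    MemLp ((unitBall d).indicator u) p :=
  (memLp_indicator_iff_restrict measurableSet_unitBall).2 hu

theorem hat_congr_ae {u v : Space d → ℂ} (h : u =ᵐ[ballMeasure d] v) : hat u = hat v := by
  funext ξ
  rw [hat_apply, hat_apply]
  refine integral_congr_ae ?_
  filter_upwards [h] with x hx
  rw [hx]

theorem hat_add {u v : Space d → ℂ} (hu : Integrable u (ballMeasure d))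
    (hv : Integrable v (ballMeasure d)) (ξ : Space d) :
    hat (fun x => u x + v x) ξ = hat u ξ + hat v ξ := by
  simp only [hat_apply, smul_add]
  exact integral_add ((Real.fourierIntegral_convergent_iff ξ).2 hu)
    ((Real.fourierIntegral_convergent_iff ξ).2 hv)

theorem hat_const_mul (c : ℂ) (u : Space d → ℂ) (ξ : Space d) :
    hat (fun x => c * u x) ξ = c * hat u ξ := by
  simp only [hat_apply, ← integral_const_mul]
  congr 1
  funext x
  simp only [Circle.smul_def, smul_eq_mul]
  ring

theorem continuous_hat {u : Space d → ℂ} (hu : Integrable u (ballMeasure d)) :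
    Continuous (hat u) :=
  continuous_fourier (integrable_indicator_of_integrable hu)

theorem norm_hat_le (u : Space d → ℂ) (ξ : Space d) : ‖hat u ξ‖ ≤ ∫ x, ‖u x‖ ∂(ballMeasure d) := by
  rw [hat_apply]
  refine (norm_integral_le_integral_norm _).trans_eq ?_
  simp

theorem memLp_hat {u : Space d → ℂ} (hu : MemLp u 2 (ballMeasure d)) : MemLp (hat u) 2 :=
  memLp_two_fourier (integrable_indicator_of_integrable (hu.integrable (by norm_num)))
    (memLp_indicator_of_memLp hu)

theorem integral_norm_sq_hat {u : Space d → ℂ} (hu : MemLp u 2 (ballMeasure d)) :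
    ∫ ξ, ‖hat u ξ‖ ^ 2 = ∫ x, ‖u x‖ ^ 2 ∂(ballMeasure d) := by
  rw [hat, integral_norm_sq_fourier
    (integrable_indicator_of_integrable (hu.integrable (by norm_num))) (memLp_indicator_of_memLp hu),
    ballMeasure, ← integral_indicator measurableSet_unitBall]
  congr 1
  funext x
  by_cases hx : x ∈ unitBall d <;> simp [hx]

theorem rhat_add {g h : Space d → ℝ} (hg : Integrable g (ballMeasure d))
    (hh : Integrable h (ballMeasure d)) (ξ : Space d) :
    rhat (fun x => g x + h x) ξ = rhat g ξ + rhat h ξ := by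
  simpa [rhat] using hat_add hg.ofReal hh.ofReal ξ

theorem rhat_const_mul (c : ℝ) (h : Space d → ℝ) (ξ : Space d) :
    rhat (fun x => c * h x) ξ = c * rhat h ξ := by
  simpa [rhat] using hat_const_mul (c : ℂ) (fun x => (h x : ℂ)) ξ

theorem rhat_congr_ae {g h : Space d → ℝ} (hgh : g =ᵐ[ballMeasure d] h) : rhat g = rhat h :=
  hat_congr_ae (by filter_upwards [hgh] with x hx; rw [hx])

theorem continuous_rhat {h : Space d → ℝ} (hh : Integrable h (ballMeasure d)) :
    Continuous (rhat h) := continuous_hat hh.ofReal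

theorem norm_rhat_le (h : Space d → ℝ) (ξ : Space d) :
    ‖rhat h ξ‖ ≤ ∫ x, |h x| ∂(ballMeasure d) := by
  simpa [rhat] using norm_hat_le (fun x => (h x : ℂ)) ξ

theorem memLp_rhat {h : Space d → ℝ} (hh : MemLp h 2 (ballMeasure d)) : MemLp (rhat h) 2 :=
  memLp_hat hh.ofReal

/-- Reflection invariance of the Lebesgue measure on the ball. -/
theorem measurePreserving_neg_ballMeasure :
    MeasurePreserving (fun x : Space d => -x) (ballMeasure d) (ballMeasure d) := by
  have h := (Measure.measurePreserving_neg (volume : Measure (Space d))).restrict_preimage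
    (measurableSet_unitBall (d := d))
  have h2 : Neg.neg ⁻¹' (unitBall d) = unitBall d := by
    ext x; exact neg_mem_unitBall
  rw [h2] at h
  exact h

theorem integral_comp_neg_ballMeasure {G : Type*} [NormedAddCommGroup G] [NormedSpace ℝ G]
    (u : Space d → G) :
    ∫ x, u (-x) ∂(ballMeasure d) = ∫ x, u x ∂(ballMeasure d) :=
  measurePreserving_neg_ballMeasure.integral_comp (MeasurableEquiv.neg _).measurableEmbedding u

/-- Conjugation reverses the phase, hence reflects the variable, and the ball is symmetric.
Conjugated factors in an even power of a modulus thus become transforms of functions on the same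
ball. -/
theorem conj_rhat (h : Space d → ℝ) (ξ : Space d) :
    starRingEnd ℂ (rhat h ξ) = rhat (fun x => h (-x)) ξ := by
  rw [rhat, rhat, hat_apply, hat_apply, ← integral_conj,
    ← integral_comp_neg_ballMeasure]
  congr 1
  funext x
  simp [Circle.smul_def, ← Circle.coe_inv_eq_conj, AddChar.map_neg_eq_inv]

/-- The Fourier transform of the indicator of the ball. -/
def ballHat (d : ℕ) : Space d → ℂ := 𝓕 (ballIndicator d)

theorem rhat_one : rhat (fun _ : Space d => 1) = ballHat d := by
  simp [rhat, hat, ballHat, ballIndicator]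

theorem conj_ballHat (ξ : Space d) : starRingEnd ℂ (ballHat d ξ) = ballHat d ξ := by
  rw [← rhat_one, conj_rhat]

theorem ballHat_re (ξ : Space d) : ((ballHat d ξ).re : ℂ) = ballHat d ξ :=
  Complex.conj_eq_iff_re.1 (conj_ballHat ξ)

theorem continuous_ballHat : Continuous (ballHat d) := by
  rw [← rhat_one]; exact continuous_rhat (integrable_const _)

theorem memLp_ballHat : MemLp (ballHat d) 2 := by
  rw [← rhat_one]; exact memLp_rhat (memLp_const _)

/-- The volume of the unit ball, a bound for `ballHat`. -/
def ballVol (d : ℕ) : ℝ := (ballMeasure d).real Set.univ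

theorem norm_ballHat_le (ξ : Space d) : ‖ballHat d ξ‖ ≤ ballVol d := by
  rw [← rhat_one]; simpa [ballVol] using norm_rhat_le (fun _ => 1) ξ

theorem ballVol_nonneg : 0 ≤ ballVol d := measureReal_nonneg

theorem integrable_mul_ballHat_pow {N : Space d → ℂ} (hN : Integrable N) (n : ℕ) :
    Integrable (fun ξ => N ξ * ballHat d ξ ^ n) := by
  refine hN.mul_bdd (c := ballVol d ^ n) (continuous_ballHat.pow n).aestronglyMeasurable ?_
  filter_upwards with ξ
  rw [norm_pow]
  exact pow_le_pow_left₀ (norm_nonneg _) (norm_ballHat_le ξ) n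

theorem integrable_mul_rhat {N : Space d → ℂ} (hN : Integrable N) {h : Space d → ℝ}
    (hh : Integrable h (ballMeasure d)) : Integrable (fun ξ => N ξ * rhat h ξ) :=
  hN.mul_bdd (continuous_rhat hh).aestronglyMeasurable (.of_forall fun ξ => norm_rhat_le h ξ)

/-! ### Inverse transforms and convolution over the ball. -/

/-- The real part of the inverse Fourier transform. -/
def rinv (N : Space d → ℂ) (s : Space d) : ℝ := (𝓕⁻ N s).re

theorem continuous_rinv {N : Space d → ℂ} (hN : Integrable N) : Continuous (rinv N) := by
  have : rinv N = fun s => (𝓕 N (-s)).re := by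
    funext s; rw [rinv, Real.fourierInv_eq_fourier_neg]
  rw [this]
  exact Complex.continuous_re.comp ((continuous_fourier hN).comp continuous_neg)

theorem abs_rinv_le (N : Space d → ℂ) (s : Space d) : |rinv N s| ≤ ∫ ξ, ‖N ξ‖ := by
  rw [rinv, Real.fourierInv_eq_fourier_neg]
  exact (Complex.abs_re_le_norm _).trans (norm_fourier_le _ _)

theorem rinv_add {N N' : Space d → ℂ} (hN : Integrable N) (hN' : Integrable N') (s : Space d) :
    rinv (fun ξ => N ξ + N' ξ) s = rinv N s + rinv N' s := by
  simp only [rinv, Real.fourierInv_eq_fourier_neg, Real.fourier_eq, smul_add]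
  rw [integral_add ((Real.fourierIntegral_convergent_iff _).2 hN)
    ((Real.fourierIntegral_convergent_iff _).2 hN'), Complex.add_re]

theorem rinv_const_mul (c : ℝ) (N : Space d → ℂ) (s : Space d) :
    rinv (fun ξ => c * N ξ) s = c * rinv N s := by
  simp only [rinv, Real.fourierInv_eq_fourier_neg, Real.fourier_eq]
  rw [← Complex.re_ofReal_mul, ← integral_const_mul]
  congr 2
  funext x
  simp only [Circle.smul_def, smul_eq_mul]
  ring

/-- The multiplication formula applied to χ and to N modulated by a character. This is the mechanism
that adds one more ball variable to a fibre. -/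
theorem integral_mul_rinv {N : Space d → ℂ} (hN : Integrable N) {χ : Space d → ℝ}
    (hχ : Integrable χ (ballMeasure d)) (s : Space d) :
    ∫ z, χ z * rinv N (s - z) ∂(ballMeasure d) = rinv (fun ξ => N ξ * rhat χ ξ) s := by
  set Ns : Space d → ℂ := fun ξ => Real.fourierChar (inner ℝ ξ s) • N ξ with hNs
  have hNsi : Integrable Ns := by
    have := (Real.fourierIntegral_convergent_iff (-s)).2 hN
    simpa [hNs] using this
  have h1 : ∀ z, 𝓕⁻ N (s - z) = 𝓕 Ns z := by
    intro z
    rw [Real.fourierInv_eq, Real.fourier_eq]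
    congr 1
    funext ξ
    rw [hNs, smul_smul, ← AddChar.map_add_eq_mul, inner_sub_right]
    congr 2
    ring
  have h2 := integral_fourier_mul_eq (integrable_indicator_of_integrable hχ.ofReal (d := d)) hNsi
  have h3 : ∫ x, (unitBall d).indicator (fun x => (χ x : ℂ)) x * 𝓕 Ns x
      = ∫ z, (χ z : ℂ) * 𝓕 Ns z ∂(ballMeasure d) := by
    rw [ballMeasure, ← integral_indicator measurableSet_unitBall]
    congr 1
    funext x
    by_cases hx : x ∈ unitBall d <;> simp [hx]
  have h4 : 𝓕⁻ (fun ξ => N ξ * rhat χ ξ) s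
      = ∫ ξ, 𝓕 ((unitBall d).indicator fun x => (χ x : ℂ)) ξ * Ns ξ := by
    rw [Real.fourierInv_eq]
    congr 1
    funext ξ
    simp only [hNs, rhat, hat, Circle.smul_def, smul_eq_mul]
    ring
  have hintegr : Integrable (fun z => (χ z : ℂ) * 𝓕 Ns z) (ballMeasure d) :=
    hχ.ofReal.mul_bdd (continuous_fourier hNsi).aestronglyMeasurable
      (.of_forall fun ξ => norm_fourier_le Ns ξ)
  have h5 := congrArg Complex.re (h4.trans (h2.trans h3))
  rw [rinv, h5]
  have h6 := integral_re hintegr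
  change _ = (∫ z, (χ z : ℂ) * 𝓕 Ns z ∂(ballMeasure d)).re
  refine Eq.trans ?_ h6
  congr 1
  funext z
  rw [rinv, h1]
  exact (Complex.re_ofReal_mul _ _).symm

/-- The inverse Fourier transform of a product of Fourier transforms is a convolution. -/
theorem integral_mul_indicator_sub {u v : Space d → ℝ} (hu : MemLp u 2 (ballMeasure d))
    (hv : MemLp v 2 (ballMeasure d)) (s : Space d) :
    ∫ z, u z * (unitBall d).indicator v (s - z) ∂(ballMeasure d)
      = rinv (fun ξ => rhat u ξ * rhat v ξ) s := by
  have hV1 : Integrable ((unitBall d).indicator fun x => (v x : ℂ)) :=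
    integrable_indicator_of_integrable (hv.integrable (by norm_num)).ofReal
  have hV2 : MemLp ((unitBall d).indicator fun x => (v x : ℂ)) 2 :=
    memLp_indicator_of_memLp hv.ofReal
  -- The transform of v need not be integrable, so the multiplication formula does not apply.
  -- Instead Plancherel pairs u with the reflected translate of v, whose conjugated transform is a
  -- character times that of v.
  set w : Space d → ℂ := fun x => (unitBall d).indicator (fun x => (v x : ℂ)) (s - x) with hw
  have hmp : MeasurePreserving (fun x : Space d => s - x) := Measure.measurePreserving_sub_left volume s
  have hw1 : Integrable w := hmp.integrable_comp_of_integrable hV1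
  have hw2 : MemLp w 2 := hV2.comp_measurePreserving hmp
  have hwhat : ∀ ξ, starRingEnd ℂ (𝓕 w ξ) = Real.fourierChar (inner ℝ ξ s) • rhat v ξ := by
    intro ξ
    have e1 : 𝓕 w ξ = ∫ y, Real.fourierChar (-inner ℝ (s - y) ξ)
        • (unitBall d).indicator (fun x => (v x : ℂ)) y := by
      rw [Real.fourier_eq, ← integral_sub_left_eq_self _ volume s]
      simp [hw]
    rw [e1, ← integral_conj, rhat, hat, Real.fourier_eq, Circle.smul_def, smul_eq_mul,
      ← integral_const_mul]
    congr 1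
    funext y
    by_cases hy : y ∈ unitBall d
    · simp only [hy, Set.indicator_of_mem, Circle.smul_def, smul_eq_mul, map_mul, Complex.conj_ofReal,
        ← Circle.coe_inv_eq_conj, ← AddChar.map_neg_eq_inv, ← mul_assoc, ← Circle.coe_mul,
        ← AddChar.map_add_eq_mul]
      congr 3
      rw [inner_sub_left, real_inner_comm s ξ]
      ring
    · simp [hy]
  have hU1 := integrable_indicator_of_integrable (hu.integrable (by norm_num)).ofReal (d := d)
  have hU2 := memLp_indicator_of_memLp (hu.ofReal (K := ℂ)) (d := d)
  have h := integral_fourier_mul_conj_fourier hU1 hU2 hw1 hw2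
  have h1 : 𝓕⁻ (fun ξ => rhat u ξ * rhat v ξ) s
      = ∫ x, (unitBall d).indicator (fun x => (u x : ℂ)) x * starRingEnd ℂ (w x) := by
    refine Eq.trans ?_ h
    rw [Real.fourierInv_eq]
    congr 1
    funext ξ
    rw [hwhat]
    simp only [rhat, hat, Circle.smul_def, smul_eq_mul, RCLike.ofReal_eq_complex_ofReal]
    ring
  have h2 : ∫ x, (unitBall d).indicator (fun x => (u x : ℂ)) x * starRingEnd ℂ (w x)
      = ((∫ z, u z * (unitBall d).indicator v (s - z) ∂(ballMeasure d) : ℝ) : ℂ) := by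
    rw [← integral_complex_ofReal, ballMeasure, ← integral_indicator measurableSet_unitBall]
    congr 1
    funext x
    by_cases hx : x ∈ unitBall d <;> by_cases hx' : s - x ∈ unitBall d <;> simp [hx, hx', hw]
  rw [rinv, h1, h2, Complex.ofReal_re]

/-! ### Quadratic integrals over the fibres of the sum map. -/

/-- Sum of the Fourier transforms of the first `n + 2` functions of a sequence. -/
def hatSum (h : ℕ → Space d → ℝ) (n : ℕ) (ξ : Space d) : ℂ :=
  ∑ j ∈ Finset.range (n + 2), rhat (h j) ξ

/-- Sum of the Fourier transforms of the squares of the first `n + 2` functions. -/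
def sqHatSum (h : ℕ → Space d → ℝ) (n : ℕ) (ξ : Space d) : ℂ :=
  ∑ j ∈ Finset.range (n + 2), rhat (fun x => h j x ^ 2) ξ

/-- Sum of the squares of the Fourier transforms of the first `n + 2` functions. -/
def hatSqSum (h : ℕ → Space d → ℝ) (n : ℕ) (ξ : Space d) : ℂ :=
  ∑ j ∈ Finset.range (n + 2), rhat (h j) ξ ^ 2

/-- The Fourier transform of `quadCoeff`. -/
def quadSymbol (h : ℕ → Space d → ℝ) (n : ℕ) (ξ : Space d) : ℂ :=
  sqHatSum h n ξ * ballHat d ξ ^ (n + 1)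
    + (hatSum h n ξ ^ 2 - hatSqSum h n ξ) * ballHat d ξ ^ n

/-- The `(n + 2)`-fold convolution of the indicator of the ball, i.e. the total mass of the fibre
`{z ∈ B ^ (n + 2) : ∑ z_j = s}`. -/
def fiberMass (d n : ℕ) (s : Space d) : ℝ := rinv (fun ξ => ballHat d ξ ^ (n + 2)) s

/-- The integral of `∑ h_j(z_j)` over the fibre `{z ∈ B ^ (n + 2) : ∑ z_j = s}`. -/
def linCoeff (h : ℕ → Space d → ℝ) (n : ℕ) (s : Space d) : ℝ :=
  rinv (fun ξ => hatSum h n ξ * ballHat d ξ ^ (n + 1)) s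

/-- The integral of `(∑ h_j(z_j))²` over the fibre `{z ∈ B ^ (n + 2) : ∑ z_j = s}`. -/
def quadCoeff (h : ℕ → Space d → ℝ) (n : ℕ) (s : Space d) : ℝ := rinv (quadSymbol h n) s

/-- The integral of `(t + ∑ h_j(z_j))²` over the fibre `{z ∈ B ^ (n + 2) : ∑ z_j = s}`. -/
def fiberQuad (h : ℕ → Space d → ℝ) (n : ℕ) (t : ℝ) (s : Space d) : ℝ :=
  t ^ 2 * fiberMass d n s + 2 * t * linCoeff h n s + quadCoeff h n s

theorem memLp_sq_of_top {g : Space d → ℝ} (hg : MemLp g ∞ (ballMeasure d)) :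
    MemLp (fun x => g x ^ 2) ∞ (ballMeasure d) := by
  simp only [pow_two]
  exact hg.mul hg

theorem integrable_rhat_mul_rhat {g h : Space d → ℝ} (hg : MemLp g 2 (ballMeasure d))
    (hh : MemLp h 2 (ballMeasure d)) : Integrable (fun ξ => rhat g ξ * rhat h ξ) :=
  (memLp_rhat hg).integrable_mul (memLp_rhat hh)

theorem integrable_rhat_mul_ballHat {g : Space d → ℝ} (hg : MemLp g 2 (ballMeasure d)) :
    Integrable (fun ξ => rhat g ξ * ballHat d ξ) :=
  (memLp_rhat hg).integrable_mul memLp_ballHat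

theorem integrable_rhat_mul_ballHat_pow {g : Space d → ℝ} (hg : MemLp g 2 (ballMeasure d)) (n : ℕ) :
    Integrable (fun ξ => rhat g ξ * ballHat d ξ ^ (n + 1)) := by
  simpa only [pow_succ', ← mul_assoc] using
    integrable_mul_ballHat_pow (integrable_rhat_mul_ballHat hg) n

theorem integrable_ballHat_pow (n : ℕ) : Integrable (fun ξ => ballHat d ξ ^ (n + 2)) := by
  have := integrable_rhat_mul_ballHat_pow (d := d) (g := fun _ => 1) (memLp_const _) n
  rw [rhat_one] at this
  simpa only [pow_succ' _ (n + 1)] using this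

theorem continuous_fiberMass (n : ℕ) : Continuous (fiberMass d n) :=
  continuous_rinv (integrable_ballHat_pow n)

section Sequence

variable {h : ℕ → Space d → ℝ}

theorem integrable_hatSum_mul (hh : ∀ j, MemLp (h j) 2 (ballMeasure d)) (n k : ℕ) :
    Integrable (fun ξ => hatSum h n ξ * ballHat d ξ ^ (k + 1)) := by
  simp only [hatSum, Finset.sum_mul]
  exact integrable_finsetSum _ fun j _ => integrable_rhat_mul_ballHat_pow (hh j) k

theorem continuous_linCoeff (hh : ∀ j, MemLp (h j) 2 (ballMeasure d)) (n : ℕ) :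
    Continuous (linCoeff h n) :=
  continuous_rinv (integrable_hatSum_mul hh n n)

theorem memLp_two_of_top {g : Space d → ℝ} (hg : MemLp g ∞ (ballMeasure d)) :
    MemLp g 2 (ballMeasure d) := hg.mono_exponent le_top

theorem integrable_of_top {g : Space d → ℝ} (hg : MemLp g ∞ (ballMeasure d)) :
    Integrable g (ballMeasure d) := hg.integrable le_top

theorem integrable_quadSymbol (hh : ∀ j, MemLp (h j) ∞ (ballMeasure d)) (n : ℕ) :
    Integrable (quadSymbol h n) := by
  refine Integrable.add ?_ ?_
  · simp only [sqHatSum, Finset.sum_mul]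
    exact integrable_finsetSum _ fun j _ =>
      integrable_rhat_mul_ballHat_pow (memLp_two_of_top (memLp_sq_of_top (hh j))) n
  · refine integrable_mul_ballHat_pow (N := fun ξ => hatSum h n ξ ^ 2 - hatSqSum h n ξ)
      (Integrable.sub (f := fun ξ => hatSum h n ξ ^ 2) (g := fun ξ => hatSqSum h n ξ) ?_ ?_) n
    · simp only [hatSum, pow_two, Finset.sum_mul_sum]
      exact integrable_finsetSum _ fun i _ => integrable_finsetSum _ fun j _ =>
        integrable_rhat_mul_rhat (memLp_two_of_top (hh i)) (memLp_two_of_top (hh j))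
    · simp only [hatSqSum, pow_two]
      exact integrable_finsetSum _ fun i _ =>
        integrable_rhat_mul_rhat (memLp_two_of_top (hh i)) (memLp_two_of_top (hh i))

theorem integrable_mul_rinv {N : Space d → ℂ} (hN : Integrable N) {χ : Space d → ℝ}
    (hχ : Integrable χ (ballMeasure d)) (s : Space d) :
    Integrable (fun z => χ z * rinv N (s - z)) (ballMeasure d) :=
  hχ.mul_bdd ((continuous_rinv hN).comp (continuous_const.sub continuous_id)).aestronglyMeasurable
    (.of_forall fun z => abs_rinv_le N (s - z))

theorem fiberMass_succ (n : ℕ) (s : Space d) :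
    fiberMass d (n + 1) s = ∫ z, fiberMass d n (s - z) ∂(ballMeasure d) := by
  have := integral_mul_rinv (integrable_ballHat_pow (d := d) n) (χ := fun _ => 1)
    (integrable_const _) s
  simp only [one_mul, rhat_one] at this
  exact this.symm

theorem integrable_fiberQuad_shift (hh : ∀ j, MemLp (h j) ∞ (ballMeasure d)) (n : ℕ)
    {χ : Space d → ℝ} (hχ : MemLp χ ∞ (ballMeasure d)) (s : Space d) :
    Integrable (fun z => fiberQuad h n (χ z) (s - z)) (ballMeasure d) := by
  refine ((integrable_mul_rinv (integrable_ballHat_pow n)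
    (integrable_of_top (memLp_sq_of_top hχ)) s).add ?_).add ?_
  · exact integrable_mul_rinv (integrable_hatSum_mul (fun j => memLp_two_of_top (hh j)) n n)
      ((integrable_of_top hχ).const_mul 2) s
  · simpa [quadCoeff] using
      integrable_mul_rinv (integrable_quadSymbol hh n) (integrable_const (1 : ℝ)) s

/-- Fubini on the fibre: fixing the last coordinate z moves the base point to s - z, and the value
of the last function joins the constant t. On the Fourier side this is an identity of symbols. -/
theorem fiberQuad_succ (hh : ∀ j, MemLp (h j) ∞ (ballMeasure d)) (n : ℕ) (t : ℝ) (s : Space d) :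
    fiberQuad h (n + 1) t s
      = ∫ z, fiberQuad h n (t + h (n + 2) z) (s - z) ∂(ballMeasure d) := by
  set χ := h (n + 2) with hχdef
  have hχ : MemLp χ ∞ (ballMeasure d) := hh _
  have hχ1 : Integrable χ (ballMeasure d) := integrable_of_top hχ
  have hχ2 : Integrable (fun x => χ x ^ 2) (ballMeasure d) := integrable_of_top (memLp_sq_of_top hχ)
  have htχ : MemLp (fun z => t + χ z) ∞ (ballMeasure d) := (memLp_const t).add hχ
  have hA := integrable_ballHat_pow (d := d) n
  have hB := integrable_hatSum_mul (fun j => memLp_two_of_top (hh j)) n n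
  have hC := integrable_quadSymbol hh n
  have i1 := integrable_mul_rinv hA (integrable_of_top (memLp_sq_of_top htχ)) s
  have i2 := integrable_mul_rinv hB ((integrable_of_top htχ).const_mul 2) s
  have i3 := integrable_mul_rinv hC (integrable_const (1 : ℝ)) s
  have e1 := integral_mul_rinv hA (integrable_of_top (memLp_sq_of_top htχ)) s
  have e2 := integral_mul_rinv hB ((integrable_of_top htχ).const_mul 2) s
  have e3 := integral_mul_rinv hC (integrable_const (1 : ℝ)) s
  have r1 : ∀ ξ, rhat (fun z => (t + χ z) ^ 2) ξ
      = t ^ 2 * ballHat d ξ + 2 * t * rhat χ ξ + rhat (fun x => χ x ^ 2) ξ := by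
    intro ξ
    have : (fun z => (t + χ z) ^ 2) = fun z => (t ^ 2 * 1 + 2 * t * χ z) + χ z ^ 2 := by
      funext z; ring
    rw [this, rhat_add (((integrable_const _).const_mul _).fun_add (hχ1.const_mul _)) hχ2,
      rhat_add ((integrable_const _).const_mul _) (hχ1.const_mul _),
      rhat_const_mul, rhat_const_mul, rhat_one]
    push_cast; ring
  have r2 : ∀ ξ, rhat (fun z => 2 * (t + χ z)) ξ = 2 * (t * ballHat d ξ + rhat χ ξ) := by
    intro ξ
    have : (fun z => 2 * (t + χ z)) = fun z => 2 * (t * 1 + χ z) := by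
      funext z; ring
    rw [this, rhat_const_mul, rhat_add ((integrable_const _).const_mul _) hχ1,
      rhat_const_mul, rhat_one]
    push_cast; ring
  simp only [one_mul, rhat_one] at e3 i3
  simp only [r1] at e1
  simp only [r2] at e2
  have hsplit : ∫ z, fiberQuad h n (t + χ z) (s - z) ∂(ballMeasure d)
      = (∫ z, (t + χ z) ^ 2 * rinv (fun ξ => ballHat d ξ ^ (n + 2)) (s - z) ∂(ballMeasure d))
        + (∫ z, 2 * (t + χ z) * rinv (fun ξ => hatSum h n ξ * ballHat d ξ ^ (n + 1)) (s - z)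
          ∂(ballMeasure d))
        + ∫ z, rinv (quadSymbol h n) (s - z) ∂(ballMeasure d) := by
    rw [← integral_add i1 i2, ← integral_add (i1.fun_add i2) i3]
    rfl
  rw [hsplit, e1, e2, e3]
  have hA' := integrable_ballHat_pow (d := d) (n + 1)
  have hB' := integrable_hatSum_mul (fun j => memLp_two_of_top (hh j)) (n + 1) (n + 1)
  have hC' := integrable_quadSymbol hh (n + 1)
  have hAχ := integrable_mul_rhat hA hχ1
  have hAχ2 := integrable_mul_rhat hA hχ2
  have hBχ := integrable_mul_rhat hB hχ1
  have hBF := integrable_mul_rhat hB (integrable_const (1 : ℝ))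
  have hAF := integrable_mul_rhat hA (integrable_const (1 : ℝ))
  have hCF := integrable_mul_rhat hC (integrable_const (1 : ℝ))
  simp only [rhat_one] at hBF hAF hCF
  -- The square of the new function enters through `sqHatSum`; its cross terms with the old ones are
  -- exactly the increment of `hatSum` squared minus `hatSqSum`.
  have hmain : ∀ ξ, (((t ^ 2 : ℝ) : ℂ) * ballHat d ξ ^ (n + 1 + 2)
        + ((2 * t : ℝ) : ℂ) * (hatSum h (n + 1) ξ * ballHat d ξ ^ (n + 1 + 1)))
        + quadSymbol h (n + 1) ξ
      = (ballHat d ξ ^ (n + 2)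
          * (t ^ 2 * ballHat d ξ + 2 * t * rhat χ ξ + rhat (fun x => χ x ^ 2) ξ)
        + hatSum h n ξ * ballHat d ξ ^ (n + 1) * (2 * (t * ballHat d ξ + rhat χ ξ)))
        + quadSymbol h n ξ * ballHat d ξ := by
    intro ξ
    have s1 : hatSum h (n + 1) ξ = hatSum h n ξ + rhat χ ξ := by
      rw [hatSum, Finset.sum_range_succ]; rfl
    have s2 : sqHatSum h (n + 1) ξ = sqHatSum h n ξ + rhat (fun x => χ x ^ 2) ξ := by
      rw [sqHatSum, Finset.sum_range_succ]; rfl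
    have s3 : hatSqSum h (n + 1) ξ = hatSqSum h n ξ + rhat χ ξ ^ 2 := by
      rw [hatSqSum, Finset.sum_range_succ]; rfl
    simp only [quadSymbol, s1, s2, s3]
    push_cast
    ring
  have lhs : fiberQuad h (n + 1) t s = rinv (fun ξ => (((t ^ 2 : ℝ) : ℂ) * ballHat d ξ ^ (n + 1 + 2)
        + ((2 * t : ℝ) : ℂ) * (hatSum h (n + 1) ξ * ballHat d ξ ^ (n + 1 + 1)))
        + quadSymbol h (n + 1) ξ) s := by
    rw [rinv_add ((hA'.const_mul _).fun_add (hB'.const_mul _)) hC',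
      rinv_add (hA'.const_mul _) (hB'.const_mul _), rinv_const_mul, rinv_const_mul]
    rfl
  rw [lhs]
  simp only [hmain]
  rw [rinv_add, rinv_add]
  · convert! ((hAF.const_mul ((t : ℂ) ^ 2)).add (hAχ.const_mul (2 * (t : ℂ)))).add hAχ2 using 1
    funext ξ
    simp only [Pi.add_apply]
    ring
  · convert! (hBF.const_mul (2 * (t : ℂ))).add (hBχ.const_mul 2) using 1
    funext ξ
    simp only [Pi.add_apply]
    ring
  · convert! (((hAF.const_mul ((t : ℂ) ^ 2)).add (hAχ.const_mul (2 * (t : ℂ)))).add hAχ2).add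
      ((hBF.const_mul (2 * (t : ℂ))).add (hBχ.const_mul 2)) using 1
    funext ξ
    simp only [Pi.add_apply]
    ring
  · exact hCF

/-- The square splits into a function of z, a function of y and a mixed term 2 h₀(z) h₁(y). Each is
a product of one-variable functions, so its fibre integral is an ordinary convolution. -/
theorem fiberQuad_zero_eq (hh : ∀ j, MemLp (h j) ∞ (ballMeasure d)) (t : ℝ) (s : Space d) :
    fiberQuad h 0 t s = ∫ z, (unitBall d).indicator (fun y => (t + h 0 z + h 1 y) ^ 2) (s - z)
      ∂(ballMeasure d) := by
  set p := h 0
  set r := h 1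
  have hp : MemLp p ∞ (ballMeasure d) := hh 0
  have hr : MemLp r ∞ (ballMeasure d) := hh 1
  have hp1 := integrable_of_top hp
  have hr1 := integrable_of_top hr
  have hp2 := integrable_of_top (memLp_sq_of_top hp)
  have hr2 := integrable_of_top (memLp_sq_of_top hr)
  have u1 : MemLp (fun z => t ^ 2 * 1 + 2 * t * p z + p z ^ 2) 2 (ballMeasure d) :=
    memLp_two_of_top ((((memLp_const 1).const_mul (t ^ 2)).add (hp.const_mul (2 * t))).add
      (memLp_sq_of_top hp))
  have v2 : MemLp (fun z => 2 * t * r z + r z ^ 2) 2 (ballMeasure d) :=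
    memLp_two_of_top ((hr.const_mul (2 * t)).add (memLp_sq_of_top hr))
  have u3 : MemLp (fun z => 2 * p z) 2 (ballMeasure d) := memLp_two_of_top (hp.const_mul 2)
  have c1 : MemLp (fun _ : Space d => (1 : ℝ)) 2 (ballMeasure d) := memLp_const _
  have hr' : MemLp r 2 (ballMeasure d) := memLp_two_of_top hr
  have e1 := integral_mul_indicator_sub u1 c1 s
  have e2 := integral_mul_indicator_sub c1 v2 s
  have e3 := integral_mul_indicator_sub u3 hr' s
  have hmain : ∀ ξ, (((t ^ 2 : ℝ) : ℂ) * ballHat d ξ ^ (0 + 2)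
        + ((2 * t : ℝ) : ℂ) * (hatSum h 0 ξ * ballHat d ξ ^ (0 + 1)))
        + quadSymbol h 0 ξ
      = (rhat (fun z => t ^ 2 * 1 + 2 * t * p z + p z ^ 2) ξ * rhat (fun _ => 1) ξ
        + rhat (fun _ => 1) ξ * rhat (fun z => 2 * t * r z + r z ^ 2) ξ)
        + rhat (fun z => 2 * p z) ξ * rhat r ξ := by
    intro ξ
    rw [rhat_add (((integrable_const _).const_mul _).fun_add (hp1.const_mul _)) hp2,
      rhat_add ((integrable_const _).const_mul _) (hp1.const_mul _),
      rhat_add (hr1.const_mul _) hr2, rhat_const_mul, rhat_const_mul, rhat_const_mul,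
      rhat_const_mul, rhat_one]
    simp only [quadSymbol, hatSum, sqHatSum, hatSqSum, Finset.sum_range_succ, Finset.sum_range_zero]
    push_cast
    ring
  have lhs : fiberQuad h 0 t s = rinv (fun ξ => (((t ^ 2 : ℝ) : ℂ) * ballHat d ξ ^ (0 + 2)
        + ((2 * t : ℝ) : ℂ) * (hatSum h 0 ξ * ballHat d ξ ^ (0 + 1)))
        + quadSymbol h 0 ξ) s := by
    have hA' := integrable_ballHat_pow (d := d) 0
    have hB' := integrable_hatSum_mul (fun j => memLp_two_of_top (hh j)) 0 0
    have hC' := integrable_quadSymbol hh 0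
    rw [rinv_add ((hA'.const_mul _).fun_add (hB'.const_mul _)) hC',
      rinv_add (hA'.const_mul _) (hB'.const_mul _), rinv_const_mul, rinv_const_mul]
    rfl
  rw [lhs]
  simp only [hmain]
  have j1 := integrable_rhat_mul_rhat u1 c1
  have j2 := integrable_rhat_mul_rhat c1 v2
  have j3 := integrable_rhat_mul_rhat u3 hr'
  rw [rinv_add (j1.fun_add j2) j3, rinv_add j1 j2, ← e1, ← e2, ← e3]
  have hmp : MeasurePreserving (fun x : Space d => s - x) := Measure.measurePreserving_sub_left volume s
  have key : ∀ {u v : Space d → ℝ}, MemLp u 2 (ballMeasure d) → MemLp v 2 (ballMeasure d) →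
      Integrable (fun z => u z * (unitBall d).indicator v (s - z)) (ballMeasure d) := by
    intro u v hu hv
    have : MemLp ((unitBall d).indicator v) 2 :=
      (memLp_indicator_iff_restrict measurableSet_unitBall).2 hv
    exact hu.integrable_mul ((this.comp_measurePreserving hmp).restrict _)
  rw [← integral_add (key u1 c1) (key c1 v2),
    ← integral_add ((key u1 c1).fun_add (key c1 v2)) (key u3 hr')]
  refine integral_congr_ae (.of_forall fun z => ?_)
  by_cases hz : s - z ∈ unitBall d
  · simp only [hz, Set.indicator_of_mem]
    ring
  · simp [hz]

/-- The definition by Fourier inversion hides the sign; the recursion exhibits an iterated integral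
of a square. -/
theorem fiberQuad_nonneg (hh : ∀ j, MemLp (h j) ∞ (ballMeasure d)) (n : ℕ) (t : ℝ) (s : Space d) :
    0 ≤ fiberQuad h n t s := by
  induction n generalizing t s with
  | zero =>
    rw [fiberQuad_zero_eq hh]
    exact integral_nonneg fun z => Set.indicator_nonneg (fun _ _ => sq_nonneg _) _
  | succ n ih =>
    rw [fiberQuad_succ hh]
    exact integral_nonneg fun z => ih _ _

end Sequence

/-! ### Positivity of the fibre mass. -/

theorem fiberMass_nonneg (n : ℕ) (s : Space d) : 0 ≤ fiberMass d n s := by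
  have h0 : ∀ j : ℕ, MemLp ((fun _ _ => 0 : ℕ → Space d → ℝ) j) ∞ (ballMeasure d) :=
    fun _ => memLp_const _
  have hz : rhat (fun _ : Space d => (0 : ℝ)) = fun _ => 0 := by
    funext ξ; simpa using rhat_const_mul 0 (fun _ : Space d => (0 : ℝ)) ξ
  have := fiberQuad_nonneg h0 n 1 s
  simpa [fiberQuad, linCoeff, quadCoeff, quadSymbol, hatSum, sqHatSum, hatSqSum, hz, rinv,
    Real.fourierInv_eq] using this

theorem fiberMass_zero_eq (s : Space d) : fiberMass d 0 s
    = ∫ z, (unitBall d).indicator (fun _ => (1 : ℝ)) (s - z) ∂(ballMeasure d) := by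
  have c1 : MemLp (fun _ : Space d => (1 : ℝ)) 2 (ballMeasure d) := memLp_const _
  have e := integral_mul_indicator_sub c1 c1 s
  simp only [rhat_one, one_mul] at e
  rw [e, fiberMass]
  simp only [pow_two, zero_add]

/-- For two variables, both can be taken near s/2. Further variables can be taken near 0, so the
radius 2 persists for every n; it is the radius that contains all sums of two points of the open
ball. -/
theorem fiberMass_pos (n : ℕ) {s : Space d} (hs : ‖s‖ < 2) : 0 < fiberMass d n s := by
  have hopen : ∀ (U : Set (Space d)), IsOpen U → U.Nonempty → U ⊆ unitBall d →
      ballMeasure d U ≠ 0 := by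
    intro U hU hne hsub
    rw [ballMeasure, Measure.restrict_apply hU.measurableSet, Set.inter_eq_left.2 hsub]
    exact hU.measure_ne_zero _ hne
  induction n generalizing s with
  | zero =>
    have hmeas : MeasurableSet ((fun z => s - z) ⁻¹' unitBall d) :=
      measurableSet_unitBall.preimage (measurable_const.sub measurable_id)
    have e2 : ∫ z, (unitBall d).indicator (fun _ => (1 : ℝ)) (s - z) ∂(ballMeasure d)
        = (ballMeasure d).real ((fun z => s - z) ⁻¹' unitBall d) := by
      rw [← integral_indicator_one hmeas]
      rfl
    rw [fiberMass_zero_eq, e2]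
    refine ENNReal.toReal_pos ?_ (measure_ne_top _ _)
    have hU : IsOpen (Metric.ball (0 : Space d) 1 ∩ (fun z => s - z) ⁻¹' Metric.ball 0 1) :=
      Metric.isOpen_ball.inter (Metric.isOpen_ball.preimage (continuous_const.sub continuous_id))
    have hn : ‖(1 / 2 : ℝ) • s‖ < 1 := by
      rw [norm_smul]; norm_num; linarith
    refine fun h0 => hopen _ hU ⟨(1 / 2 : ℝ) • s, ?_, ?_⟩ ?_ (measure_mono_null ?_ h0)
    · simpa using hn
    · have : s - (1 / 2 : ℝ) • s = (1 / 2 : ℝ) • s := by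
        rw [sub_eq_iff_eq_add, ← add_smul]; norm_num
      rw [Set.mem_preimage, this]
      simpa using hn
    · exact fun z hz => Metric.ball_subset_closedBall hz.1
    · intro z hz
      have hz2 : ‖s - z‖ < 1 := by simpa using hz.2
      simpa [unitBall] using hz2.le
  | succ n ih =>
    rw [fiberMass_succ]
    have hintegr : Integrable (fun z => fiberMass d n (s - z)) (ballMeasure d) := by
      simpa [fiberMass] using integrable_mul_rinv (integrable_ballHat_pow n) (integrable_const (1 : ℝ)) s
    rw [integral_pos_iff_support_of_nonneg (fun z => fiberMass_nonneg n _) hintegr]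
    have hU : IsOpen (Metric.ball (0 : Space d) 1 ∩ (fun z => s - z) ⁻¹' Metric.ball 0 2) :=
      Metric.isOpen_ball.inter (Metric.isOpen_ball.preimage (continuous_const.sub continuous_id))
    refine pos_iff_ne_zero.2 fun h0 => hopen _ hU ⟨0, ?_, ?_⟩ ?_ (measure_mono_null ?_ h0)
    · simp
    · simpa using hs
    · exact fun z hz => Metric.ball_subset_closedBall hz.1
    · intro z hz
      have : ‖s - z‖ < 2 := by simpa using hz.2
      exact (ih this).ne'

theorem integral_mul_le_sqrt_mul_sqrt {α : Type*} [MeasurableSpace α] {μ : Measure α} {a b : α → ℝ}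
    (ha : MemLp a 2 μ) (hb : MemLp b 2 μ) (ha0 : ∀ x, 0 ≤ a x) (hb0 : ∀ x, 0 ≤ b x) :
    ∫ x, a x * b x ∂μ ≤ √(∫ x, a x ^ 2 ∂μ) * √(∫ x, b x ^ 2 ∂μ) := by
  have h := integral_mul_le_Lp_mul_Lq_of_nonneg (p := 2) (q := 2) (μ := μ)
    Real.HolderConjugate.two_two (.of_forall ha0) (.of_forall hb0) (by simpa using ha)
    (by simpa using hb)
  simpa [Real.sqrt_eq_rpow] using h

/-! ### The second variation as a fibre integral. -/

/-- The quadratic form of the second variation at the exponent `N + 4`. -/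
def quadForm (N : ℕ) (g : Space d → ℝ) : ℝ :=
  ∫ x, fiberMass d (N + 1) x * g x ^ 2 ∂(ballMeasure d)
    - ∫ ξ, ‖ballHat d ξ‖ ^ (N + 2) * ((N + 3) * (rhat g ξ).im ^ 2 + (rhat g ξ).re ^ 2)

/-- The sequence with `r + 2` entries `-g(-x)` followed by entries `g`. -/
def signedSeq (r : ℕ) (g : Space d → ℝ) (j : ℕ) : Space d → ℝ :=
  if j < r + 2 then fun x => -g (-x) else g

theorem fiberMass_neg (n : ℕ) (s : Space d) : fiberMass d n (-s) = fiberMass d n s := by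
  have h : starRingEnd ℂ (𝓕⁻ (fun ξ => ballHat d ξ ^ (n + 2)) s)
      = 𝓕⁻ (fun ξ => ballHat d ξ ^ (n + 2)) (-s) := by
    rw [Real.fourierInv_eq, Real.fourierInv_eq, ← integral_conj]
    congr 1
    funext ξ
    simp [Circle.smul_def, ← Circle.coe_inv_eq_conj, AddChar.map_neg_eq_inv, conj_ballHat]
  rw [fiberMass, fiberMass, rinv, rinv, ← h, Complex.conj_re]

/-- The transform of the ball is real. This is how evenness of the exponent enters: it turns powers
of the modulus into polynomial symbols. -/
theorem norm_ballHat_pow_even {k : ℕ} (hk : Even k) (ξ : Space d) :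
    ((‖ballHat d ξ‖ ^ k : ℝ) : ℂ) = ballHat d ξ ^ k := by
  rw [← ballHat_re ξ, Complex.norm_real, Real.norm_eq_abs, hk.pow_abs]
  push_cast
  rfl

theorem memLp_comp_neg {p : ℝ≥0∞} {g : Space d → ℝ} (hg : MemLp g p (ballMeasure d)) :
    MemLp (fun x => g (-x)) p (ballMeasure d) :=
  hg.comp_measurePreserving measurePreserving_neg_ballMeasure

theorem memLp_signedSeq {p : ℝ≥0∞} {g : Space d → ℝ} (hg : MemLp g p (ballMeasure d)) (r j : ℕ) :
    MemLp (signedSeq r g j) p (ballMeasure d) := by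
  unfold signedSeq
  split_ifs
  · exact (memLp_comp_neg hg).neg
  · exact hg

theorem sum_signedSeq {G : Type*} [AddCommMonoid G] (r : ℕ) (g : Space d → ℝ)
    (Φ : (Space d → ℝ) → G) :
    ∑ j ∈ Finset.range (2 * r + 2 + 2), Φ (signedSeq r g j)
      = (r + 2) • Φ (fun x => -g (-x)) + (r + 2) • Φ g := by
  have : 2 * r + 2 + 2 = (r + 2) + (r + 2) := by ring
  rw [this, Finset.sum_range_add]
  congr 1
  · rw [Finset.sum_congr rfl (g := fun _ => Φ (fun x => -g (-x))), Finset.sum_const,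
      Finset.card_range]
    intro j hj
    rw [signedSeq, if_pos (Finset.mem_range.1 hj)]
  · rw [Finset.sum_congr rfl (g := fun _ => Φ g), Finset.sum_const, Finset.card_range]
    intro j hj
    rw [signedSeq, if_neg (by omega)]

theorem rhat_neg_comp_neg (g : Space d → ℝ) (ξ : Space d) :
    rhat (fun x => -g (-x)) ξ = -starRingEnd ℂ (rhat g ξ) := by
  rw [conj_rhat]
  simpa using rhat_const_mul (-1) (fun x => g (-x)) ξ

theorem integral_fiberMass_mul {χ : Space d → ℝ} (hχ : Integrable χ (ballMeasure d)) (n : ℕ) :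
    ∫ x, fiberMass d n x * χ x ∂(ballMeasure d)
      = (∫ ξ, ballHat d ξ ^ (n + 2) * rhat χ ξ).re := by
  have h := integral_mul_rinv (integrable_ballHat_pow (d := d) n) hχ 0
  rw [rinv, Real.fourierInv_eq] at h
  simp only [inner_zero_right, AddChar.map_zero_eq_one, one_smul] at h
  rw [← h]
  congr 1
  funext x
  rw [zero_sub, mul_comm]
  congr 1
  exact (fiberMass_neg n x).symm

theorem integrable_norm_ballHat_pow (n : ℕ) : Integrable (fun ξ => ‖ballHat d ξ‖ ^ (n + 2)) := by
  simpa using (integrable_ballHat_pow (d := d) n).norm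

theorem integrable_weighted_quad (N : ℕ) {g : Space d → ℝ} (hg : Integrable g (ballMeasure d)) :
    Integrable fun ξ => ‖ballHat d ξ‖ ^ (N + 2)
      * ((N + 3) * (rhat g ξ).im ^ 2 + (rhat g ξ).re ^ 2) := by
  have hc := continuous_rhat hg
  refine (integrable_norm_ballHat_pow N).mul_bdd
    (c := (N + 3) * (∫ x, |g x| ∂(ballMeasure d)) ^ 2 + (∫ x, |g x| ∂(ballMeasure d)) ^ 2) ?_ ?_
  · exact ((((Complex.continuous_im.comp hc).pow 2).const_mul _).add
      ((Complex.continuous_re.comp hc).pow 2)).aestronglyMeasurable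
  · refine .of_forall fun ξ => ?_
    have h1 := (Complex.abs_im_le_norm (rhat g ξ)).trans (norm_rhat_le g ξ)
    have h2 := (Complex.abs_re_le_norm (rhat g ξ)).trans (norm_rhat_le g ξ)
    rw [Real.norm_of_nonneg (by positivity)]
    rw [← sq_abs (rhat g ξ).im, ← sq_abs (rhat g ξ).re]
    gcongr

/-- With m = r + 2 entries of each kind, the transforms sum to 2mi Im ĝ and their squares to 2m((Re
ĝ)² - (Im ĝ)²). The off-diagonal symbol is then -2m((2m-1)(Im ĝ)² + (Re ĝ)²), and 2m - 1 = 2r + 3 is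
the weight in `quadForm`. The diagonal terms give the integral of K g², once for each entry. -/
theorem fiberQuad_signedSeq_eq {g : Space d → ℝ} (hg : MemLp g ∞ (ballMeasure d)) (r : ℕ) :
    fiberQuad (signedSeq r g) (2 * r + 2) 0 0 = (2 * r + 4) * quadForm (2 * r) g := by
  have hg1 := integrable_of_top hg
  have hg2 : Integrable (fun x => g x ^ 2) (ballMeasure d) := integrable_of_top (memLp_sq_of_top hg)
  have hg2' : Integrable (fun x => g (-x) ^ 2) (ballMeasure d) :=
    integrable_of_top (memLp_sq_of_top (memLp_comp_neg hg))
  have e1 := integral_fiberMass_mul hg2 (2 * r + 1)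
  have e2 := integral_fiberMass_mul hg2' (2 * r + 1)
  have e3 : ∫ x, fiberMass d (2 * r + 1) x * g (-x) ^ 2 ∂(ballMeasure d)
      = ∫ x, fiberMass d (2 * r + 1) x * g x ^ 2 ∂(ballMeasure d) := by
    rw [← integral_comp_neg_ballMeasure]
    simp only [fiberMass_neg, neg_neg]
  have i1 := integrable_mul_rhat (integrable_ballHat_pow (2 * r + 1)) hg2
  have i2 := integrable_mul_rhat (integrable_ballHat_pow (2 * r + 1)) hg2'
  have i3 := integrable_weighted_quad (2 * r) hg1
  have hsym : ∀ ξ, quadSymbol (signedSeq r g) (2 * r + 2) ξ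
      = (r + 2 : ℂ) * (ballHat d ξ ^ (2 * r + 1 + 2) * rhat (fun x => g (-x) ^ 2) ξ)
        + (r + 2 : ℂ) * (ballHat d ξ ^ (2 * r + 1 + 2) * rhat (fun x => g x ^ 2) ξ)
        + ((-(2 * r + 4) * (‖ballHat d ξ‖ ^ (2 * r + 2)
          * (((2 * r : ℕ) + 3) * (rhat g ξ).im ^ 2 + (rhat g ξ).re ^ 2)) : ℝ) : ℂ) := by
    intro ξ
    have s1 : hatSum (signedSeq r g) (2 * r + 2) ξ
        = (r + 2) • rhat (fun x => -g (-x)) ξ + (r + 2) • rhat g ξ :=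
      sum_signedSeq r g fun h => rhat h ξ
    have s2 : sqHatSum (signedSeq r g) (2 * r + 2) ξ
        = (r + 2) • rhat (fun x => (-g (-x)) ^ 2) ξ + (r + 2) • rhat (fun x => g x ^ 2) ξ :=
      sum_signedSeq r g fun h => rhat (fun x => h x ^ 2) ξ
    have s3 : hatSqSum (signedSeq r g) (2 * r + 2) ξ
        = (r + 2) • rhat (fun x => -g (-x)) ξ ^ 2 + (r + 2) • rhat g ξ ^ 2 :=
      sum_signedSeq r g fun h => rhat h ξ ^ 2
    have hpow := norm_ballHat_pow_even (d := d) (k := 2 * r + 2) ⟨r + 1, by ring⟩ ξ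
    rw [quadSymbol, s1, s2, s3, rhat_neg_comp_neg]
    rw [Complex.ofReal_mul, Complex.ofReal_mul, hpow]
    have hz := Complex.re_add_im (rhat g ξ)
    have hzc : starRingEnd ℂ (rhat g ξ) = (rhat g ξ).re - (rhat g ξ).im * Complex.I := by
      conv_lhs => rw [← hz]
      simp only [map_add, map_mul, Complex.conj_ofReal, Complex.conj_I]
      ring
    have hI := Complex.I_sq
    simp only [nsmul_eq_mul, neg_sq]
    push_cast
    rw [hzc]
    generalize ((rhat g ξ).re : ℂ) = a at hz ⊢
    generalize ((rhat g ξ).im : ℂ) = b at hz ⊢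
    rw [← hz]
    ring_nf
    rw [hI]
    ring
  have hq : fiberQuad (signedSeq r g) (2 * r + 2) 0 0
      = (∫ ξ, quadSymbol (signedSeq r g) (2 * r + 2) ξ).re := by
    rw [fiberQuad, quadCoeff, rinv, Real.fourierInv_eq]
    simp
  rw [hq]
  simp only [hsym]
  have i4 : Integrable fun ξ => ((-(2 * r + 4) * (‖ballHat d ξ‖ ^ (2 * r + 2)
      * (((2 * r : ℕ) + 3) * (rhat g ξ).im ^ 2 + (rhat g ξ).re ^ 2)) : ℝ) : ℂ) :=
    (i3.const_mul _).ofReal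
  rw [integral_add ((i2.const_mul _).fun_add (i1.const_mul _)) i4,
    integral_add (i2.const_mul _) (i1.const_mul _), integral_const_mul, integral_const_mul,
    integral_complex_ofReal, integral_const_mul]
  have hr : (r + 2 : ℂ) = ((r + 2 : ℝ) : ℂ) := by push_cast; rfl
  rw [hr, Complex.add_re, Complex.add_re, Complex.re_ofReal_mul, Complex.re_ofReal_mul, ← e1, ← e2,
    e3, Complex.ofReal_re, quadForm]
  push_cast
  ring

/-- Cauchy–Schwarz on the fibre, read off from the discriminant of a quadratic polynomial in t that
is nonnegative everywhere. -/
theorem sq_le_fiberMass_mul_fiberQuad {h : ℕ → Space d → ℝ}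
    (hh : ∀ j, MemLp (h j) ∞ (ballMeasure d)) (n : ℕ) (t : ℝ) (s : Space d) :
    (fiberMass d n s * t + linCoeff h n s) ^ 2 ≤ fiberMass d n s * fiberQuad h n t s := by
  have hd : discrim (fiberMass d n s) (2 * linCoeff h n s) (quadCoeff h n s) ≤ 0 :=
    discrim_le_zero fun x => by
      have := fiberQuad_nonneg hh n x s
      rw [fiberQuad] at this
      linarith
  rw [discrim] at hd
  rw [fiberQuad]
  nlinarith

/-! ### The defect in Cauchy's functional equation, and truncation. -/

/-- The defect in Cauchy's functional equation. -/
def cauchyDefect (r : ℕ) (g : Space d → ℝ) (p : Space d × Space d) : ℝ :=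
  fiberMass d (2 * r) (0 - p.1 - p.2) * (g p.1 + g p.2)
    + linCoeff (signedSeq r g) (2 * r) (0 - p.1 - p.2)

theorem aemeasurable_cauchyDefect (r : ℕ) {g : Space d → ℝ} (hg : MemLp g 2 (ballMeasure d)) :
    AEMeasurable (cauchyDefect r g) ((ballMeasure d).prod (ballMeasure d)) := by
  have hc : Continuous fun p : Space d × Space d => 0 - p.1 - p.2 := by fun_prop
  have h1 : AEMeasurable (fun p : Space d × Space d => g p.1 + g p.2)
      ((ballMeasure d).prod (ballMeasure d)) :=
    hg.1.aemeasurable.comp_fst.add hg.1.aemeasurable.comp_snd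
  have h2 : AEMeasurable (fun p : Space d × Space d => fiberMass d (2 * r) (0 - p.1 - p.2))
      ((ballMeasure d).prod (ballMeasure d)) :=
    ((continuous_fiberMass (2 * r)).comp hc).measurable.aemeasurable
  have h3 : AEMeasurable
      (fun p : Space d × Space d => linCoeff (signedSeq r g) (2 * r) (0 - p.1 - p.2))
      ((ballMeasure d).prod (ballMeasure d)) :=
    ((continuous_linCoeff (memLp_signedSeq hg r) (2 * r)).comp hc).measurable.aemeasurable
  exact (h2.mul h1).add h3

/-- The last two variables are peeled off the fibre. Their indices 2r + 2 and 2r + 3 are at least r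
+ 2, so both carry g itself rather than its reflected negative. -/
theorem lintegral_lintegral_fiberQuad {g : Space d → ℝ} (hg : MemLp g ∞ (ballMeasure d)) (r : ℕ) :
    ∫⁻ z, ∫⁻ w, ENNReal.ofReal
        (fiberQuad (signedSeq r g) (2 * r) (g z + g w) (0 - z - w))
        ∂(ballMeasure d) ∂(ballMeasure d)
      = ENNReal.ofReal ((2 * r + 4) * quadForm (2 * r) g) := by
  have hseq := memLp_signedSeq hg r
  have hlast : ∀ j, r + 2 ≤ j → signedSeq r g j = g := fun j hj => by
    rw [signedSeq, if_neg (by omega)]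
  have h1 : ∀ t s, fiberQuad (signedSeq r g) (2 * r + 1) t s
      = ∫ w, fiberQuad (signedSeq r g) (2 * r) (t + g w) (s - w) ∂(ballMeasure d) := by
    intro t s
    rw [fiberQuad_succ hseq, hlast _ (by omega)]
  have h2 : fiberQuad (signedSeq r g) (2 * r + 2) 0 0
      = ∫ z, fiberQuad (signedSeq r g) (2 * r + 1) (g z) (0 - z) ∂(ballMeasure d) := by
    rw [fiberQuad_succ hseq, hlast _ (by omega)]
    simp only [zero_add]
  rw [← fiberQuad_signedSeq_eq hg, h2, ofReal_integral_eq_lintegral_ofReal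
    (integrable_fiberQuad_shift hseq _ hg 0)
    (.of_forall fun z => fiberQuad_nonneg hseq _ _ _)]
  refine lintegral_congr fun z => ?_
  have hi : Integrable (fun w => fiberQuad (signedSeq r g) (2 * r) (g z + g w) (0 - z - w))
      (ballMeasure d) :=
    integrable_fiberQuad_shift hseq _ ((memLp_const (g z)).add hg) (0 - z)
  rw [h1, ofReal_integral_eq_lintegral_ofReal hi
    (.of_forall fun w => fiberQuad_nonneg hseq _ _ _)]

theorem cauchyDefect_sq_le {g : Space d → ℝ} (hg : MemLp g ∞ (ballMeasure d)) (r : ℕ)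
    (z w : Space d) :
    cauchyDefect r g (z, w) ^ 2 ≤ (∫ ξ, ‖ballHat d ξ ^ (2 * r + 2)‖)
      * fiberQuad (signedSeq r g) (2 * r) (g z + g w) (0 - z - w) := by
  have hseq := memLp_signedSeq hg r
  exact (sq_le_fiberMass_mul_fiberQuad hseq (2 * r) (g z + g w) (0 - z - w)).trans
    (mul_le_mul_of_nonneg_right ((le_abs_self _).trans (abs_rinv_le _ _))
      (fiberQuad_nonneg hseq _ _ _))

theorem lintegral_cauchyDefect_le {g : Space d → ℝ} (hg : MemLp g ∞ (ballMeasure d)) (r : ℕ) :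
    ∫⁻ p, ENNReal.ofReal (cauchyDefect r g p ^ 2) ∂((ballMeasure d).prod (ballMeasure d))
      ≤ ENNReal.ofReal ((∫ ξ, ‖ballHat d ξ ^ (2 * r + 2)‖)
        * ((2 * r + 4) * quadForm (2 * r) g)) := by
  have hpt := cauchyDefect_sq_le hg r
  have hA0 : 0 ≤ ∫ ξ, ‖ballHat d ξ ^ (2 * r + 2)‖ := integral_nonneg fun _ => norm_nonneg _
  generalize ∫ ξ, ‖ballHat d ξ ^ (2 * r + 2)‖ = A at hpt hA0 ⊢
  have hm : AEMeasurable (fun p => ENNReal.ofReal (cauchyDefect r g p ^ 2))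
      ((ballMeasure d).prod (ballMeasure d)) :=
    ((aemeasurable_cauchyDefect r (memLp_two_of_top hg)).pow_const 2).ennreal_ofReal
  rw [ENNReal.ofReal_mul hA0, ← lintegral_lintegral_fiberQuad hg, lintegral_prod _ hm,
    ← lintegral_const_mul' _ _ ENNReal.ofReal_ne_top]
  refine lintegral_mono fun z => ?_
  simp only []
  rw [← lintegral_const_mul' _ _ ENNReal.ofReal_ne_top]
  refine lintegral_mono fun w => ?_
  simp only []
  rw [← ENNReal.ofReal_mul hA0]
  exact ENNReal.ofReal_le_ofReal (hpt z w)

/-- Truncation of a real function at height `k`. -/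
def clamp (k : ℕ) (g : Space d → ℝ) (x : Space d) : ℝ := max (-(k : ℝ)) (min (g x) k)

theorem abs_clamp_le (k : ℕ) (g : Space d → ℝ) (x : Space d) : |clamp k g x| ≤ |g x| := by
  have hk : (0 : ℝ) ≤ k := Nat.cast_nonneg k
  unfold clamp
  rcases le_total (g x) k with h | h <;> rcases le_total (-(k : ℝ)) (g x) with h' | h' <;>
    rcases abs_cases (g x) with h1 | h1 <;> rw [abs_le] <;> constructor <;>
    simp only [max_def, min_def] <;> split_ifs <;> linarith

theorem abs_clamp_le_nat (k : ℕ) (g : Space d → ℝ) (x : Space d) : |clamp k g x| ≤ k := by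
  have hk : (0 : ℝ) ≤ k := Nat.cast_nonneg k
  rw [abs_le]
  exact ⟨le_max_left _ _, max_le (by linarith) (min_le_right _ _)⟩

theorem tendsto_clamp (g : Space d → ℝ) (x : Space d) :
    Tendsto (fun k => clamp k g x) atTop (𝓝 (g x)) := by
  refine tendsto_const_nhds.congr' ?_
  filter_upwards [eventually_ge_atTop ⌈|g x|⌉₊] with k hk
  have h : |g x| ≤ k := Nat.ceil_le.1 hk
  rw [abs_le] at h
  rw [clamp, min_eq_left h.2, max_eq_right h.1]

theorem aestronglyMeasurable_clamp (k : ℕ) {g : Space d → ℝ}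
    (hg : AEStronglyMeasurable g (ballMeasure d)) :
    AEStronglyMeasurable (clamp k g) (ballMeasure d) := by
  have hc : Continuous fun t : ℝ => max (-(k : ℝ)) (min t k) := by fun_prop
  exact hc.comp_aestronglyMeasurable hg

theorem memLp_clamp_top (k : ℕ) {g : Space d → ℝ} (hg : AEStronglyMeasurable g (ballMeasure d)) :
    MemLp (clamp k g) ∞ (ballMeasure d) :=
  memLp_top_of_bound (aestronglyMeasurable_clamp k hg) k (.of_forall fun x => abs_clamp_le_nat k g x)

section Dominated

variable {g : Space d → ℝ} {G : ℕ → Space d → ℝ}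

theorem tendsto_rhat (hg : Integrable g (ballMeasure d))
    (hG : ∀ k, AEStronglyMeasurable (G k) (ballMeasure d)) (hle : ∀ k x, |G k x| ≤ |g x|)
    (hlim : ∀ x, Tendsto (fun k => G k x) atTop (𝓝 (g x))) (ξ : Space d) :
    Tendsto (fun k => rhat (G k) ξ) atTop (𝓝 (rhat g ξ)) := by
  simp only [rhat, hat_apply]
  refine tendsto_integral_of_dominated_convergence (fun x => |g x|) ?_ hg.abs ?_ ?_
  · intro k
    have hc : Continuous fun x : Space d => Real.fourierChar (-inner ℝ x ξ) :=
      Real.continuous_fourierChar.comp (continuous_id.inner continuous_const).neg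
    exact hc.aestronglyMeasurable.smul
      (Complex.continuous_ofReal.comp_aestronglyMeasurable (hG k))
  · intro k
    refine .of_forall fun x => ?_
    simpa using hle k x
  · refine .of_forall fun x => ?_
    exact ((Complex.continuous_ofReal.tendsto _).comp (hlim x)).const_smul _

theorem tendsto_quadForm (N : ℕ) (hg : MemLp g 2 (ballMeasure d))
    (hG : ∀ k, AEStronglyMeasurable (G k) (ballMeasure d)) (hle : ∀ k x, |G k x| ≤ |g x|)
    (hlim : ∀ x, Tendsto (fun k => G k x) atTop (𝓝 (g x))) :
    Tendsto (fun k => quadForm N (G k)) atTop (𝓝 (quadForm N g)) := by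
  have hg1 : Integrable g (ballMeasure d) := hg.integrable (by norm_num)
  have hGi : ∀ k, Integrable (G k) (ballMeasure d) := fun k =>
    hg1.mono (hG k) (.of_forall fun x => hle k x)
  refine Tendsto.sub ?_ ?_
  · refine tendsto_integral_of_dominated_convergence
      (fun x => (∫ ξ, ‖ballHat d ξ ^ (N + 1 + 2)‖) * g x ^ 2) ?_ (hg.integrable_sq.const_mul _) ?_ ?_
    · exact fun k => (continuous_fiberMass _).aestronglyMeasurable.mul ((hG k).pow 2)
    · refine fun k => .of_forall fun x => ?_
      rw [norm_mul, norm_pow, Real.norm_eq_abs, Real.norm_eq_abs, ← sq_abs (g x)]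
      exact mul_le_mul (abs_rinv_le _ _) (pow_le_pow_left₀ (abs_nonneg _) (hle k x) 2)
        (by positivity) (integral_nonneg fun _ => norm_nonneg _)
    · exact .of_forall fun x => ((hlim x).pow 2).const_mul _
  · refine tendsto_integral_of_dominated_convergence
      (fun ξ => ‖ballHat d ξ‖ ^ (N + 2) * ((N + 3) * (∫ x, |g x| ∂(ballMeasure d)) ^ 2
        + (∫ x, |g x| ∂(ballMeasure d)) ^ 2)) ?_ ((integrable_norm_ballHat_pow N).mul_const _) ?_ ?_
    · exact fun k => (integrable_weighted_quad N (hGi k)).1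
    · refine fun k => .of_forall fun ξ => ?_
      have h0 : ‖rhat (G k) ξ‖ ≤ ∫ x, |g x| ∂(ballMeasure d) :=
        (norm_rhat_le _ _).trans (integral_mono (hGi k).abs hg1.abs (hle k))
      have h1 := (Complex.abs_im_le_norm _).trans h0
      have h2 := (Complex.abs_re_le_norm _).trans h0
      rw [Real.norm_of_nonneg (by positivity)]
      rw [← sq_abs (rhat (G k) ξ).im, ← sq_abs (rhat (G k) ξ).re]
      gcongr
    · refine .of_forall fun ξ => ?_
      have h := tendsto_rhat hg1 hG hle hlim ξ
      have him := (Complex.continuous_im.tendsto _).comp h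
      have hre := (Complex.continuous_re.tendsto _).comp h
      exact (((him.pow 2).const_mul _).add (hre.pow 2)).const_mul _

theorem integral_norm_mul_le_of_memLp {u : Space d → ℝ} (hu : MemLp u 2 (ballMeasure d)) (n : ℕ) :
    ∫ ξ, ‖rhat u ξ * ballHat d ξ ^ (n + 1)‖
      ≤ √(∫ x, u x ^ 2 ∂(ballMeasure d)) * √(∫ ξ, ‖ballHat d ξ ^ (n + 1)‖ ^ 2) := by
  have hF : MemLp (fun ξ => ballHat d ξ ^ (n + 1)) 2 := by
    have : MemLp (fun ξ => ballHat d ξ * ballHat d ξ ^ n) 2 := by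
      refine (memLp_ballHat.mul (r := 2) (p := ∞)
        (memLp_top_of_bound (continuous_ballHat.pow n).aestronglyMeasurable (ballVol d ^ n)
          (.of_forall fun ξ => ?_))).congr_norm ?_ (.of_forall fun ξ => ?_)
      · rw [Pi.pow_apply, norm_pow]
        exact pow_le_pow_left₀ (norm_nonneg _) (norm_ballHat_le ξ) n
      · exact (continuous_ballHat.mul (continuous_ballHat.pow n)).aestronglyMeasurable
      · simp [mul_comm]
    simpa only [pow_succ'] using this
  have h := integral_mul_le_sqrt_mul_sqrt (memLp_rhat hu).norm hF.norm
    (fun _ => norm_nonneg _) (fun _ => norm_nonneg _)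
  have h2 := integral_norm_sq_hat (u := fun x => (u x : ℂ)) hu.ofReal
  simp only [Complex.norm_real, Real.norm_eq_abs, sq_abs] at h2
  simp only [norm_mul]
  refine h.trans_eq ?_
  rw [← h2]
  rfl

/-- Convergence in L² suffices even for pointwise values of the inverse transform: Plancherel and
Cauchy–Schwarz against a power of F, itself in L², bound the difference. -/
theorem tendsto_rinv_rhat_mul (n : ℕ) (hg : MemLp g 2 (ballMeasure d))
    (hG : ∀ k, AEStronglyMeasurable (G k) (ballMeasure d)) (hle : ∀ k x, |G k x| ≤ |g x|)
    (hlim : ∀ x, Tendsto (fun k => G k x) atTop (𝓝 (g x))) (s : Space d) :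
    Tendsto (fun k => rinv (fun ξ => rhat (G k) ξ * ballHat d ξ ^ (n + 1)) s) atTop
      (𝓝 (rinv (fun ξ => rhat g ξ * ballHat d ξ ^ (n + 1)) s)) := by
  have hG2 : ∀ k, MemLp (G k) 2 (ballMeasure d) := fun k =>
    hg.mono (hG k) (.of_forall fun x => hle k x)
  have hD2 : ∀ k, MemLp (fun x => G k x + (-1) * g x) 2 (ballMeasure d) := fun k =>
    (hG2 k).add (hg.const_mul (-1))
  have hintegr : Tendsto (fun k => ∫ x, (G k x + (-1) * g x) ^ 2 ∂(ballMeasure d)) atTop (𝓝 0) := by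
    have : Tendsto (fun k => ∫ x, (G k x + (-1) * g x) ^ 2 ∂(ballMeasure d)) atTop
        (𝓝 (∫ _, (0 : ℝ) ∂(ballMeasure d))) := by
      refine tendsto_integral_of_dominated_convergence (fun x => 4 * g x ^ 2)
        (fun k => (hD2 k).1.pow 2) (hg.integrable_sq.const_mul 4) ?_ ?_
      · refine fun k => .of_forall fun x => ?_
        rw [norm_pow, Real.norm_eq_abs, ← sq_abs (g x)]
        have h1 : |G k x + (-1) * g x| ≤ 2 * |g x| := by
          refine (abs_add_le _ _).trans ?_
          rw [abs_mul, abs_neg, abs_one, one_mul]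
          linarith [hle k x]
        nlinarith [abs_nonneg (G k x + (-1) * g x)]
      · refine .of_forall fun x => ?_
        have := ((hlim x).add_const (-1 * g x)).pow 2
        simpa using this
    simpa using this
  have hbound : ∀ k, |rinv (fun ξ => rhat (G k) ξ * ballHat d ξ ^ (n + 1)) s
      - rinv (fun ξ => rhat g ξ * ballHat d ξ ^ (n + 1)) s|
      ≤ √(∫ x, (G k x + (-1) * g x) ^ 2 ∂(ballMeasure d))
        * √(∫ ξ, ‖ballHat d ξ ^ (n + 1)‖ ^ 2) := by
    intro k
    refine le_trans (le_of_eq ?_) ((abs_rinv_le _ s).trans (integral_norm_mul_le_of_memLp (hD2 k) n))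
    congr 1
    have e : ∀ ξ, rhat (fun x => G k x + (-1) * g x) ξ * ballHat d ξ ^ (n + 1)
        = rhat (G k) ξ * ballHat d ξ ^ (n + 1)
          + ((-1 : ℝ) : ℂ) * (rhat g ξ * ballHat d ξ ^ (n + 1)) := by
      intro ξ
      rw [rhat_add ((hG2 k).integrable (by norm_num))
        ((hg.integrable (by norm_num)).const_mul _), rhat_const_mul]
      ring
    simp only [e]
    rw [rinv_add (integrable_rhat_mul_ballHat_pow (hG2 k) n)
      ((integrable_rhat_mul_ballHat_pow hg n).const_mul _), rinv_const_mul]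
    ring
  rw [tendsto_iff_norm_sub_tendsto_zero]
  have hlim0 : Tendsto (fun k => √(∫ x, (G k x + (-1) * g x) ^ 2 ∂(ballMeasure d))
      * √(∫ ξ, ‖ballHat d ξ ^ (n + 1)‖ ^ 2)) atTop (𝓝 0) := by
    have := ((Real.continuous_sqrt.tendsto 0).comp hintegr).mul_const
      (√(∫ ξ, ‖ballHat d ξ ^ (n + 1)‖ ^ 2))
    simpa using this
  exact squeeze_zero (fun _ => norm_nonneg _) hbound hlim0

theorem linCoeff_eq_sum {h : ℕ → Space d → ℝ} (hh : ∀ j, MemLp (h j) 2 (ballMeasure d)) (n : ℕ)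
    (s : Space d) :
    linCoeff h n s
      = ∑ j ∈ Finset.range (n + 2), rinv (fun ξ => rhat (h j) ξ * ballHat d ξ ^ (n + 1)) s := by
  have key : ∀ t : Finset ℕ, rinv (fun ξ => ∑ j ∈ t, rhat (h j) ξ * ballHat d ξ ^ (n + 1)) s
      = ∑ j ∈ t, rinv (fun ξ => rhat (h j) ξ * ballHat d ξ ^ (n + 1)) s := by
    intro t
    induction t using Finset.induction_on with
    | empty => simp [rinv, Real.fourierInv_eq]
    | insert a t ha ih =>
      simp only [Finset.sum_insert ha]
      rw [rinv_add (integrable_rhat_mul_ballHat_pow (hh a) n)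
        (integrable_finsetSum _ fun j _ => integrable_rhat_mul_ballHat_pow (hh j) n), ih]
  rw [← key, linCoeff]
  simp only [hatSum, Finset.sum_mul]

theorem tendsto_linCoeff_signedSeq (r n : ℕ) (hg : MemLp g 2 (ballMeasure d))
    (hG : ∀ k, AEStronglyMeasurable (G k) (ballMeasure d)) (hle : ∀ k x, |G k x| ≤ |g x|)
    (hlim : ∀ x, Tendsto (fun k => G k x) atTop (𝓝 (g x))) (s : Space d) :
    Tendsto (fun k => linCoeff (signedSeq r (G k)) n s) atTop
      (𝓝 (linCoeff (signedSeq r g) n s)) := by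
  have hG2 : ∀ k, MemLp (G k) 2 (ballMeasure d) := fun k =>
    hg.mono (hG k) (.of_forall fun x => hle k x)
  simp only [linCoeff_eq_sum (memLp_signedSeq hg r), linCoeff_eq_sum (memLp_signedSeq (hG2 _) r)]
  refine tendsto_finsetSum _ fun j _ => ?_
  refine tendsto_rinv_rhat_mul n (memLp_signedSeq hg r j)
    (fun k => (memLp_signedSeq (hG2 k) r j).1) (fun k x => ?_) (fun x => ?_) s
  · unfold signedSeq
    split_ifs
    · simpa using hle k (-x)
    · exact hle k x
  · unfold signedSeq
    split_ifs
    · exact (hlim (-x)).neg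
    · exact hlim x

end Dominated

theorem quadForm_nonneg_of_top {g : Space d → ℝ} (hg : MemLp g ∞ (ballMeasure d)) (r : ℕ) :
    0 ≤ quadForm (2 * r) g := by
  have h := fiberQuad_nonneg (memLp_signedSeq hg r) (2 * r + 2) 0 0
  rw [fiberQuad_signedSeq_eq hg] at h
  exact nonneg_of_mul_nonneg_right h (by positivity)

theorem tendsto_quadForm_clamp {g : Space d → ℝ} (hg : MemLp g 2 (ballMeasure d)) (N : ℕ) :
    Tendsto (fun k => quadForm N (clamp k g)) atTop (𝓝 (quadForm N g)) :=
  tendsto_quadForm N hg (fun k => aestronglyMeasurable_clamp k hg.1)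
    (fun k x => abs_clamp_le k g x) (tendsto_clamp g)

theorem quadForm_nonneg {g : Space d → ℝ} (hg : MemLp g 2 (ballMeasure d)) (r : ℕ) :
    0 ≤ quadForm (2 * r) g :=
  ge_of_tendsto' (tendsto_quadForm_clamp hg (2 * r))
    fun k => quadForm_nonneg_of_top (memLp_clamp_top k hg.1) r

/-- The fibre identities are proved for bounded functions only. The forms of the truncations tend to
the form of g, which is zero, so their defects tend to zero in L², and Fatou's lemma transfers this
to g. -/
theorem cauchyDefect_ae_eq_zero {g : Space d → ℝ} (hg : MemLp g 2 (ballMeasure d)) (r : ℕ)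
    (h0 : quadForm (2 * r) g = 0) :
    ∀ᵐ p ∂((ballMeasure d).prod (ballMeasure d)), cauchyDefect r g p = 0 := by
  have hlim : ∀ p, Tendsto (fun k => ENNReal.ofReal (cauchyDefect r (clamp k g) p ^ 2)) atTop
      (𝓝 (ENNReal.ofReal (cauchyDefect r g p ^ 2))) := by
    intro p
    refine ENNReal.tendsto_ofReal (Tendsto.pow ?_ 2)
    exact (((tendsto_clamp g p.1).add (tendsto_clamp g p.2)).const_mul _).add
      (tendsto_linCoeff_signedSeq r _ hg (fun k => aestronglyMeasurable_clamp k hg.1)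
        (fun k x => abs_clamp_le k g x) (tendsto_clamp g) _)
  have hm : ∀ k, AEMeasurable (fun p => ENNReal.ofReal (cauchyDefect r (clamp k g) p ^ 2))
      ((ballMeasure d).prod (ballMeasure d)) := fun k =>
    ((aemeasurable_cauchyDefect r (memLp_two_of_top (memLp_clamp_top k hg.1))).pow_const
      2).ennreal_ofReal
  have hF := lintegral_liminf_le' (u := atTop) hm
  simp only [fun p => (hlim p).liminf_eq] at hF
  have hzero : Tendsto (fun k => ∫⁻ p, ENNReal.ofReal (cauchyDefect r (clamp k g) p ^ 2)
      ∂((ballMeasure d).prod (ballMeasure d))) atTop (𝓝 0) := by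
    have hub : Tendsto (fun k => ENNReal.ofReal ((∫ ξ, ‖ballHat d ξ ^ (2 * r + 2)‖)
        * ((2 * r + 4) * quadForm (2 * r) (clamp k g)))) atTop (𝓝 0) := by
      have := ((tendsto_quadForm_clamp hg (2 * r)).const_mul (2 * r + 4 : ℝ)).const_mul
        (∫ ξ, ‖ballHat d ξ ^ (2 * r + 2)‖)
      rw [h0, mul_zero, mul_zero] at this
      simpa using ENNReal.tendsto_ofReal this
    exact tendsto_of_tendsto_of_tendsto_of_le_of_le tendsto_const_nhds hub (fun _ => zero_le)
      (fun k => lintegral_cauchyDefect_le (memLp_clamp_top k hg.1) r)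
  rw [hzero.liminf_eq, nonpos_iff_eq_zero, lintegral_eq_zero_iff'
    ((aemeasurable_cauchyDefect r hg).pow_const 2).ennreal_ofReal] at hF
  filter_upwards [hF] with p hp
  have : cauchyDefect r g p ^ 2 ≤ 0 := by simpa using hp
  exact pow_eq_zero_iff two_ne_zero |>.1 (le_antisymm this (sq_nonneg _))

/-! ### Local solutions of Cauchy's equation, and the kernel of the second variation. -/

section LocalCauchy

variable {V : Type*} [NormedAddCommGroup V] [NormedSpace ℝ V] {φ : V → ℝ}

theorem map_nsmul_of_locally_additive
    (hadd : ∀ x y, ‖x‖ < 1 → ‖y‖ < 1 → ‖x + y‖ < 1 → φ (x + y) = φ x + φ y) (n : ℕ) {y : V}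
    (hy : (n + 1 : ℝ) * ‖y‖ < 1) : φ ((n + 1 : ℝ) • y) = (n + 1) * φ y := by
  induction n with
  | zero => simp
  | succ n ih =>
    push_cast at hy ⊢
    have h0 := norm_nonneg y
    have h1 : ((n : ℝ) + 1) * ‖y‖ < 1 := by nlinarith
    have hn : (0 : ℝ) ≤ n := Nat.cast_nonneg n
    have h2 : ‖((n : ℝ) + 1) • y‖ < 1 := by
      rw [norm_smul, Real.norm_of_nonneg (by positivity)]; exact h1
    have h3 : ‖((n : ℝ) + 1 + 1) • y‖ < 1 := by
      rw [norm_smul, Real.norm_of_nonneg (by positivity)]; exact hy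
    have h4 : ‖y‖ < 1 := by nlinarith
    rw [add_smul, one_smul] at h3 ⊢
    rw [hadd _ _ h2 h4 h3, ih h1]
    ring

/-- A continuous function which is additive on the unit ball is there the restriction of a
continuous linear form. -/
theorem exists_continuousLinearMap_of_locally_additive
    (hadd : ∀ x y, ‖x‖ < 1 → ‖y‖ < 1 → ‖x + y‖ < 1 → φ (x + y) = φ x + φ y)
    (hc : ContinuousAt φ 0) : ∃ T : V →L[ℝ] ℝ, ∀ x, ‖x‖ < 1 → φ x = T x := by
  have hmul : ∀ (n : ℕ) (x : V), ‖x‖ < 1 → φ x = (n + 1) * φ ((n + 1 : ℝ)⁻¹ • x) := by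
    intro n x hx
    have hn : (0 : ℝ) < n + 1 := by positivity
    rw [← map_nsmul_of_locally_additive hadd n, smul_inv_smul₀ hn.ne']
    rw [norm_smul, norm_inv, Real.norm_of_nonneg hn.le, mul_inv_cancel_left₀ hn.ne']
    exact hx
  have hlt : ∀ (n : ℕ) (x : V), ‖x‖ < n + 1 → ‖(n + 1 : ℝ)⁻¹ • x‖ < 1 := by
    intro n x hx
    have hn : (0 : ℝ) < n + 1 := by positivity
    rw [norm_smul, norm_inv, Real.norm_of_nonneg hn.le, inv_mul_lt_one₀ hn]
    exact hx
  -- φ is extended to the whole space by rescaling. Any n with ‖x‖ < n + 1 gives the same value, so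
  -- a single n serves x, y and x + y when additivity is checked.
  set A : V → ℝ := fun x => (⌊‖x‖⌋₊ + 1) * φ ((⌊‖x‖⌋₊ + 1 : ℝ)⁻¹ • x) with hA
  have hAn : ∀ (n : ℕ) (x : V), ‖x‖ < n + 1 → A x = (n + 1) * φ ((n + 1 : ℝ)⁻¹ • x) := by
    intro n x hx
    rw [hA]
    simp only
    rw [hmul n _ (hlt _ x (Nat.lt_floor_add_one ‖x‖)), hmul ⌊‖x‖⌋₊ _ (hlt n x hx), smul_comm]
    ring
  have hA1 : ∀ x, ‖x‖ < 1 → A x = φ x := by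
    intro x hx
    have := hAn 0 x (by simpa using hx)
    simpa using this
  have hAadd : ∀ x y, A (x + y) = A x + A y := by
    intro x y
    set n := ⌊‖x‖ + ‖y‖⌋₊
    have hn : ‖x‖ + ‖y‖ < n + 1 := Nat.lt_floor_add_one _
    have hx := norm_nonneg x
    have hy := norm_nonneg y
    have hxy := norm_add_le x y
    rw [hAn n (x + y) (by linarith), hAn n x (by linarith), hAn n y (by linarith), smul_add,
      hadd _ _ (hlt n x (by linarith)) (hlt n y (by linarith))]
    · ring
    · rw [← smul_add]
      exact hlt n _ (by linarith)
  let T₀ : V →+ ℝ := AddMonoidHom.mk' A hAadd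
  have hcA : Continuous T₀ := by
    refine continuous_of_continuousAt_zero T₀ (hc.congr ?_)
    filter_upwards [Metric.ball_mem_nhds (0 : V) one_pos] with x hx
    exact (hA1 x (by simpa using hx)).symm
  exact ⟨T₀.toRealLinearMap hcA, fun x hx => (hA1 x hx).symm⟩

end LocalCauchy

/-- The sphere is null. An open domain is wanted because on it almost everywhere equality of
continuous functions becomes equality everywhere. -/
theorem ballMeasure_eq_restrict_ball :
    ballMeasure d = volume.restrict (Metric.ball (0 : Space d) 1) := by
  refine Measure.restrict_congr_set ?_
  rw [unitBall, ← Metric.ball_union_sphere]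
  have h : volume (Metric.sphere (0 : Space d) 1) = 0 :=
    Measure.addHaar_sphere_of_ne_zero _ _ one_ne_zero
  exact union_ae_eq_left_of_ae_eq_empty (ae_eq_empty.2 h)

/-- Freezing one good point x₀ shows that g agrees almost everywhere with the continuous function y
↦ ψ(x₀ + y) - g(x₀). For this representative the equation holds everywhere on the open ball, and
subtracting its value at 0 leaves a locally additive function. -/
theorem exists_affine_of_add_eq {g ψ : Space d → ℝ}
    (hψ : ContinuousOn ψ (Metric.ball 0 2))
    (h : ∀ᵐ p ∂((ballMeasure d).prod (ballMeasure d)), g p.1 + g p.2 = ψ (p.1 + p.2)) :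
    ∃ (α : Space d) (b : ℝ), g =ᵐ[ballMeasure d] fun x => inner ℝ α x + b := by
  rw [ballMeasure_eq_restrict_ball] at h ⊢
  set U := Metric.ball (0 : Space d) 1 with hU
  have hUo : IsOpen U := Metric.isOpen_ball
  have hne : (volume.restrict U) ≠ 0 := by
    rw [Ne, Measure.restrict_eq_zero]
    exact hUo.measure_ne_zero _ ⟨0, by simp [hU]⟩
  have : (ae (volume.restrict U)).NeBot := ae_neBot.2 hne
  obtain ⟨x₀, hx₀, hx₀U⟩ := ((Measure.ae_ae_of_ae_prod h).and
    (ae_restrict_mem hUo.measurableSet)).exists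
  have hadd2 : ∀ x y : Space d, x ∈ U → y ∈ U → x + y ∈ Metric.ball (0 : Space d) 2 := by
    intro x y hx hy
    rw [hU, mem_ball_zero_iff] at hx hy
    rw [mem_ball_zero_iff]
    linarith [norm_add_le x y]
  set φ : Space d → ℝ := fun y => ψ (x₀ + y) - g x₀ with hφ
  have hgφ : g =ᵐ[volume.restrict U] φ := by
    filter_upwards [hx₀] with y hy
    simp only [hφ]
    linarith
  have hφc : ContinuousOn φ U :=
    (hψ.comp (by fun_prop) fun y hy => hadd2 x₀ y hx₀U hy).sub continuousOn_const
  have hae : (fun p : Space d × Space d => φ p.1 + φ p.2)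
      =ᵐ[(volume.prod volume).restrict (U ×ˢ U)] fun p => ψ (p.1 + p.2) := by
    rw [← Measure.prod_restrict]
    have h1 : ∀ᵐ p ∂((volume.restrict U).prod (volume.restrict U)), g p.1 = φ p.1 :=
      Measure.quasiMeasurePreserving_fst.ae hgφ
    have h2 : ∀ᵐ p ∂((volume.restrict U).prod (volume.restrict U)), g p.2 = φ p.2 :=
      Measure.quasiMeasurePreserving_snd.ae hgφ
    filter_upwards [h, h1, h2] with p hp hp1 hp2
    rw [← hp1, ← hp2, hp]
  have heq : ∀ x ∈ U, ∀ y ∈ U, φ x + φ y = ψ (x + y) := by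
    have := Measure.eqOn_open_of_ae_eq hae (hUo.prod hUo)
      ((hφc.comp continuousOn_fst fun p hp => hp.1).add
        (hφc.comp continuousOn_snd fun p hp => hp.2))
      (hψ.comp (by fun_prop) fun p hp => hadd2 _ _ hp.1 hp.2)
    exact fun x hx y hy => this (Set.mk_mem_prod hx hy)
  have h0U : (0 : Space d) ∈ U := by simp [hU]
  have hadd : ∀ x y : Space d, ‖x‖ < 1 → ‖y‖ < 1 → ‖x + y‖ < 1 →
      φ (x + y) - φ 0 = (φ x - φ 0) + (φ y - φ 0) := by
    intro x y hx hy hxy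
    have e1 := heq x (by simpa [hU] using hx) y (by simpa [hU] using hy)
    have e2 := heq (x + y) (by simpa [hU] using hxy) 0 h0U
    rw [add_zero] at e2
    linarith
  obtain ⟨T, hT⟩ := exists_continuousLinearMap_of_locally_additive (φ := fun x => φ x - φ 0) hadd
    ((hφc.continuousAt (hUo.mem_nhds h0U)).sub continuousAt_const)
  refine ⟨(InnerProductSpace.toDual ℝ (Space d)).symm T, φ 0, ?_⟩
  filter_upwards [hgφ, ae_restrict_mem hUo.measurableSet] with x hx hxU
  rw [hx, InnerProductSpace.toDual_symm_apply, ← hT x (by simpa [hU] using hxU)]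
  ring

/-- A vanishing defect can be solved for g(z) + g(w) as a function of z + w. The division is
legitimate, and the quotient continuous, on the ball of radius 2 where the fibre mass is positive.
-/
theorem exists_affine_of_quadForm_eq_zero {g : Space d → ℝ} (hg : MemLp g 2 (ballMeasure d))
    (r : ℕ) (h0 : quadForm (2 * r) g = 0) :
    ∃ (α : Space d) (b : ℝ), g =ᵐ[ballMeasure d] fun x => inner ℝ α x + b := by
  set L : Space d → ℝ := fun s => fiberMass d (2 * r) (-s) with hL
  set M : Space d → ℝ := fun s => linCoeff (signedSeq r g) (2 * r) (-s) with hM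
  have hLc : Continuous L := (continuous_fiberMass _).comp continuous_neg
  have hMc : Continuous M := (continuous_linCoeff (memLp_signedSeq hg r) _).comp continuous_neg
  have hLpos : ∀ s ∈ Metric.ball (0 : Space d) 2, 0 < L s := fun s hs =>
    fiberMass_pos _ (by simpa using hs)
  refine exists_affine_of_add_eq (ψ := fun s => -M s / L s)
    (hMc.neg.continuousOn.div hLc.continuousOn fun s hs => (hLpos s hs).ne') ?_
  have hU : ∀ᵐ x ∂(ballMeasure d), ‖x‖ < 1 := by
    rw [ballMeasure_eq_restrict_ball]
    filter_upwards [ae_restrict_mem Metric.isOpen_ball.measurableSet] with x hx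
    simpa using hx
  have h1 : ∀ᵐ p ∂((ballMeasure d).prod (ballMeasure d)), ‖p.1‖ < 1 :=
    Measure.quasiMeasurePreserving_fst.ae hU
  have h2 : ∀ᵐ p ∂((ballMeasure d).prod (ballMeasure d)), ‖p.2‖ < 1 :=
    Measure.quasiMeasurePreserving_snd.ae hU
  filter_upwards [cauchyDefect_ae_eq_zero hg r h0, h1, h2] with p hp hp1 hp2
  have hs : 0 < L (p.1 + p.2) := hLpos _ (by
    rw [mem_ball_zero_iff]; linarith [norm_add_le p.1 p.2])
  have e : 0 - p.1 - p.2 = -(p.1 + p.2) := by abel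
  rw [cauchyDefect, e] at hp
  rw [eq_div_iff hs.ne']
  simp only [hL, hM]
  linarith

/-- On the fibre the linear parts add up to α · s, so the integrand is constant. At s = 0 with the
signed sequence the constants cancel as well, and the second variation of an affine function
vanishes. -/
theorem fiberQuad_affine {h : ℕ → Space d → ℝ} (hh : ∀ j, MemLp (h j) ∞ (ballMeasure d))
    {α : Space d} {c : ℕ → ℝ} (hα : ∀ j x, h j x = inner ℝ α x + c j) (n : ℕ) (t : ℝ)
    (s : Space d) :
    fiberQuad h n t s
      = (t + inner ℝ α s + ∑ j ∈ Finset.range (n + 2), c j) ^ 2 * fiberMass d n s := by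
  induction n generalizing t s with
  | zero =>
    rw [fiberQuad_zero_eq hh, fiberMass_zero_eq, ← integral_const_mul]
    congr 1
    funext z
    by_cases hz : s - z ∈ unitBall d
    · simp only [hz, Set.indicator_of_mem, hα, Finset.sum_range_succ, Finset.sum_range_zero,
        inner_sub_right]
      ring
    · simp [hz]
  | succ n ih =>
    rw [fiberQuad_succ hh, fiberMass_succ, ← integral_const_mul]
    congr 1
    funext z
    rw [ih, hα, inner_sub_right, Finset.sum_range_succ _ (n + 2)]
    ring

theorem quadForm_affine (r : ℕ) (α : Space d) (b : ℝ) :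
    quadForm (2 * r) (fun x => inner ℝ α x + b) = 0 := by
  have hc : Continuous fun x : Space d => inner ℝ α x + b := by fun_prop
  obtain ⟨C, hC⟩ := (isCompact_closedBall (0 : Space d) 1).exists_bound_of_continuousOn
    hc.continuousOn
  have hg : MemLp (fun x => inner ℝ α x + b) ∞ (ballMeasure d) :=
    memLp_top_of_bound hc.aestronglyMeasurable C
      ((ae_restrict_mem measurableSet_unitBall).mono fun x hx => hC x hx)
  have hα : ∀ j x, signedSeq r (fun x => inner ℝ α x + b) j x
      = inner ℝ α x + if j < r + 2 then -b else b := by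
    intro j x
    unfold signedSeq
    split_ifs
    · simp only [inner_neg_right]; ring
    · rfl
  have hsum : ∑ j ∈ Finset.range (2 * r + 2 + 2), (if j < r + 2 then -b else b) = 0 := by
    have := sum_signedSeq r (fun _ : Space d => b) fun h => h 0
    simp only [smul_neg, neg_add_cancel] at this
    rw [← this]
    refine Finset.sum_congr rfl fun j _ => ?_
    unfold signedSeq
    split_ifs <;> rfl
  have h := fiberQuad_affine (memLp_signedSeq hg r) hα (2 * r + 2) 0 0
  rw [fiberQuad_signedSeq_eq hg, hsum] at h
  have h4 : (2 * r + 4 : ℝ) ≠ 0 := by positivity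
  simpa [h4] using h

/-! ### A spectral gap from weak compactness. -/

section WeakCompactness

variable {H : Type*} [NormedAddCommGroup H] [InnerProductSpace ℝ H] [CompleteSpace H]
  [TopologicalSpace.SeparableSpace H]

/-- Sequential Banach–Alaoglu in the dual, transported by the Riesz isometry. -/
theorem exists_weakly_convergent_subseq {x : ℕ → H} (hx : ∀ n, ‖x n‖ ≤ 1) :
    ∃ (y : H) (φ : ℕ → ℕ), StrictMono φ ∧ ‖y‖ ≤ 1 ∧
      ∀ z, Tendsto (fun n => inner ℝ (x (φ n)) z) atTop (𝓝 (inner ℝ y z)) := by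
  have hK := WeakDual.isSeqCompact_closedBall ℝ H (0 : StrongDual ℝ H) 1
  obtain ⟨f, hf, φ, hφ, hlim⟩ := hK (x := fun n =>
    StrongDual.toWeakDual (InnerProductSpace.toDual ℝ H (x n))) (fun n => by simpa using hx n)
  refine ⟨(InnerProductSpace.toDual ℝ H).symm (WeakDual.toStrongDual f), φ, hφ, ?_, fun z => ?_⟩
  · rw [LinearIsometryEquiv.norm_map]
    simpa using hf
  · have := ((WeakDual.eval_continuous (𝕜 := ℝ) (E := H) z).tendsto f).comp hlim
    rw [InnerProductSpace.toDual_symm_apply]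
    exact this

/-- A quadratic form `‖x‖² - B x ≥ 0` with `B` weakly continuous has a spectral gap. -/
theorem exists_gap_of_weakly_continuous {W : Submodule ℝ H} {B : H → ℝ}
    (hB : ∀ (x : ℕ → H) (y : H), (∀ n, ‖x n‖ ≤ 1) →
      (∀ z, Tendsto (fun n => inner ℝ (x n) z) atTop (𝓝 (inner ℝ y z))) →
      Tendsto (fun n => B (x n)) atTop (𝓝 (B y)))
    (hhom : ∀ (t : ℝ) (x : H), B (t • x) = t ^ 2 * B x)
    (hle : ∀ x, B x ≤ ‖x‖ ^ 2) (hker : ∀ x, B x = ‖x‖ ^ 2 → x ∈ W) :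
    ∃ c : ℝ, 0 < c ∧ ∀ x ∈ Wᗮ, c * ‖x‖ ^ 2 ≤ ‖x‖ ^ 2 - B x := by
  by_contra! hcon
  choose x hxW hx using fun n : ℕ => hcon (1 / (n + 1)) Nat.one_div_pos_of_nat
  have hpos : ∀ n, 0 < ‖x n‖ := by
    intro n
    rcases (norm_nonneg (x n)).eq_or_lt' with h | h
    · exfalso
      have h1 := hx n
      have h2 := hhom 0 (x n)
      rw [norm_eq_zero.1 h] at h1 h2
      simp at h1 h2
      linarith
    · exact h
  -- The normalised counterexamples have B(u n) at least 1 - 1/(n+1). A weak limit y satisfies 1 ≤ B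
  -- y ≤ ‖y‖² ≤ 1, hence lies in W; as a weak limit of vectors of Wᗮ it is orthogonal to itself,
  -- contradicting 1 ≤ ‖y‖².
  set u : ℕ → H := fun n => ‖x n‖⁻¹ • x n with hu
  have hu1 : ∀ n, ‖u n‖ = 1 := fun n => by
    simp [hu, norm_smul, (hpos n).ne']
  have huB : ∀ n : ℕ, 1 - 1 / (n + 1) ≤ B (u n) := by
    intro n
    have h := hx n
    have hp := hpos n
    rw [hu]
    simp only
    rw [hhom, inv_pow, ← div_eq_inv_mul, le_div_iff₀ (by positivity)]
    linarith
  obtain ⟨y, φ, hφ, hy, hlim⟩ := exists_weakly_convergent_subseq fun n => (hu1 n).le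
  have hBy := hB (u ∘ φ) y (fun n => (hu1 _).le) hlim
  have h1 : Tendsto (fun n : ℕ => 1 - 1 / ((φ n : ℝ) + 1)) atTop (𝓝 (1 - 0)) :=
    tendsto_const_nhds.sub (tendsto_one_div_add_atTop_nhds_zero_nat.comp hφ.tendsto_atTop)
  rw [sub_zero] at h1
  have h2 : 1 ≤ B y := le_of_tendsto_of_tendsto' h1 hBy fun n => huB (φ n)
  have h3 : ‖y‖ ^ 2 ≤ 1 := pow_le_one₀ (norm_nonneg _) hy
  have hyW : y ∈ W := hker y (le_antisymm (hle y) (h3.trans h2))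
  have hyW' : inner ℝ y y = 0 := by
    refine tendsto_nhds_unique (hlim y) (tendsto_const_nhds.congr fun n => ?_)
    have : u (φ n) ∈ Wᗮ := Wᗮ.smul_mem _ (hxW _)
    rw [Submodule.mem_orthogonal'] at this
    exact (this y hyW).symm
  rw [real_inner_self_eq_norm_sq] at hyW'
  linarith [hle y]

end WeakCompactness

/-! ### Coercivity of the second variation modulo affine functions. -/

theorem quadForm_congr_ae {g h : Space d → ℝ} (N : ℕ) (hgh : g =ᵐ[ballMeasure d] h) :
    quadForm N g = quadForm N h := by
  rw [quadForm, quadForm, rhat_congr_ae hgh]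
  congr 1
  refine integral_congr_ae ?_
  filter_upwards [hgh] with x hx
  rw [hx]

theorem integrable_fiberMass_mul {u : Space d → ℝ} (n : ℕ) (hu : Integrable u (ballMeasure d)) :
    Integrable (fun x => fiberMass d n x * u x) (ballMeasure d) :=
  hu.bdd_mul (continuous_fiberMass n).aestronglyMeasurable
    (.of_forall fun x => abs_rinv_le _ x)

theorem exists_quadForm_add_smul (N : ℕ) {g h : Space d → ℝ} (hg : MemLp g 2 (ballMeasure d))
    (hh : MemLp h 2 (ballMeasure d)) :
    ∃ b : ℝ, ∀ t : ℝ, quadForm N (fun x => g x + t * h x)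
      = quadForm N g + t * b + t ^ 2 * quadForm N h := by
  have hg1 : Integrable g (ballMeasure d) := hg.integrable (by norm_num)
  have hh1 : Integrable h (ballMeasure d) := hh.integrable (by norm_num)
  have i1 := integrable_fiberMass_mul (N + 1) hg.integrable_sq
  have i2 : Integrable (fun x => fiberMass d (N + 1) x * (g x * h x)) (ballMeasure d) :=
    integrable_fiberMass_mul (N + 1) (hg.integrable_mul hh)
  have i3 := integrable_fiberMass_mul (N + 1) hh.integrable_sq
  have j1 := integrable_weighted_quad N hg1
  have j3 := integrable_weighted_quad N hh1
  have j13 := integrable_weighted_quad N (hg1.add hh1)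
  have j2 : Integrable fun ξ => ‖ballHat d ξ‖ ^ (N + 2)
      * ((N + 3) * ((rhat g ξ).im * (rhat h ξ).im) + (rhat g ξ).re * (rhat h ξ).re) := by
    have := ((j13.sub j1).sub j3).const_mul (1 / 2 : ℝ)
    refine this.congr (.of_forall fun ξ => ?_)
    have e : rhat (g + h) ξ = rhat g ξ + rhat h ξ := rhat_add hg1 hh1 ξ
    simp only [Pi.sub_apply, e, Complex.add_im, Complex.add_re]
    ring
  refine ⟨2 * (∫ x, fiberMass d (N + 1) x * (g x * h x) ∂(ballMeasure d))
    - 2 * ∫ ξ, ‖ballHat d ξ‖ ^ (N + 2)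
      * ((N + 3) * ((rhat g ξ).im * (rhat h ξ).im) + (rhat g ξ).re * (rhat h ξ).re), fun t => ?_⟩
  have e1 : ∫ x, fiberMass d (N + 1) x * (g x + t * h x) ^ 2 ∂(ballMeasure d)
      = ∫ x, fiberMass d (N + 1) x * g x ^ 2 ∂(ballMeasure d)
        + (2 * t) * (∫ x, fiberMass d (N + 1) x * (g x * h x) ∂(ballMeasure d))
        + t ^ 2 * ∫ x, fiberMass d (N + 1) x * h x ^ 2 ∂(ballMeasure d) := by
    rw [← integral_const_mul, ← integral_const_mul, ← integral_add i1 (i2.const_mul _),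
      ← integral_add (i1.fun_add (i2.const_mul _)) (i3.const_mul _)]
    congr 1
    funext x
    ring
  have e2 : ∫ ξ, ‖ballHat d ξ‖ ^ (N + 2) * ((N + 3) * (rhat (fun x => g x + t * h x) ξ).im ^ 2
        + (rhat (fun x => g x + t * h x) ξ).re ^ 2)
      = (∫ ξ, ‖ballHat d ξ‖ ^ (N + 2) * ((N + 3) * (rhat g ξ).im ^ 2 + (rhat g ξ).re ^ 2))
        + (2 * t) * (∫ ξ, ‖ballHat d ξ‖ ^ (N + 2)
          * ((N + 3) * ((rhat g ξ).im * (rhat h ξ).im) + (rhat g ξ).re * (rhat h ξ).re))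
        + t ^ 2 * ∫ ξ, ‖ballHat d ξ‖ ^ (N + 2)
          * ((N + 3) * (rhat h ξ).im ^ 2 + (rhat h ξ).re ^ 2) := by
    rw [← integral_const_mul, ← integral_const_mul, ← integral_add j1 (j2.const_mul _),
      ← integral_add (j1.fun_add (j2.const_mul _)) (j3.const_mul _)]
    congr 1
    funext ξ
    rw [rhat_add hg1 (hh1.const_mul t), rhat_const_mul, Complex.add_im, Complex.add_re,
      Complex.im_ofReal_mul, Complex.re_ofReal_mul]
    ring
  rw [quadForm, quadForm, quadForm, e1, e2]
  ring

/-- Along a null direction a nonnegative quadratic form is affine in t and bounded below, hence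
constant. -/
theorem quadForm_add_of_eq_zero (r : ℕ) {g h : Space d → ℝ} (hg : MemLp g 2 (ballMeasure d))
    (hh : MemLp h 2 (ballMeasure d)) (h0 : quadForm (2 * r) h = 0) (t : ℝ) :
    quadForm (2 * r) (fun x => g x + t * h x) = quadForm (2 * r) g := by
  obtain ⟨b, hb⟩ := exists_quadForm_add_smul (2 * r) hg hh
  have hpos : ∀ t : ℝ, 0 ≤ quadForm (2 * r) g + t * b := by
    intro t
    have := quadForm_nonneg (hg.add (hh.const_mul t)) r
    have e := hb t
    rw [h0, mul_zero, add_zero] at e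
    rw [← e]
    exact this
  have hb0 : b = 0 := by
    by_contra hne
    have := hpos (-(quadForm (2 * r) g + 1) / b)
    rw [div_mul_cancel₀ _ hne] at this
    linarith
  rw [hb, h0, hb0]
  ring

theorem quadForm_const_mul (N : ℕ) (t : ℝ) (g : Space d → ℝ) :
    quadForm N (fun x => t * g x) = t ^ 2 * quadForm N g := by
  have e1 : ∫ x, fiberMass d (N + 1) x * (t * g x) ^ 2 ∂(ballMeasure d)
      = t ^ 2 * ∫ x, fiberMass d (N + 1) x * g x ^ 2 ∂(ballMeasure d) := by
    rw [← integral_const_mul]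
    congr 1
    funext x
    ring
  have e2 : ∫ ξ, ‖ballHat d ξ‖ ^ (N + 2) * ((N + 3) * (rhat (fun x => t * g x) ξ).im ^ 2
        + (rhat (fun x => t * g x) ξ).re ^ 2)
      = t ^ 2 * ∫ ξ, ‖ballHat d ξ‖ ^ (N + 2)
          * ((N + 3) * (rhat g ξ).im ^ 2 + (rhat g ξ).re ^ 2) := by
    rw [← integral_const_mul]
    congr 1
    funext ξ
    rw [rhat_const_mul, Complex.im_ofReal_mul, Complex.re_ofReal_mul]
    ring
  rw [quadForm, quadForm, e1, e2]
  ring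

/-- The symbol of the kernel is F^{2r+3}, a convolution of 2r + 3 balls; since `fiberMass` counts n
+ 2 factors, the index is 2r + 1. -/
theorem kernel_even_eq_fiberMass (r : ℕ) :
    kernel d ((2 * r + 4 : ℕ) : ℝ) = fiberMass d (2 * r + 1) := by
  have h : kernelHat d ((2 * r + 4 : ℕ) : ℝ) = fun ξ => ballHat d ξ ^ (2 * r + 1 + 2) := by
    funext ξ
    have e : (((2 * r + 4 : ℕ) : ℝ) - 2) = ((2 * r + 2 : ℕ) : ℝ) := by push_cast; ring
    have h2 := norm_ballHat_pow_even (d := d) (k := 2 * r + 2) ⟨r + 1, by ring⟩ ξ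
    rw [kernelHat, e, Real.rpow_natCast]
    change ((‖ballHat d ξ‖ ^ (2 * r + 2) : ℝ) : ℂ) * ballHat d ξ = _
    rw [h2]
    ring
  funext x
  rw [kernel, h]
  rfl

theorem exists_fiberMass_lower_bound (n : ℕ) :
    ∃ κ : ℝ, 0 < κ ∧ ∀ x ∈ unitBall d, κ ≤ fiberMass d n x := by
  obtain ⟨x, hx, hmin⟩ := (isCompact_closedBall (0 : Space d) 1).exists_isMinOn
    ⟨0, by simp⟩ (continuous_fiberMass n).continuousOn
  refine ⟨fiberMass d n x, fiberMass_pos n ?_, fun y hy => hmin hy⟩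
  have : ‖x‖ ≤ 1 := by simpa using hx
  linarith

/-- Division of an element of `L²(B)` by the square root of the kernel. -/
def unweight (n : ℕ) (G : Lp ℝ 2 (ballMeasure d)) (x : Space d) : ℝ := G x / √(fiberMass d n x)

theorem memLp_inv_sqrt_fiberMass_mul (n : ℕ) {u : Space d → ℝ} (hu : MemLp u 2 (ballMeasure d)) :
    MemLp (fun x => u x / √(fiberMass d n x)) 2 (ballMeasure d) := by
  obtain ⟨κ, hκ, hle⟩ := exists_fiberMass_lower_bound (d := d) n
  have htop : MemLp (fun x => (√(fiberMass d n x))⁻¹) ∞ (ballMeasure d) := by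
    refine memLp_top_of_bound
      (continuous_fiberMass n).sqrt.measurable.inv.aestronglyMeasurable (√κ)⁻¹ ?_
    filter_upwards [ae_restrict_mem measurableSet_unitBall] with x hx
    rw [norm_inv, Real.norm_of_nonneg (Real.sqrt_nonneg _)]
    exact inv_anti₀ (Real.sqrt_pos.2 hκ) (Real.sqrt_le_sqrt (hle x hx))
  simp only [div_eq_mul_inv]
  exact htop.mul (r := 2) hu

theorem memLp_unweight (n : ℕ) (G : Lp ℝ 2 (ballMeasure d)) :
    MemLp (unweight n G) 2 (ballMeasure d) :=
  memLp_inv_sqrt_fiberMass_mul n (Lp.memLp G)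

theorem fiberMass_mul_unweight_sq (n : ℕ) (G : Lp ℝ 2 (ballMeasure d)) {x : Space d}
    (hx : x ∈ unitBall d) : fiberMass d n x * unweight n G x ^ 2 = G x ^ 2 := by
  obtain ⟨κ, hκ, hle⟩ := exists_fiberMass_lower_bound (d := d) n
  have h := hκ.trans_le (hle x hx)
  rw [unweight, div_pow, Real.sq_sqrt h.le, mul_div_cancel₀ _ h.ne']

theorem norm_sq_eq_integral (G : Lp ℝ 2 (ballMeasure d)) :
    ‖G‖ ^ 2 = ∫ x, G x ^ 2 ∂(ballMeasure d) := by
  rw [← real_inner_self_eq_norm_sq, L2.inner_def]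
  simp [pow_two]

theorem integral_fiberMass_mul_unweight_sq (n : ℕ) (G : Lp ℝ 2 (ballMeasure d)) :
    ∫ x, fiberMass d n x * unweight n G x ^ 2 ∂(ballMeasure d) = ‖G‖ ^ 2 := by
  rw [norm_sq_eq_integral]
  refine integral_congr_ae ?_
  filter_upwards [ae_restrict_mem measurableSet_unitBall] with x hx
  exact fiberMass_mul_unweight_sq n G hx

theorem exists_integral_abs_unweight_le (n : ℕ) :
    ∃ C : ℝ, 0 ≤ C ∧ ∀ G : Lp ℝ 2 (ballMeasure d),
      ∫ x, |unweight n G x| ∂(ballMeasure d) ≤ C * ‖G‖ := by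
  obtain ⟨κ, hκ, hle⟩ := exists_fiberMass_lower_bound (d := d) n
  refine ⟨√(ballVol d) * (√κ)⁻¹, by positivity, fun G => ?_⟩
  have hc := integral_mul_le_sqrt_mul_sqrt (μ := ballMeasure d) (a := fun _ => (1 : ℝ))
    (b := fun x => |unweight n G x|) (memLp_const 1) (memLp_unweight n G).abs
    (fun _ => zero_le_one) (fun _ => abs_nonneg _)
  simp only [one_mul, one_pow, sq_abs, integral_const, smul_eq_mul, mul_one] at hc
  refine hc.trans ?_
  rw [mul_assoc]
  refine mul_le_mul_of_nonneg_left ?_ (Real.sqrt_nonneg _)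
  rw [← Real.sqrt_inv, ← Real.sqrt_sq (norm_nonneg G), ← Real.sqrt_mul (by positivity)]
  refine Real.sqrt_le_sqrt ?_
  rw [← integral_fiberMass_mul_unweight_sq n G, ← integral_const_mul]
  refine integral_mono_ae (memLp_unweight n G).integrable_sq
    ((integrable_fiberMass_mul n (memLp_unweight n G).integrable_sq).const_mul _) ?_
  filter_upwards [ae_restrict_mem measurableSet_unitBall] with x hx
  rw [← mul_assoc, ← div_eq_inv_mul]
  exact le_mul_of_one_le_left (sq_nonneg _) ((one_le_div hκ).2 (hle x hx))

/-- K^{-1/2} is bounded on the ball, so evaluating the transform at a fixed frequency is a bounded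
functional of G = K^{1/2} g. Weak convergence of G thus yields pointwise convergence of the
transforms. -/
theorem exists_rhat_unweight_eq_inner (n : ℕ) (ξ : Space d) :
    ∃ a b : Lp ℝ 2 (ballMeasure d), ∀ G : Lp ℝ 2 (ballMeasure d),
      (rhat (unweight n G) ξ).re = inner ℝ G a ∧ (rhat (unweight n G) ξ).im = inner ℝ G b := by
  set e : Space d → ℂ := fun x => (Real.fourierChar (-inner ℝ x ξ) : ℂ) with he
  have hec : Continuous e := by
    have hc : Continuous fun x : Space d => Real.fourierChar (-inner ℝ x ξ) :=
      Real.continuous_fourierChar.comp (continuous_id.inner continuous_const).neg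
    exact continuous_subtype_val.comp hc
  have hen : ∀ x, ‖e x‖ = 1 := fun x => Circle.norm_coe _
  have hre : MemLp (fun x => (e x).re) 2 (ballMeasure d) :=
    MemLp.of_bound (Complex.continuous_re.comp hec).aestronglyMeasurable 1
      (.of_forall fun x => (Complex.abs_re_le_norm _).trans (hen x).le)
  have him : MemLp (fun x => (e x).im) 2 (ballMeasure d) :=
    MemLp.of_bound (Complex.continuous_im.comp hec).aestronglyMeasurable 1
      (.of_forall fun x => (Complex.abs_im_le_norm _).trans (hen x).le)
  have hre' := memLp_inv_sqrt_fiberMass_mul n hre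
  have him' := memLp_inv_sqrt_fiberMass_mul n him
  refine ⟨hre'.toLp _, him'.toLp _, fun G => ?_⟩
  have hintegr : Integrable (fun x => e x * (unweight n G x : ℂ)) (ballMeasure d) :=
    ((memLp_unweight n G).integrable (by norm_num)).ofReal.bdd_mul hec.aestronglyMeasurable
      (.of_forall fun x => (hen x).le)
  have hr : rhat (unweight n G) ξ = ∫ x, e x * (unweight n G x : ℂ) ∂(ballMeasure d) := by
    rw [rhat, hat_apply]
    rfl
  rw [hr, L2.inner_def, L2.inner_def]
  constructor
  · refine (integral_re hintegr).symm.trans (integral_congr_ae ?_)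
    filter_upwards [hre'.coeFn_toLp] with x hx
    rw [hx, unweight]
    change (e x * ((G x / √(fiberMass d n x) : ℝ) : ℂ)).re = _
    rw [Complex.re_mul_ofReal, real_inner_comm]
    simp only [RCLike.inner_apply, conj_trivial]
    ring
  · refine (integral_im hintegr).symm.trans (integral_congr_ae ?_)
    filter_upwards [him'.coeFn_toLp] with x hx
    rw [hx, unweight]
    change (e x * ((G x / √(fiberMass d n x) : ℝ) : ℂ)).im = _
    rw [Complex.im_mul_ofReal, real_inner_comm]
    simp only [RCLike.inner_apply, conj_trivial]
    ring

/-- The compact part of the quadratic form. -/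
def compactForm (r : ℕ) (G : Lp ℝ 2 (ballMeasure d)) : ℝ :=
  ∫ ξ, ‖ballHat d ξ‖ ^ (2 * r + 2) * (((2 * r : ℕ) + 3) * (rhat (unweight (2 * r + 1) G) ξ).im ^ 2
    + (rhat (unweight (2 * r + 1) G) ξ).re ^ 2)

theorem quadForm_unweight (r : ℕ) (G : Lp ℝ 2 (ballMeasure d)) :
    quadForm (2 * r) (unweight (2 * r + 1) G) = ‖G‖ ^ 2 - compactForm r G := by
  rw [quadForm, compactForm, integral_fiberMass_mul_unweight_sq]

/-- Dominated convergence: the transforms converge pointwise, are uniformly bounded on the unit ball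
of L², and the weight |F|^{2r+2} is integrable. -/
theorem tendsto_compactForm (r : ℕ) {x : ℕ → Lp ℝ 2 (ballMeasure d)} {y : Lp ℝ 2 (ballMeasure d)}
    (hx : ∀ n, ‖x n‖ ≤ 1)
    (hlim : ∀ z, Tendsto (fun n => inner ℝ (x n) z) atTop (𝓝 (inner ℝ y z))) :
    Tendsto (fun n => compactForm r (x n)) atTop (𝓝 (compactForm r y)) := by
  obtain ⟨C, hC0, hC⟩ := exists_integral_abs_unweight_le (d := d) (2 * r + 1)
  refine tendsto_integral_of_dominated_convergence
    (fun ξ => ‖ballHat d ξ‖ ^ (2 * r + 2) * (((2 * r : ℕ) + 3) * C ^ 2 + C ^ 2)) ?_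
    ((integrable_norm_ballHat_pow (2 * r)).mul_const _) ?_ ?_
  · exact fun n => (integrable_weighted_quad (2 * r)
      ((memLp_unweight _ (x n)).integrable (by norm_num))).1
  · refine fun n => .of_forall fun ξ => ?_
    have h0 : ‖rhat (unweight (2 * r + 1) (x n)) ξ‖ ≤ C :=
      ((norm_rhat_le _ _).trans (hC _)).trans (mul_le_of_le_one_right hC0 (hx n))
    have h1 := (Complex.abs_im_le_norm _).trans h0
    have h2 := (Complex.abs_re_le_norm _).trans h0
    rw [Real.norm_of_nonneg (by positivity), ← sq_abs (Complex.im _), ← sq_abs (Complex.re _)]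
    gcongr
  · refine .of_forall fun ξ => ?_
    obtain ⟨a, b, hab⟩ := exists_rhat_unweight_eq_inner (2 * r + 1) ξ
    simp only [fun G => (hab G).1, fun G => (hab G).2]
    exact ((((hlim b).pow 2).const_mul _).add ((hlim a).pow 2)).const_mul _

theorem weighted_coeFn_even (r : ℕ) {g : Space d → ℝ} (hg : MemLp g 2 (ballMeasure d)) :
    weighted d ((2 * r + 4 : ℕ) : ℝ) g hg
      =ᵐ[ballMeasure d] fun x => √(fiberMass d (2 * r + 1) x) * g x := by
  rw [weighted, ← kernel_even_eq_fiberMass]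
  exact MemLp.coeFn_toLp _

theorem mem_affineSubspace_of_unweight (r : ℕ) {G : Lp ℝ 2 (ballMeasure d)} {α : Space d} {b : ℝ}
    (h : unweight (2 * r + 1) G =ᵐ[ballMeasure d] fun x => inner ℝ α x + b) :
    G ∈ affineSubspace d ((2 * r + 4 : ℕ) : ℝ) := by
  refine ⟨(α, b), Lp.ext ?_⟩
  obtain ⟨κ, hκ, hle⟩ := exists_fiberMass_lower_bound (d := d) (2 * r + 1)
  have hw := weighted_coeFn_even r (memLp_affine d (α, b))
  filter_upwards [hw, h, ae_restrict_mem measurableSet_unitBall] with x h1 h2 hx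
  have hpos := Real.sqrt_pos.2 (hκ.trans_le (hle x hx))
  refine h1.trans ?_
  simp only [← h2, unweight]
  field_simp

theorem exists_gap_compactForm (r : ℕ) :
    ∃ c : ℝ, 0 < c ∧ ∀ G ∈ (affineSubspace d ((2 * r + 4 : ℕ) : ℝ))ᗮ,
      c * ‖G‖ ^ 2 ≤ ‖G‖ ^ 2 - compactForm r G := by
  have : Fact ((2 : ℝ≥0∞) ≠ ∞) := ⟨by norm_num⟩
  refine exists_gap_of_weakly_continuous (fun x y hx hlim => tendsto_compactForm r hx hlim) ?_ ?_ ?_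
  · intro t G
    have hae : unweight (2 * r + 1) (t • G) =ᵐ[ballMeasure d]
        fun x => t * unweight (2 * r + 1) G x := by
      filter_upwards [Lp.coeFn_smul t G] with x hx
      simp only [unweight, hx, Pi.smul_apply, smul_eq_mul]
      ring
    have h := quadForm_congr_ae (2 * r) hae
    rw [quadForm_const_mul, quadForm_unweight, quadForm_unweight, norm_smul, mul_pow,
      Real.norm_eq_abs, sq_abs] at h
    linarith
  · intro G
    have := quadForm_nonneg (memLp_unweight (2 * r + 1) G) r
    rw [quadForm_unweight] at this
    linarith
  · intro G hG
    have h0 : quadForm (2 * r) (unweight (2 * r + 1) G) = 0 := by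
      rw [quadForm_unweight, hG, sub_self]
    obtain ⟨α, b, h⟩ := exists_affine_of_quadForm_eq_zero (memLp_unweight _ G) r h0
    exact mem_affineSubspace_of_unweight r h

/-- Coercivity of the second variation modulo affine functions. -/
theorem exists_quadForm_gap (r : ℕ) :
    ∃ c : ℝ, 0 < c ∧ ∀ (g : Space d → ℝ) (hg : MemLp g 2 (ballMeasure d)),
      c * ‖weighted d ((2 * r + 4 : ℕ) : ℝ) g hg
        - (affineSubspace d ((2 * r + 4 : ℕ) : ℝ)).starProjection
          (weighted d ((2 * r + 4 : ℕ) : ℝ) g hg)‖ ^ 2 ≤ quadForm (2 * r) g := by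
  obtain ⟨c, hc, hgap⟩ := exists_gap_compactForm (d := d) r
  refine ⟨c, hc, fun g hg => ?_⟩
  obtain ⟨κ, hκ, hle⟩ := exists_fiberMass_lower_bound (d := d) (2 * r + 1)
  set G := weighted d ((2 * r + 4 : ℕ) : ℝ) g hg with hG
  set W := affineSubspace d ((2 * r + 4 : ℕ) : ℝ) with hW
  obtain ⟨p, hp⟩ : W.starProjection G ∈ W := Submodule.starProjection_apply_mem _ _
  have h1 := hgap _ (Submodule.sub_starProjection_mem_orthogonal (K := W) G)
  rw [← quadForm_unweight] at h1
  refine h1.trans_eq ?_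
  have hp' : W.starProjection G =ᵐ[ballMeasure d]
      fun x => √(fiberMass d (2 * r + 1) x) * (inner ℝ p.1 x + p.2) := by
    rw [← hp]
    exact weighted_coeFn_even r (memLp_affine d p)
  -- Dividing the orthogonal component by K^{1/2} leaves g minus an affine function. Affine
  -- functions are null directions, so the form does not notice the subtraction.
  have hae : unweight (2 * r + 1) (G - W.starProjection G) =ᵐ[ballMeasure d]
      fun x => g x + (-1) * (inner ℝ p.1 x + p.2) := by
    filter_upwards [Lp.coeFn_sub G (W.starProjection G), weighted_coeFn_even r hg, hp',
      ae_restrict_mem measurableSet_unitBall] with x e1 e2 e3 hx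
    have hpos := Real.sqrt_pos.2 (hκ.trans_le (hle x hx))
    rw [unweight, e1, Pi.sub_apply, e3, hG, e2]
    field_simp
    ring
  rw [quadForm_congr_ae _ hae]
  exact quadForm_add_of_eq_zero r hg (memLp_affine d p) (quadForm_affine r p.1 p.2) (-1)

/-! ### Second order expansion of |x + z|^q. -/

section Taylor

/-- Second order Taylor expansion with a cubic remainder. -/
theorem abs_sub_taylor_two_le {f f₁ f₂ f₃ : ℝ → ℝ} {C s : ℝ}
    (h₁ : ∀ x ∈ Set.uIcc 0 s, HasDerivAt f (f₁ x) x)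
    (h₂ : ∀ x ∈ Set.uIcc 0 s, HasDerivAt f₁ (f₂ x) x)
    (h₃ : ∀ x ∈ Set.uIcc 0 s, HasDerivAt f₂ (f₃ x) x)
    (hC : ∀ x ∈ Set.uIcc 0 s, |f₃ x| ≤ C) :
    |f s - (f 0 + f₁ 0 * s + f₂ 0 / 2 * s ^ 2)| ≤ C * |s| ^ 3 := by
  have hconv : Convex ℝ (Set.uIcc 0 s) := convex_uIcc 0 s
  have h0 : (0 : ℝ) ∈ Set.uIcc 0 s := Set.left_mem_uIcc
  have hs : s ∈ Set.uIcc 0 s := Set.right_mem_uIcc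
  have hC0 : 0 ≤ C := (abs_nonneg _).trans (hC 0 h0)
  have habs : ∀ x ∈ Set.uIcc 0 s, |x| ≤ |s| := fun x hx => by
    simpa using Set.abs_sub_left_of_mem_uIcc hx
  have e2 : ∀ x ∈ Set.uIcc 0 s, |f₂ x - f₂ 0| ≤ C * |s| := by
    intro x hx
    have := hconv.norm_image_sub_le_of_norm_hasDerivWithin_le
      (fun y hy => (h₃ y hy).hasDerivWithinAt) hC h0 hx
    rw [sub_zero] at this
    exact this.trans (mul_le_mul_of_nonneg_left (habs x hx) hC0)
  have e1 : ∀ x ∈ Set.uIcc 0 s, |f₁ x - f₂ 0 * x - f₁ 0| ≤ C * |s| ^ 2 := by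
    intro x hx
    have hd : ∀ y ∈ Set.uIcc 0 s, HasDerivWithinAt (fun y => f₁ y - f₂ 0 * y) (f₂ y - f₂ 0)
        (Set.uIcc 0 s) y := fun y hy => by
      exact ((h₂ y hy).sub ((hasDerivAt_id y).const_mul (f₂ 0))).hasDerivWithinAt.congr_deriv
        (by simp)
    have := hconv.norm_image_sub_le_of_norm_hasDerivWithin_le hd e2 h0 hx
    rw [sub_zero, mul_zero, sub_zero] at this
    refine this.trans ((mul_le_mul_of_nonneg_left (habs x hx) (by positivity)).trans_eq ?_)
    rw [mul_assoc, pow_two]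
  have hd : ∀ y ∈ Set.uIcc 0 s, HasDerivWithinAt
      (fun y => f y - f₁ 0 * y - f₂ 0 / 2 * y ^ 2) (f₁ y - f₂ 0 * y - f₁ 0)
      (Set.uIcc 0 s) y := fun y hy => by
    have := (((h₁ y hy).sub ((hasDerivAt_id y).const_mul (f₁ 0))).sub
      ((hasDerivAt_pow 2 y).const_mul (f₂ 0 / 2))).hasDerivWithinAt (s := Set.uIcc 0 s)
    refine this.congr_deriv ?_
    norm_num
    ring
  have := hconv.norm_image_sub_le_of_norm_hasDerivWithin_le hd e1 h0 hs
  rw [Real.norm_eq_abs, sub_zero, Real.norm_eq_abs] at this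
  calc |f s - (f 0 + f₁ 0 * s + f₂ 0 / 2 * s ^ 2)|
      = |f s - f₁ 0 * s - f₂ 0 / 2 * s ^ 2 - (f 0 - f₁ 0 * 0 - f₂ 0 / 2 * 0 ^ 2)| := by
        congr 1; ring
    _ ≤ C * |s| ^ 2 * |s| := this
    _ = C * |s| ^ 3 := by ring

theorem rpow_le_four_rpow_abs {y e : ℝ} (h1 : 1 / 4 ≤ y) (h2 : y ≤ 4) : y ^ e ≤ 4 ^ |e| := by
  have hy : 0 < y := by linarith
  rcases le_total 0 e with he | he
  · rw [abs_of_nonneg he]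
    exact Real.rpow_le_rpow hy.le h2 he
  · rw [abs_of_nonpos he, ← neg_neg e, Real.rpow_neg hy.le, ← Real.inv_rpow hy.le, neg_neg]
    refine Real.rpow_le_rpow (by positivity) ?_ (by linarith)
    rw [inv_le_comm₀ hy (by norm_num)]
    linarith

/-- The window for s keeps 1 + x between 1/4 and 4, so the third derivative is bounded uniformly in
p even when its exponent p - 3 is negative. -/
theorem one_add_rpow_le {P p s : ℝ} (hp1 : 1 ≤ p) (hpP : p ≤ P) (hs1 : -(3 / 4) ≤ s) (hs2 : s ≤ 3) :
    (1 + s) ^ p ≤ 1 + p * s + p * (p - 1) / 2 * s ^ 2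
      + P * P * (P + 2) * 4 ^ (P + 2) * |s| ^ 3 := by
  have hmem : ∀ x ∈ Set.uIcc 0 s, 1 / 4 ≤ 1 + x ∧ 1 + x ≤ 4 := by
    intro x hx
    rcases Set.mem_uIcc.1 hx with h | h <;> constructor <;> linarith
  have hder : ∀ (c e : ℝ), ∀ x ∈ Set.uIcc 0 s,
      HasDerivAt (fun x => c * (1 + x) ^ e) (c * e * (1 + x) ^ (e - 1)) x := by
    intro c e x hx
    have h := ((hasDerivAt_id x).const_add 1).rpow_const (p := e)
      (Or.inl (show (1 + id x : ℝ) ≠ 0 by have := (hmem x hx).1; simp only [id]; linarith))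
    refine (h.const_mul c).congr_deriv ?_
    simp only [id]
    ring
  have h := abs_sub_taylor_two_le (s := s) (C := P * P * (P + 2) * 4 ^ (P + 2))
    (hder 1 p) (hder (1 * p) (p - 1)) (hder (1 * p * (p - 1)) (p - 1 - 1)) ?_
  · have := (abs_le.1 h).2
    simp only [add_zero, Real.one_rpow, one_mul, mul_one] at this
    linarith
  · intro x hx
    obtain ⟨h1, h2⟩ := hmem x hx
    have e1 := rpow_le_four_rpow_abs (e := p - 1 - 1 - 1) h1 h2
    have e2 : (4 : ℝ) ^ |p - 1 - 1 - 1| ≤ 4 ^ (P + 2) := by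
      refine Real.rpow_le_rpow_of_exponent_le (by norm_num) ?_
      rw [abs_le]; constructor <;> linarith
    have e0 : 0 ≤ (1 + x) ^ (p - 1 - 1 - 1) := Real.rpow_nonneg (by linarith) _
    rw [abs_mul, abs_of_nonneg e0, abs_mul, abs_mul, abs_mul, abs_one, one_mul]
    have a1 : |p| ≤ P := by rw [abs_le]; constructor <;> linarith
    have a2 : |p - 1| ≤ P := by rw [abs_le]; constructor <;> linarith
    have a3 : |p - 1 - 1| ≤ P + 2 := by rw [abs_le]; constructor <;> linarith
    have hP : 0 ≤ P := by linarith
    exact mul_le_mul (mul_le_mul (mul_le_mul a1 a2 (abs_nonneg _) hP) a3 (abs_nonneg _)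
      (by positivity)) (e1.trans e2) e0 (by positivity)

theorem rpow_add_three {x q : ℝ} (hx : 0 < x) : x ^ q = x ^ (q - 3) * x ^ 3 := by
  rw [← Real.rpow_natCast x 3, ← Real.rpow_add hx]
  norm_num

theorem rpow_le_rpow_of_le_of_one_le {x M e Q : ℝ} (hx : 0 ≤ x) (hxM : x ≤ M) (hM : 1 ≤ M)
    (he : 0 ≤ e) (heQ : e ≤ Q) : x ^ e ≤ M ^ Q :=
  (Real.rpow_le_rpow hx hxM he).trans (Real.rpow_le_rpow_of_exponent_le hM heQ)

/-- When z dominates x, the left side and the linear term are of order ‖z‖^q, which is O(‖z‖³)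
because q ≥ 3. The quadratic term and |x|^q are nonnegative and can be discarded. -/
theorem norm_add_rpow_le_of_large {M Q q x : ℝ} {z : ℂ} (hM : 1 ≤ M) (hq3 : 3 ≤ q) (hqQ : q ≤ Q)
    (hzM : ‖z‖ ≤ M) (hz : 0 < ‖z‖) (hxz : |x| ≤ 2 * ‖z‖) :
    ‖(x : ℂ) + z‖ ^ q ≤ |x| ^ q + q * |x| ^ (q - 2) * x * z.re
      + q / 2 * |x| ^ (q - 2) * ((q - 1) * z.re ^ 2 + z.im ^ 2)
      + (3 ^ Q + Q * 2 ^ Q) * M ^ Q * ‖z‖ ^ 3 := by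
  have h1 : ‖(x : ℂ) + z‖ ≤ 3 * ‖z‖ := by
    refine (norm_add_le _ _).trans ?_
    rw [Complex.norm_real, Real.norm_eq_abs]
    linarith
  have hzq : ‖z‖ ^ q ≤ M ^ Q * ‖z‖ ^ 3 := by
    rw [rpow_add_three hz]
    exact mul_le_mul_of_nonneg_right
      (rpow_le_rpow_of_le_of_one_le hz.le hzM hM (by linarith) (by linarith)) (by positivity)
  have h2 : ‖(x : ℂ) + z‖ ^ q ≤ 3 ^ Q * (M ^ Q * ‖z‖ ^ 3) := by
    refine (Real.rpow_le_rpow (norm_nonneg _) h1 (by linarith)).trans ?_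
    rw [Real.mul_rpow (by norm_num) hz.le]
    exact mul_le_mul (Real.rpow_le_rpow_of_exponent_le (by norm_num) hqQ) hzq (by positivity)
      (by positivity)
  have h3 : |q * |x| ^ (q - 2) * x * z.re| ≤ Q * 2 ^ Q * (M ^ Q * ‖z‖ ^ 3) := by
    rw [abs_mul, abs_mul, abs_mul, abs_of_nonneg (by linarith : (0 : ℝ) ≤ q),
      abs_of_nonneg (Real.rpow_nonneg (abs_nonneg x) _)]
    have e1 : |x| ^ (q - 2) * |x| = |x| ^ (q - 1) := by
      rw [← Real.rpow_add_one' (abs_nonneg x) (by linarith)]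
      ring_nf
    have e2 : |x| ^ (q - 1) ≤ 2 ^ Q * ‖z‖ ^ (q - 1) := by
      refine (Real.rpow_le_rpow (abs_nonneg x) hxz (by linarith)).trans ?_
      rw [Real.mul_rpow (by norm_num) hz.le]
      exact mul_le_mul_of_nonneg_right
        (Real.rpow_le_rpow_of_exponent_le (by norm_num) (by linarith)) (by positivity)
    have e3 : ‖z‖ ^ (q - 1) * ‖z‖ = ‖z‖ ^ q := by
      rw [← Real.rpow_add_one' hz.le (by linarith)]
      ring_nf
    calc q * |x| ^ (q - 2) * |x| * |z.re| = q * |x| ^ (q - 1) * |z.re| := by rw [← e1]; ring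
      _ ≤ Q * (2 ^ Q * ‖z‖ ^ (q - 1)) * ‖z‖ := by
        refine mul_le_mul (mul_le_mul hqQ e2 (by positivity) (by linarith))
          (Complex.abs_re_le_norm z) (abs_nonneg _) ?_
        have : 0 ≤ Q := by linarith
        positivity
      _ = Q * 2 ^ Q * ‖z‖ ^ q := by rw [← e3]; ring
      _ ≤ Q * 2 ^ Q * (M ^ Q * ‖z‖ ^ 3) := by
        refine mul_le_mul_of_nonneg_left hzq ?_
        have : 0 ≤ Q := by linarith
        positivity
  have h4 : 0 ≤ q / 2 * |x| ^ (q - 2) * ((q - 1) * z.re ^ 2 + z.im ^ 2) := by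
    have : 0 ≤ q - 1 := by linarith
    positivity
  have h5 : 0 ≤ |x| ^ q := by positivity
  have h6 := (abs_le.1 h3).1
  nlinarith

/-- Here |x + z|² = x²(1 + s) with s = 2 Re z / x + (‖z‖/|x|)², so the power 1 + s ↦ (1 + s)^{q/2}
is expanded at s = 0. The condition ‖z‖ < |x|/2 gives s ≥ -3/4. Errors cubic in ‖z‖/|x| cost
|x|^{q-3} ‖z‖³, bounded since q ≥ 3. -/
theorem norm_add_rpow_le_of_small {M Q q x : ℝ} {z : ℂ} (hM : 1 ≤ M) (hq3 : 3 ≤ q) (hqQ : q ≤ Q)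
    (hxM : |x| ≤ M) (hxz : 2 * ‖z‖ < |x|) :
    ‖(x : ℂ) + z‖ ^ q ≤ |x| ^ q + q * |x| ^ (q - 2) * x * z.re
      + q / 2 * |x| ^ (q - 2) * ((q - 1) * z.re ^ 2 + z.im ^ 2)
      + (Q * Q * (Q + 2) * 4 ^ (Q + 2) * 16 + 5 * Q * Q) * M ^ Q * ‖z‖ ^ 3 := by
  have hz0 := norm_nonneg z
  have hx0 : 0 < |x| := by linarith
  have hxne : x ≠ 0 := abs_pos.1 hx0
  set a := z.re
  set b := z.im
  set n := ‖z‖ with hn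
  set y := |x| with hy
  have hyx : y ^ 2 = x ^ 2 := sq_abs x
  have hnab : n ^ 2 = a ^ 2 + b ^ 2 := by
    rw [hn, ← Complex.normSq_eq_norm_sq, Complex.normSq_apply]; ring
  have han : |a| ≤ n := Complex.abs_re_le_norm z
  set ρ := n / y with hρ
  have hρ0 : 0 ≤ ρ := by positivity
  have hρ1 : ρ ≤ 1 / 2 := by rw [hρ, div_le_iff₀ hx0]; linarith
  have hnρ : n = ρ * y := by rw [hρ]; field_simp
  set u := a / x with hu
  have hau : a = u * x := by rw [hu]; field_simp
  have hu1 : |u| ≤ ρ := by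
    rw [hu, abs_div, hρ]
    gcongr
  set s := 2 * u + ρ ^ 2 with hs
  have hus := abs_le.1 hu1
  have hs1 : -(3 / 4) ≤ s := by nlinarith
  have hs2 : s ≤ 3 := by nlinarith
  have hsabs : |s| ≤ 5 / 2 * ρ := by
    rw [abs_le]; constructor <;> nlinarith
  have hnorm : ‖(x : ℂ) + z‖ ^ 2 = y ^ 2 * (1 + s) := by
    rw [← Complex.normSq_eq_norm_sq, Complex.normSq_apply]
    simp only [Complex.add_re, Complex.add_im, Complex.ofReal_re, Complex.ofReal_im, zero_add]
    have h1 : y ^ 2 * (1 + s) = x ^ 2 + 2 * (u * x) * x + (ρ * y) ^ 2 := by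
      rw [hs, mul_pow, hyx]; ring
    rw [h1, ← hau, ← hnρ, hnab]
    ring
  have hpow : ‖(x : ℂ) + z‖ ^ q = y ^ q * (1 + s) ^ (q / 2) := by
    have e : ∀ w : ℝ, 0 ≤ w → w ^ q = (w ^ 2) ^ (q / 2) := by
      intro w hw
      rw [← Real.rpow_natCast w 2, ← Real.rpow_mul hw]
      congr 1
      push_cast
      ring
    rw [e _ (norm_nonneg _), hnorm, Real.mul_rpow (by positivity) (by linarith), ← e y hx0.le]
  have htaylor := one_add_rpow_le (P := Q) (p := q / 2) (s := s) (by linarith) (by linarith) hs1 hs2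
  have hQ : 0 ≤ Q := by linarith
  set A := Q * Q * (Q + 2) * 4 ^ (Q + 2) with hA
  have hA0 : 0 ≤ A := by positivity
  have hs3 : |s| ^ 3 ≤ 16 * ρ ^ 3 := by
    calc |s| ^ 3 ≤ (5 / 2 * ρ) ^ 3 := pow_le_pow_left₀ (abs_nonneg _) hsabs 3
      _ = 125 / 8 * ρ ^ 3 := by ring
      _ ≤ 16 * ρ ^ 3 := by gcongr; norm_num
  have hssq : s ^ 2 ≤ 4 * u ^ 2 + 5 * ρ ^ 3 := by
    have h1 : u * ρ ^ 2 ≤ ρ * ρ ^ 2 := mul_le_mul_of_nonneg_right hus.2 (by positivity)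
    have h2 : ρ ^ 4 ≤ ρ ^ 3 := by
      have : ρ ^ 3 * ρ ≤ ρ ^ 3 * 1 := mul_le_mul_of_nonneg_left (by linarith) (by positivity)
      linarith only [this, show ρ ^ 3 * ρ = ρ ^ 4 by ring]
    have h3 : s ^ 2 = 4 * u ^ 2 + 4 * (u * ρ ^ 2) + ρ ^ 4 := by rw [hs]; ring
    have h4 : ρ * ρ ^ 2 = ρ ^ 3 := by ring
    linarith only [h1, h2, h3, h4]
  have hc0 : 0 ≤ q / 2 * (q / 2 - 1) / 2 := by
    have : 0 ≤ q / 2 - 1 := by linarith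
    positivity
  have hc1 : q / 2 * (q / 2 - 1) / 2 ≤ Q * Q := by
    nlinarith only [hq3, hqQ]
  have hmain : (1 + s) ^ (q / 2) ≤ 1 + q / 2 * s + q / 2 * (q / 2 - 1) / 2 * (4 * u ^ 2)
      + (A * 16 + 5 * Q * Q) * ρ ^ 3 := by
    have h1 := mul_le_mul_of_nonneg_left hs3 hA0
    have h2 := mul_le_mul_of_nonneg_left hssq hc0
    have h3 : q / 2 * (q / 2 - 1) / 2 * (5 * ρ ^ 3) ≤ Q * Q * (5 * ρ ^ 3) :=
      mul_le_mul_of_nonneg_right hc1 (by positivity)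
    linarith only [h1, h2, h3, htaylor]
  have hq2 : y ^ (q - 2) * y ^ 2 = y ^ q := by
    rw [← Real.rpow_natCast y 2, ← Real.rpow_add hx0]
    norm_num
  have herr : y ^ q * ρ ^ 3 ≤ M ^ Q * n ^ 3 := by
    have : y ^ q * ρ ^ 3 = y ^ (q - 3) * n ^ 3 := by
      rw [rpow_add_three hx0, hnρ]; ring
    rw [this]
    exact mul_le_mul_of_nonneg_right
      (rpow_le_rpow_of_le_of_one_le hx0.le hxM hM (by linarith) (by linarith)) (by positivity)
  have hfin := mul_le_mul_of_nonneg_left hmain (by positivity : 0 ≤ y ^ q)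
  have e1 : y ^ q * u = y ^ (q - 2) * x * a := by
    rw [← hq2, hyx, hau]; ring
  have e2 : y ^ q * u ^ 2 = y ^ (q - 2) * a ^ 2 := by
    rw [← hq2, hyx, hau]; ring
  have e3 : y ^ q * ρ ^ 2 = y ^ (q - 2) * (a ^ 2 + b ^ 2) := by
    rw [← hq2, ← hnab, hnρ]; ring
  have herr2 := mul_le_mul_of_nonneg_left herr (by positivity : 0 ≤ A * 16 + 5 * Q * Q)
  rw [hpow]
  calc y ^ q * (1 + s) ^ (q / 2)
      ≤ y ^ q * (1 + q / 2 * s + q / 2 * (q / 2 - 1) / 2 * (4 * u ^ 2)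
        + (A * 16 + 5 * Q * Q) * ρ ^ 3) := hfin
    _ = y ^ q + q * (y ^ q * u) + q / 2 * (y ^ q * ρ ^ 2)
        + q / 2 * (q - 2) * (y ^ q * u ^ 2) + (A * 16 + 5 * Q * Q) * (y ^ q * ρ ^ 3) := by
        rw [hs]; ring
    _ = y ^ q + q * (y ^ (q - 2) * x * a) + q / 2 * (y ^ (q - 2) * (a ^ 2 + b ^ 2))
        + q / 2 * (q - 2) * (y ^ (q - 2) * a ^ 2) + (A * 16 + 5 * Q * Q) * (y ^ q * ρ ^ 3) := by
        rw [e1, e2, e3]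
    _ ≤ y ^ q + q * y ^ (q - 2) * x * a + q / 2 * y ^ (q - 2) * ((q - 1) * a ^ 2 + b ^ 2)
        + (A * 16 + 5 * Q * Q) * M ^ Q * n ^ 3 := by
        linarith only [herr2]

/-- Second order expansion of `|x + z| ^ q` at a real point. -/
theorem exists_norm_add_rpow_le {M Q : ℝ} (hM : 1 ≤ M) (hQ : 0 ≤ Q) :
    ∃ C : ℝ, 0 ≤ C ∧ ∀ (q x : ℝ) (z : ℂ), 3 ≤ q → q ≤ Q → |x| ≤ M → ‖z‖ ≤ M →
      ‖(x : ℂ) + z‖ ^ q ≤ |x| ^ q + q * |x| ^ (q - 2) * x * z.re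
        + q / 2 * |x| ^ (q - 2) * ((q - 1) * z.re ^ 2 + z.im ^ 2) + C * ‖z‖ ^ 3 := by
  have hA : 0 ≤ (3 ^ Q + Q * 2 ^ Q) * M ^ Q := by positivity
  have hB : 0 ≤ (Q * Q * (Q + 2) * 4 ^ (Q + 2) * 16 + 5 * Q * Q) * M ^ Q := by positivity
  refine ⟨_, add_nonneg hA hB, fun q x z hq3 hqQ hxM hzM => ?_⟩
  have hz3 : 0 ≤ ‖z‖ ^ 3 := by positivity
  rcases lt_or_ge (2 * ‖z‖) |x| with h | h
  · refine (norm_add_rpow_le_of_small hM hq3 hqQ hxM h).trans ?_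
    nlinarith [mul_nonneg hA hz3]
  · rcases (norm_nonneg z).eq_or_lt' with h0 | h0
    · have hz : z = 0 := norm_eq_zero.1 h0
      have hx : x = 0 := by
        rw [h0, mul_zero] at h
        exact abs_eq_zero.1 (le_antisymm h (abs_nonneg x))
      subst hz hx
      simp
    · refine (norm_add_rpow_le_of_large hM hq3 hqQ hzM h0 h).trans ?_
      nlinarith [mul_nonneg hB hz3]

end Taylor

/-! ### Scalar inequalities for powers and for f cos g - 1. -/

theorem abs_exp_sub_exp_le (u v : ℝ) :
    |Real.exp u - Real.exp v| ≤ |u - v| * (Real.exp u + Real.exp v) := by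
  have key : ∀ u v : ℝ, Real.exp u - Real.exp v ≤ |u - v| * (Real.exp u + Real.exp v) := by
    intro u v
    have h1 := Real.add_one_le_exp (v - u)
    have h2 : Real.exp v = Real.exp u * Real.exp (v - u) := by rw [← Real.exp_add]; ring_nf
    have h3 := le_abs_self (u - v)
    have hu := Real.exp_pos u
    have hv := Real.exp_pos v
    nlinarith [abs_nonneg (u - v), mul_le_mul_of_nonneg_left h3 hu.le,
      mul_nonneg (abs_nonneg (u - v)) hv.le]
  rw [abs_le]
  constructor
  · have := key v u
    rw [abs_sub_comm] at this
    linarith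
  · exact key u v

/-- Half a power absorbs the logarithm near 0. This spare half is behind the later requirement q ≥
7/2. -/
theorem rpow_mul_abs_log_le {M S x e : ℝ} (hM : 1 ≤ M) (hx : 0 < x) (hxM : x ≤ M)
    (he : 1 / 2 ≤ e) (heS : e ≤ S) : x ^ e * |Real.log x| ≤ 2 + M ^ S * M := by
  rcases le_total x 1 with h | h
  · have h1 := Real.abs_log_mul_self_rpow_lt x (1 / 2) hx h (by norm_num)
    rw [abs_mul, abs_of_nonneg (Real.rpow_nonneg hx.le _)] at h1
    have h2 : x ^ e ≤ x ^ (1 / 2 : ℝ) := Real.rpow_le_rpow_of_exponent_ge hx h he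
    have h3 : 0 ≤ M ^ S * M := by positivity
    nlinarith [mul_le_mul_of_nonneg_right h2 (abs_nonneg (Real.log x))]
  · have h1 : Real.log x ≤ M := (Real.log_le_self hx.le).trans hxM
    have h2 := rpow_le_rpow_of_le_of_one_le hx.le hxM hM (by linarith : 0 ≤ e) heS
    rw [abs_of_nonneg (Real.log_nonneg h)]
    have := mul_le_mul h2 h1 (Real.log_nonneg h) (by positivity)
    linarith

/-- Lipschitz dependence of `x ^ s` on the exponent. -/
theorem abs_rpow_sub_rpow_le {M S σ s s' x : ℝ} (hM : 1 ≤ M) (hx : 0 ≤ x) (hxM : x ≤ M)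
    (hσ : 0 ≤ σ) (hs : σ + 1 / 2 ≤ s) (hsS : s ≤ S) (hs' : σ + 1 / 2 ≤ s') (hsS' : s' ≤ S) :
    |x ^ s - x ^ s'| ≤ 2 * (2 + M ^ S * M) * |s - s'| * x ^ σ := by
  rcases hx.eq_or_lt' with h0 | h0
  · have : 0 ≤ 2 * (2 + M ^ S * M) * |s - s'| * x ^ σ := by positivity
    rw [h0] at this ⊢
    rwa [Real.zero_rpow (by linarith), Real.zero_rpow (by linarith), sub_zero, abs_zero]
  · have h := abs_exp_sub_exp_le (Real.log x * s) (Real.log x * s')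
    rw [← Real.rpow_def_of_pos h0, ← Real.rpow_def_of_pos h0, ← mul_sub, abs_mul] at h
    have key : ∀ e, σ + 1 / 2 ≤ e → e ≤ S → |Real.log x| * x ^ e ≤ (2 + M ^ S * M) * x ^ σ := by
      intro e he heS
      have h1 := rpow_mul_abs_log_le (S := S) hM h0 hxM (e := e - σ) (by linarith) (by linarith)
      have h2 : x ^ e = x ^ (e - σ) * x ^ σ := by rw [← Real.rpow_add h0]; ring_nf
      rw [h2]
      nlinarith [mul_le_mul_of_nonneg_right h1 (Real.rpow_nonneg hx σ)]
    have k1 := key s hs hsS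
    have k2 := key s' hs' hsS'
    refine h.trans ?_
    have := mul_le_mul_of_nonneg_left (add_le_add k1 k2) (abs_nonneg (s - s'))
    nlinarith

/-- Put τ = g²/(4π²), which is at most 25/64 here. Then cos g ≤ 1 - τ: up to π by the quadratic
bound for the cosine, beyond π because the cosine is nonpositive. Finally f(1-τ) - 1 = -τ -
(1-f)(1-τ), and 1 - τ exceeds 1/4. -/
theorem mul_cos_sub_one_le {f g : ℝ} (hf0 : 0 ≤ f) (hf1 : f ≤ 1) (hg : |g| ≤ 5 * Real.pi / 4) :
    f * Real.cos g - 1 ≤ -(1 / (4 * Real.pi ^ 2)) * g ^ 2 - (1 - f) / 4 := by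
  have hpi := Real.pi_pos
  have hsq : 1 / (4 * Real.pi ^ 2) * g ^ 2 ≤ 25 / 64 := by
    rw [one_div_mul_eq_div, div_le_iff₀ (by positivity), ← sq_abs g]
    nlinarith [abs_nonneg g]
  have hcos : Real.cos g ≤ 1 - 1 / (4 * Real.pi ^ 2) * g ^ 2 := by
    rcases le_total |g| Real.pi with h | h
    · refine (Real.cos_le_one_sub_mul_cos_sq h).trans ?_
      have h1 : 1 / (4 * Real.pi ^ 2) ≤ 2 / Real.pi ^ 2 := by
        rw [div_le_div_iff₀ (by positivity) (by positivity)]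
        nlinarith [sq_nonneg Real.pi]
      linarith [mul_le_mul_of_nonneg_right h1 (sq_nonneg g)]
    · have : Real.cos g ≤ 0 := by
        rw [← Real.cos_abs]
        exact Real.cos_nonpos_of_pi_div_two_le_of_le (by linarith) (by linarith)
      linarith
  nlinarith [mul_le_mul_of_nonneg_left hcos hf0]

/-- The exact coefficient 1/2 matters: it has to match the quadratic term of the expansion to form
the second variation. -/
theorem mul_cos_sub_one_le_of_small {f g : ℝ} (hf1 : f ≤ 1) (hg : |g| ≤ 1) :
    f * Real.cos g - 1 ≤ -(1 / 2) * g ^ 2 + g ^ 4 - (1 - f) / 4 := by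
  have h := abs_le.1 (Real.cos_bound hg)
  have h4 : |g| ^ 4 = g ^ 4 := by rw [← abs_pow]; exact abs_of_nonneg (by positivity)
  rw [h4] at h
  have hg2 : g ^ 2 ≤ 1 := by rw [← sq_abs]; exact pow_le_one₀ (abs_nonneg _) hg
  have hg4 : g ^ 4 ≤ 1 := by nlinarith [sq_nonneg g]
  have hg40 : 0 ≤ g ^ 4 := by positivity
  have hc : 1 / 4 ≤ Real.cos g := by linarith [h.1]
  nlinarith [h.2, mul_le_mul_of_nonneg_left hc (sub_nonneg.2 hf1)]

theorem rpow_le_mul_sq {x B q : ℝ} (hx : 0 ≤ x) (hxB : x ≤ B) (hq : 2 ≤ q) :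
    x ^ q ≤ B ^ (q - 2) * x ^ 2 := by
  rcases hx.eq_or_lt' with h | h
  · rw [h, Real.zero_rpow (by linarith)]
    simp
  · have e : x ^ q = x ^ (q - 2) * x ^ 2 := by
      rw [← Real.rpow_natCast x 2, ← Real.rpow_add h]
      norm_num
    rw [e]
    exact mul_le_mul_of_nonneg_right (Real.rpow_le_rpow hx hxB (by linarith)) (by positivity)

/-! ### Norms in L^q and weighted quadratic forms on the Fourier side. -/

theorem integrable_norm_rpow_of_bound {v : Space d → ℂ} {B q : ℝ} (hv : MemLp v 2)
    (hB : ∀ ξ, ‖v ξ‖ ≤ B) (hq : 2 ≤ q) : Integrable fun ξ => ‖v ξ‖ ^ q := by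
  refine (hv.norm.integrable_sq.const_mul (B ^ (q - 2))).mono'
    ((Real.continuous_rpow_const (by linarith)).comp_aestronglyMeasurable hv.1.norm)
    (.of_forall fun ξ => ?_)
  rw [Real.norm_of_nonneg (by positivity)]
  exact rpow_le_mul_sq (norm_nonneg _) (hB ξ) hq

theorem memLp_of_bound {v : Space d → ℂ} {B q : ℝ} (hv : MemLp v 2) (hB : ∀ ξ, ‖v ξ‖ ≤ B)
    (hq : 2 ≤ q) : MemLp v (ENNReal.ofReal q) := by
  rw [← integrable_norm_rpow_iff hv.1 (by simp; linarith) (by simp),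
    ENNReal.toReal_ofReal (by linarith)]
  exact integrable_norm_rpow_of_bound hv hB hq

theorem lpNorm_rpow_eq_integral {v : Space d → ℂ} {q : ℝ} (hv : AEStronglyMeasurable v volume)
    (hq : 0 < q) : lpNorm v (ENNReal.ofReal q) volume ^ q = ∫ ξ, ‖v ξ‖ ^ q := by
  rw [lpNorm_eq_integral_norm_rpow_toReal (by simpa using hq) (by simp) hv,
    ENNReal.toReal_ofReal hq.le, ← Real.rpow_mul (integral_nonneg fun _ => by positivity),
    inv_mul_cancel₀ hq.ne', Real.rpow_one]

theorem integral_norm_sq_ballHat : ∫ ξ, ‖ballHat d ξ‖ ^ 2 = ballVol d := by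
  rw [← rhat_one, rhat, integral_norm_sq_hat (memLp_const _)]
  simp [ballVol]

section Weight

variable {M S e : ℝ}

theorem norm_ballHat_rpow_le (hM : 1 ≤ M) (hvol : ballVol d ≤ M) (he1 : 1 ≤ e) (heS : e ≤ S)
    (ξ : Space d) : ‖ballHat d ξ‖ ^ e ≤ M ^ S * ‖ballHat d ξ‖ := by
  have hx := norm_nonneg (ballHat d ξ)
  have hle := (norm_ballHat_le ξ).trans hvol
  have h : ‖ballHat d ξ‖ ^ e = ‖ballHat d ξ‖ ^ (e - 1) * ‖ballHat d ξ‖ := by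
    rw [← Real.rpow_add_one' hx (by linarith)]
    ring_nf
  rw [h]
  exact mul_le_mul_of_nonneg_right
    (rpow_le_rpow_of_le_of_one_le hx hle hM (by linarith) (by linarith)) hx

theorem continuous_norm_ballHat_rpow (he : 0 ≤ e) : Continuous fun ξ : Space d => ‖ballHat d ξ‖ ^ e :=
  continuous_ballHat.norm.rpow_const fun _ => Or.inr he

theorem integrable_weight_mul {N : Space d → ℝ} (he : 0 ≤ e) (hN : Integrable N) :
    Integrable fun ξ => ‖ballHat d ξ‖ ^ e * N ξ := by
  refine hN.bdd_mul (c := ballVol d ^ e) (continuous_norm_ballHat_rpow he).aestronglyMeasurable ?_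
  refine .of_forall fun ξ => ?_
  rw [Real.norm_of_nonneg (by positivity)]
  exact Real.rpow_le_rpow (norm_nonneg _) (norm_ballHat_le ξ) he

theorem integrable_norm_hat_mul {u v : Space d → ℂ} (hu : MemLp u 2 (ballMeasure d))
    (hv : MemLp v 2 (ballMeasure d)) : Integrable fun ξ => ‖hat u ξ‖ * ‖hat v ξ‖ :=
  (memLp_hat hu).norm.integrable_mul (memLp_hat hv).norm

/-- The transform of u is bounded by its L¹ norm, and a weight with exponent at least 1 leaves a
factor F in L² to pair with the transform of v. Using L¹ for one factor is essential, since ‖f -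
1‖₂² is controlled only by the first power of ‖f - 1‖₁. -/
theorem integral_weight_mul_le {u v : Space d → ℂ} (hM : 1 ≤ M) (hvol : ballVol d ≤ M)
    (he1 : 1 ≤ e) (heS : e ≤ S) (hu : MemLp u 2 (ballMeasure d)) (hv : MemLp v 2 (ballMeasure d)) :
    ∫ ξ, ‖ballHat d ξ‖ ^ e * (‖hat u ξ‖ * ‖hat v ξ‖)
      ≤ M ^ S * √(ballVol d) * ((∫ x, ‖u x‖ ∂(ballMeasure d))
        * √(∫ x, ‖v x‖ ^ 2 ∂(ballMeasure d))) := by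
  have hcs := integral_mul_le_sqrt_mul_sqrt (memLp_ballHat (d := d)).norm (memLp_hat hv).norm
    (fun _ => norm_nonneg _) (fun _ => norm_nonneg _)
  rw [integral_norm_sq_ballHat, integral_norm_sq_hat hv] at hcs
  have hintegr : Integrable fun ξ => ‖ballHat d ξ‖ * ‖hat v ξ‖ :=
    (memLp_ballHat (d := d)).norm.integrable_mul (memLp_hat hv).norm
  have hA : 0 ≤ ∫ x, ‖u x‖ ∂(ballMeasure d) := integral_nonneg fun _ => norm_nonneg _
  calc ∫ ξ, ‖ballHat d ξ‖ ^ e * (‖hat u ξ‖ * ‖hat v ξ‖)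
      ≤ ∫ ξ, M ^ S * (∫ x, ‖u x‖ ∂(ballMeasure d)) * (‖ballHat d ξ‖ * ‖hat v ξ‖) := by
        refine integral_mono (integrable_weight_mul (by linarith) (integrable_norm_hat_mul hu hv))
          (hintegr.const_mul _) fun ξ => ?_
        have h1 := norm_ballHat_rpow_le hM hvol he1 heS ξ
        have h2 := norm_hat_le u ξ
        calc ‖ballHat d ξ‖ ^ e * (‖hat u ξ‖ * ‖hat v ξ‖)
            ≤ (M ^ S * ‖ballHat d ξ‖) * ((∫ x, ‖u x‖ ∂(ballMeasure d)) * ‖hat v ξ‖) := by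
              gcongr
          _ = _ := by ring
    _ = M ^ S * (∫ x, ‖u x‖ ∂(ballMeasure d)) * ∫ ξ, ‖ballHat d ξ‖ * ‖hat v ξ‖ :=
        integral_const_mul _ _
    _ ≤ M ^ S * (∫ x, ‖u x‖ ∂(ballMeasure d))
        * (√(ballVol d) * √(∫ x, ‖v x‖ ^ 2 ∂(ballMeasure d))) := by
        gcongr
    _ = _ := by ring

end Weight

/-- The quadratic term of the expansion of `‖F + û‖_q^q`. -/
def secondOrder (q : ℝ) (u : Space d → ℂ) : ℝ :=
  ∫ ξ, ‖ballHat d ξ‖ ^ (q - 2) * ((q - 1) * (hat u ξ).re ^ 2 + (hat u ξ).im ^ 2)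

theorem quad_add_le {q : ℝ} (hq : 2 ≤ q) (z w : ℂ) :
    (q - 1) * (z + w).re ^ 2 + (z + w).im ^ 2
      ≤ ((q - 1) * z.re ^ 2 + z.im ^ 2) + 2 * q * (‖w‖ * ‖z‖) + q * (‖w‖ * ‖w‖) := by
  have h1 : z.re * w.re ≤ ‖w‖ * ‖z‖ := by
    refine (le_abs_self _).trans ?_
    rw [abs_mul, mul_comm]
    exact mul_le_mul (Complex.abs_re_le_norm w) (Complex.abs_re_le_norm z) (abs_nonneg _)
      (norm_nonneg _)
  have h2 : z.im * w.im ≤ ‖w‖ * ‖z‖ := by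
    refine (le_abs_self _).trans ?_
    rw [abs_mul, mul_comm]
    exact mul_le_mul (Complex.abs_im_le_norm w) (Complex.abs_im_le_norm z) (abs_nonneg _)
      (norm_nonneg _)
  have h3 : ‖w‖ * ‖w‖ = w.re ^ 2 + w.im ^ 2 := by
    rw [Complex.norm_mul_self_eq_normSq, Complex.normSq_apply]; ring
  rw [Complex.add_re, Complex.add_im]
  nlinarith [mul_le_mul_of_nonneg_left h1 (by linarith : 0 ≤ q - 1), sq_nonneg w.re,
    sq_nonneg w.im]

theorem integrable_hat_quad {u : Space d → ℂ} (hu : MemLp u 2 (ballMeasure d)) (a b : ℝ) :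
    Integrable fun ξ => a * (hat u ξ).re ^ 2 + b * (hat u ξ).im ^ 2 := by
  have h := memLp_hat hu
  have h1 : MemLp (fun ξ => (hat u ξ).re) 2 :=
    h.mono (Complex.continuous_re.comp_aestronglyMeasurable h.1)
      (.of_forall fun ξ => Complex.abs_re_le_norm _)
  have h2 : MemLp (fun ξ => (hat u ξ).im) 2 :=
    h.mono (Complex.continuous_im.comp_aestronglyMeasurable h.1)
      (.of_forall fun ξ => Complex.abs_im_le_norm _)
  exact (h1.integrable_sq.const_mul a).add (h2.integrable_sq.const_mul b)

theorem integrable_secondOrder {q : ℝ} (hq : 2 ≤ q) {u : Space d → ℂ}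
    (hu : MemLp u 2 (ballMeasure d)) :
    Integrable fun ξ => ‖ballHat d ξ‖ ^ (q - 2) * ((q - 1) * (hat u ξ).re ^ 2 + (hat u ξ).im ^ 2) := by
  have := integrable_hat_quad hu (q - 1) 1
  simp only [one_mul] at this
  exact integrable_weight_mul (by linarith) this

theorem secondOrder_add_le {M S q : ℝ} {u v : Space d → ℂ} (hM : 1 ≤ M) (hvol : ballVol d ≤ M)
    (hq3 : 3 ≤ q) (hqS : q ≤ S) (hu : MemLp u 2 (ballMeasure d)) (hv : MemLp v 2 (ballMeasure d)) :
    secondOrder q (fun x => u x + v x) ≤ secondOrder q u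
      + 2 * S * (M ^ S * √(ballVol d)) * ((∫ x, ‖v x‖ ∂(ballMeasure d))
        * (√(∫ x, ‖u x‖ ^ 2 ∂(ballMeasure d)) + √(∫ x, ‖v x‖ ^ 2 ∂(ballMeasure d)))) := by
  have hu1 : Integrable u (ballMeasure d) := hu.integrable (by norm_num)
  have hv1 : Integrable v (ballMeasure d) := hv.integrable (by norm_num)
  have b1 := integral_weight_mul_le (S := S) (e := q - 2) hM hvol (by linarith) (by linarith) hv hu
  have b2 := integral_weight_mul_le (S := S) (e := q - 2) hM hvol (by linarith) (by linarith) hv hv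
  have i0 := integrable_secondOrder (by linarith : 2 ≤ q) hu
  have i1 := integrable_weight_mul (d := d) (e := q - 2) (by linarith) (integrable_norm_hat_mul hv hu)
  have i2 := integrable_weight_mul (d := d) (e := q - 2) (by linarith) (integrable_norm_hat_mul hv hv)
  have i3 := integrable_secondOrder (by linarith : 2 ≤ q) (hu.add hv)
  have key : secondOrder q (fun x => u x + v x) ≤ secondOrder q u
      + 2 * q * (∫ ξ, ‖ballHat d ξ‖ ^ (q - 2) * (‖hat v ξ‖ * ‖hat u ξ‖))
      + q * ∫ ξ, ‖ballHat d ξ‖ ^ (q - 2) * (‖hat v ξ‖ * ‖hat v ξ‖) := by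
    rw [secondOrder, secondOrder, ← integral_const_mul, ← integral_const_mul,
      ← integral_add i0 (i1.const_mul _), ← integral_add (i0.fun_add (i1.const_mul _)) (i2.const_mul _)]
    refine integral_mono i3 ((i0.fun_add (i1.const_mul _)).fun_add (i2.const_mul _)) fun ξ => ?_
    simp only
    rw [hat_add hu1 hv1]
    have h := mul_le_mul_of_nonneg_left (quad_add_le (by linarith : 2 ≤ q) (hat u ξ) (hat v ξ))
      (by positivity : 0 ≤ ‖ballHat d ξ‖ ^ (q - 2))
    refine h.trans_eq ?_
    ring
  have n1 : 0 ≤ ∫ ξ, ‖ballHat d ξ‖ ^ (q - 2) * (‖hat v ξ‖ * ‖hat u ξ‖) :=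
    integral_nonneg fun _ => by positivity
  have n2 : 0 ≤ ∫ ξ, ‖ballHat d ξ‖ ^ (q - 2) * (‖hat v ξ‖ * ‖hat v ξ‖) :=
    integral_nonneg fun _ => by positivity
  have c1 := mul_le_mul (by linarith : 2 * q ≤ 2 * S) b1 n1 (by linarith)
  have c2 := mul_le_mul (by linarith : q ≤ 2 * S) b2 n2 (by linarith)
  linarith

/-! ### The kernel at real exponents and the expansion of the norm. -/

theorem kernelHat_eq_ofReal (q : ℝ) (ξ : Space d) :
    kernelHat d q ξ = ((‖ballHat d ξ‖ ^ (q - 2) * (ballHat d ξ).re : ℝ) : ℂ) := by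
  rw [Complex.ofReal_mul, ballHat_re]
  rfl

theorem ballHat_neg (ξ : Space d) : ballHat d (-ξ) = ballHat d ξ := by
  rw [← conj_ballHat, ← rhat_one, conj_rhat, rhat, hat_apply, hat_apply,
    ← integral_comp_neg_ballMeasure]
  simp

theorem integrable_kernelHat {q : ℝ} (hq : 3 ≤ q) : Integrable (kernelHat d q) := by
  have h := integrable_norm_rpow_of_bound (memLp_ballHat (d := d)) norm_ballHat_le
    (by linarith : 2 ≤ q - 1)
  refine h.mono' ?_ (.of_forall fun ξ => le_of_eq ?_)
  · exact ((Complex.continuous_ofReal.comp (continuous_norm_ballHat_rpow (by linarith))).mul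
      continuous_ballHat).aestronglyMeasurable
  · rw [kernelHat, norm_mul, Complex.norm_real, Real.norm_of_nonneg (by positivity)]
    change ‖ballHat d ξ‖ ^ (q - 2) * ‖ballHat d ξ‖ = _
    rw [← Real.rpow_add_one' (norm_nonneg _) (by linarith)]
    ring_nf

/-- An even symbol has equal direct and inverse transforms; a real symbol makes them conjugate.
Hence both are real. -/
theorem fourier_kernelHat (q : ℝ) (x : Space d) : 𝓕 (kernelHat d q) x = (kernel d q x : ℂ) := by
  have heven : (fun ξ => kernelHat d q (-ξ)) = kernelHat d q := by
    funext ξ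
    rw [kernelHat_eq_ofReal, kernelHat_eq_ofReal, ballHat_neg]
  have h1 : 𝓕⁻ (kernelHat d q) = 𝓕 (kernelHat d q) := by
    rw [Real.fourierInv_eq_fourier_comp_neg, heven]
  have hconj : starRingEnd ℂ (𝓕 (kernelHat d q) x) = 𝓕⁻ (kernelHat d q) x := by
    rw [Real.fourier_eq, Real.fourierInv_eq, ← integral_conj]
    congr 1
    funext ξ
    rw [kernelHat_eq_ofReal]
    simp [Circle.smul_def, ← Circle.coe_inv_eq_conj, AddChar.map_neg_eq_inv]
  rw [h1] at hconj
  rw [kernel, h1]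
  exact (Complex.conj_eq_iff_re.1 hconj).symm

theorem integral_kernelHat_mul_re {q : ℝ} (hq : 3 ≤ q) {u : Space d → ℂ}
    (hu : Integrable u (ballMeasure d)) :
    Integrable (fun ξ => ‖ballHat d ξ‖ ^ (q - 2) * (ballHat d ξ).re * (hat u ξ).re) ∧
    ∫ ξ, ‖ballHat d ξ‖ ^ (q - 2) * (ballHat d ξ).re * (hat u ξ).re
      = ∫ x, kernel d q x * (u x).re ∂(ballMeasure d) := by
  have hk := integrable_kernelHat (d := d) hq
  have h := integral_fourier_mul_eq (integrable_indicator_of_integrable hu) hk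
  have hintegr : Integrable fun ξ => hat u ξ * kernelHat d q ξ :=
    hk.bdd_mul (continuous_hat hu).aestronglyMeasurable (.of_forall fun ξ => norm_hat_le u ξ)
  have hbd : ∀ x, ‖𝓕 (kernelHat d q) x‖ ≤ ∫ ξ, ‖kernelHat d q ξ‖ := norm_fourier_le _
  have hint2 : Integrable (fun x => u x * 𝓕 (kernelHat d q) x) (ballMeasure d) :=
    hu.mul_bdd (continuous_fourier hk).aestronglyMeasurable (.of_forall hbd)
  have e1 : ∀ ξ, (hat u ξ * kernelHat d q ξ).re
      = ‖ballHat d ξ‖ ^ (q - 2) * (ballHat d ξ).re * (hat u ξ).re := by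
    intro ξ
    rw [kernelHat_eq_ofReal, Complex.re_mul_ofReal]
    ring
  have e2 : ∀ x, (u x * 𝓕 (kernelHat d q) x).re = kernel d q x * (u x).re := by
    intro x
    rw [fourier_kernelHat, Complex.re_mul_ofReal]
    ring
  have h3 : ∫ x, (unitBall d).indicator u x * 𝓕 (kernelHat d q) x
      = ∫ x, u x * 𝓕 (kernelHat d q) x ∂(ballMeasure d) := by
    rw [ballMeasure, ← integral_indicator measurableSet_unitBall]
    congr 1
    funext x
    by_cases hx : x ∈ unitBall d <;> simp [hx]
  rw [h3] at h
  constructor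
  · refine hintegr.re.congr (.of_forall fun ξ => ?_)
    exact e1 ξ
  · simp only [← e1, ← e2]
    have r1 := integral_re hintegr
    have r2 := integral_re hint2
    have h' := congrArg Complex.re h
    exact r1.trans (h'.trans r2.symm)

/-- The difference of symbols is at most a constant times |q - q'| |F|², integrable by Plancherel.
Retaining one power of F besides the half power spent on the logarithm needs q - 2 ≥ 3/2. -/
theorem abs_kernel_sub_kernel_le {M S q q' : ℝ} (hM : 1 ≤ M) (hvol : ballVol d ≤ M)
    (hq : 7 / 2 ≤ q) (hqS : q ≤ S) (hq' : 7 / 2 ≤ q') (hqS' : q' ≤ S) (x : Space d) :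
    |kernel d q x - kernel d q' x| ≤ 2 * (2 + M ^ S * M) * |q - q'| * ballVol d := by
  have hk := integrable_kernelHat (d := d) (by linarith : 3 ≤ q)
  have hk' := integrable_kernelHat (d := d) (by linarith : 3 ≤ q')
  have e : kernel d q x - kernel d q' x
      = rinv (fun ξ => kernelHat d q ξ + ((-1 : ℝ) : ℂ) * kernelHat d q' ξ) x := by
    rw [rinv_add hk (hk'.const_mul _), rinv_const_mul]
    simp only [kernel, rinv]
    ring
  rw [e]
  refine (abs_rinv_le _ x).trans ?_
  rw [← integral_norm_sq_ballHat, ← integral_const_mul]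
  refine integral_mono (hk.add (hk'.const_mul _)).norm
    ((memLp_ballHat (d := d)).norm.integrable_sq.const_mul _) fun ξ => ?_
  simp only
  have h := abs_rpow_sub_rpow_le (S := S) (σ := 1) (s := q - 2) (s' := q' - 2) hM
    (norm_nonneg (ballHat d ξ)) ((norm_ballHat_le ξ).trans hvol) zero_le_one (by linarith)
    (by linarith) (by linarith) (by linarith)
  have e2 : kernelHat d q ξ + ((-1 : ℝ) : ℂ) * kernelHat d q' ξ
      = ((‖ballHat d ξ‖ ^ (q - 2) - ‖ballHat d ξ‖ ^ (q' - 2) : ℝ) : ℂ) * ballHat d ξ := by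
    have hk0 : ∀ p, kernelHat d p ξ = ((‖ballHat d ξ‖ ^ (p - 2) : ℝ) : ℂ) * ballHat d ξ :=
      fun _ => rfl
    rw [hk0, hk0]
    push_cast
    ring
  rw [e2, norm_mul, Complex.norm_real, Real.norm_eq_abs, pow_two, ← mul_assoc]
  refine mul_le_mul_of_nonneg_right ?_ (norm_nonneg _)
  rw [Real.rpow_one] at h
  have : q - 2 - (q' - 2) = q - q' := by ring
  rwa [this] at h

/-- Expansion of `‖F + û‖_q^q` to second order. -/
theorem exists_integral_norm_add_rpow_le {M S : ℝ} (hM : 1 ≤ M) (hvol : ballVol d ≤ M)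
    (hS : 0 ≤ S) :
    ∃ C : ℝ, 0 ≤ C ∧ ∀ (q : ℝ) (u : Space d → ℂ), 3 ≤ q → q ≤ S → MemLp u 2 (ballMeasure d) →
      ∫ x, ‖u x‖ ∂(ballMeasure d) ≤ M →
      ∫ ξ, ‖ballHat d ξ + hat u ξ‖ ^ q ≤ (∫ ξ, ‖ballHat d ξ‖ ^ q)
        + q * (∫ x, kernel d q x * (u x).re ∂(ballMeasure d)) + q / 2 * secondOrder q u
        + C * ((∫ x, ‖u x‖ ∂(ballMeasure d)) * ∫ x, ‖u x‖ ^ 2 ∂(ballMeasure d)) := by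
  obtain ⟨C, hC, hT⟩ := exists_norm_add_rpow_le hM hS
  refine ⟨C, hC, fun q u hq3 hqS hu huM => ?_⟩
  have hu1 : Integrable u (ballMeasure d) := hu.integrable (by norm_num)
  have hhat : ∀ ξ, ‖hat u ξ‖ ≤ ∫ x, ‖u x‖ ∂(ballMeasure d) := norm_hat_le u
  have i0 := integrable_norm_rpow_of_bound (memLp_ballHat (d := d)) norm_ballHat_le
    (by linarith : 2 ≤ q)
  obtain ⟨i1, e1⟩ := integral_kernelHat_mul_re (d := d) hq3 hu1
  have i2 := integrable_secondOrder (by linarith : 2 ≤ q) hu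
  have i3 : Integrable fun ξ => ‖hat u ξ‖ ^ 2 := (memLp_hat hu).norm.integrable_sq
  have iL : Integrable fun ξ => ‖ballHat d ξ + hat u ξ‖ ^ q := by
    refine integrable_norm_rpow_of_bound (B := ballVol d + ∫ x, ‖u x‖ ∂(ballMeasure d))
      ((memLp_ballHat (d := d)).add (memLp_hat hu)) (fun ξ => ?_) (by linarith)
    exact (norm_add_le _ _).trans (add_le_add (norm_ballHat_le ξ) (hhat ξ))
  set A := ∫ x, ‖u x‖ ∂(ballMeasure d) with hA
  have hpt : ∀ ξ, ‖ballHat d ξ + hat u ξ‖ ^ q ≤ ‖ballHat d ξ‖ ^ q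
      + q * (‖ballHat d ξ‖ ^ (q - 2) * (ballHat d ξ).re * (hat u ξ).re)
      + q / 2 * (‖ballHat d ξ‖ ^ (q - 2) * ((q - 1) * (hat u ξ).re ^ 2 + (hat u ξ).im ^ 2))
      + C * A * ‖hat u ξ‖ ^ 2 := by
    intro ξ
    have hre : ‖ballHat d ξ‖ = |(ballHat d ξ).re| := by
      conv_lhs => rw [← ballHat_re ξ]
      rw [Complex.norm_real, Real.norm_eq_abs]
    have h := hT q (ballHat d ξ).re (hat u ξ) hq3 hqS
      (by rw [← hre]; exact (norm_ballHat_le ξ).trans hvol) ((hhat ξ).trans huM)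
    rw [ballHat_re, ← hre] at h
    -- One of the three factors is bounded by the L¹ norm of u, leaving a square for Plancherel.
    have h3 : C * ‖hat u ξ‖ ^ 3 ≤ C * A * ‖hat u ξ‖ ^ 2 := by
      have : ‖hat u ξ‖ ^ 3 ≤ A * ‖hat u ξ‖ ^ 2 := by
        rw [pow_succ' _ 2]
        exact mul_le_mul_of_nonneg_right (hhat ξ) (by positivity)
      rw [mul_assoc]
      exact mul_le_mul_of_nonneg_left this hC
    linarith
  have hsum := integral_mono iL
    (((i0.fun_add (i1.const_mul q)).fun_add (i2.const_mul (q / 2))).fun_add (i3.const_mul (C * A))) hpt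
  rw [integral_add ((i0.fun_add (i1.const_mul q)).fun_add (i2.const_mul (q / 2)))
      (i3.const_mul (C * A)), integral_add (i0.fun_add (i1.const_mul q)) (i2.const_mul (q / 2)),
    integral_add i0 (i1.const_mul q), integral_const_mul, integral_const_mul, integral_const_mul,
    e1, integral_norm_sq_hat hu] at hsum
  refine hsum.trans_eq ?_
  rw [secondOrder, mul_assoc C A]

theorem hat_I_mul (g : Space d → ℝ) (ξ : Space d) :
    hat (fun x => Complex.I * (g x : ℂ)) ξ = Complex.I * rhat g ξ :=
  hat_const_mul _ _ _

theorem integrable_kernel_mul {q : ℝ} (hq : 3 ≤ q) {u : Space d → ℝ}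
    (hu : Integrable u (ballMeasure d)) :
    Integrable (fun x => kernel d q x * u x) (ballMeasure d) :=
  hu.bdd_mul (continuous_rinv (integrable_kernelHat hq)).aestronglyMeasurable
    (.of_forall fun x => abs_rinv_le (kernelHat d q) x)

theorem weighted_quad_le {x x' q q' D S A a b : ℝ} (h : |x - x'| ≤ D * |q - q'|) (hx' : 0 ≤ x')
    (hxA : x' ≤ A) (hq : 1 ≤ q) (hqS : q ≤ S) (ha : 0 ≤ a) (hb : 0 ≤ b) :
    x * ((q - 1) * b + a) ≤ x' * ((q' - 1) * b + a) + (D * S + A) * |q - q'| * (a + b) := by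
  have h1 : (x - x') * ((q - 1) * b + a) ≤ D * |q - q'| * (S * (a + b)) := by
    have hn : 0 ≤ (q - 1) * b + a := by have := mul_nonneg (sub_nonneg.2 hq) hb; linarith
    refine mul_le_mul ((le_abs_self _).trans h) ?_ hn ((abs_nonneg _).trans h)
    nlinarith
  have h2 : x' * ((q - q') * b) ≤ A * (|q - q'| * (a + b)) := by
    have h3 : (q - q') * b ≤ |q - q'| * (a + b) :=
      mul_le_mul (le_abs_self _) (by linarith) hb (abs_nonneg _)
    have h4 : 0 ≤ |q - q'| * (a + b) := by positivity
    exact (mul_le_mul_of_nonneg_left h3 hx').trans (mul_le_mul_of_nonneg_right hxA h4)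
  linarith

/-- Comparison of the second variations at the exponents `q` and `2 r + 4`. -/
theorem secondOrder_I_mul_le {M S q : ℝ} {r : ℕ} {g : Space d → ℝ} (hM : 1 ≤ M)
    (hvol : ballVol d ≤ M) (hq : 7 / 2 ≤ q) (hqS : q ≤ S) (hr : 2 * r + 4 ≤ S)
    (hg : MemLp g 2 (ballMeasure d)) :
    secondOrder q (fun x => Complex.I * (g x : ℂ))
        - ∫ x, kernel d q x * g x ^ 2 ∂(ballMeasure d)
      ≤ -quadForm (2 * r) g + (2 * (2 + M ^ S * M) * (S + ballVol d) + M ^ S)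
          * |q - (2 * r + 4)| * ∫ x, g x ^ 2 ∂(ballMeasure d) := by
  set q' : ℝ := 2 * r + 4 with hq'
  set D := 2 * (2 + M ^ S * M) with hD
  have hr0 : (0 : ℝ) ≤ r := Nat.cast_nonneg r
  have hg1 : Integrable g (ballMeasure d) := hg.integrable (by norm_num)
  have hgI : MemLp (fun x => Complex.I * (g x : ℂ)) 2 (ballMeasure d) := hg.ofReal.const_mul _
  have i1 := integrable_secondOrder (by linarith : 2 ≤ q) hgI
  have i2 := integrable_weighted_quad (2 * r) hg1
  have i3 : Integrable fun ξ => ‖rhat g ξ‖ ^ 2 := (memLp_rhat hg).norm.integrable_sq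
  have e3 : ∫ ξ, ‖rhat g ξ‖ ^ 2 = ∫ x, g x ^ 2 ∂(ballMeasure d) := by
    have := integral_norm_sq_hat (u := fun x => (g x : ℂ)) hg.ofReal
    simpa [rhat] using this
  have hsec : secondOrder q (fun x => Complex.I * (g x : ℂ))
      ≤ (∫ ξ, ‖ballHat d ξ‖ ^ (2 * r + 2) * (((2 * r : ℕ) + 3) * (rhat g ξ).im ^ 2
          + (rhat g ξ).re ^ 2))
        + (D * S + M ^ S) * |q - q'| * ∫ x, g x ^ 2 ∂(ballMeasure d) := by
    rw [← e3, ← integral_const_mul, ← integral_add i2 (i3.const_mul _), secondOrder]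
    refine integral_mono i1 (i2.fun_add (i3.const_mul _)) fun ξ => ?_
    simp only
    rw [hat_I_mul]
    -- No power of F needs to survive, hence σ = 0: integrability already comes from ĝ in L².
    have h := abs_rpow_sub_rpow_le (S := S) (σ := 0) (s := q - 2) (s' := q' - 2) hM
      (norm_nonneg (ballHat d ξ)) ((norm_ballHat_le ξ).trans hvol) le_rfl (by linarith)
      (by linarith) (by linarith) (by linarith)
    have hpow : ‖ballHat d ξ‖ ^ (q' - 2) = ‖ballHat d ξ‖ ^ (2 * r + 2) := by
      rw [← Real.rpow_natCast]
      congr 1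
      push_cast
      rw [hq']
      ring
    have hle : ‖ballHat d ξ‖ ^ (q' - 2) ≤ M ^ S :=
      rpow_le_rpow_of_le_of_one_le (norm_nonneg _) ((norm_ballHat_le ξ).trans hvol) hM
        (by linarith) (by linarith)
    have hnn : 0 ≤ ‖ballHat d ξ‖ ^ (q' - 2) := by positivity
    have hsq : ‖rhat g ξ‖ ^ 2 = (rhat g ξ).re ^ 2 + (rhat g ξ).im ^ 2 := by
      rw [← Complex.normSq_eq_norm_sq, Complex.normSq_apply]; ring
    rw [Real.rpow_zero, mul_one, show q - 2 - (q' - 2) = q - q' by ring] at h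
    rw [hsq, ← hpow]
    have hcast : (((2 * r : ℕ) : ℝ) + 3) = q' - 1 := by push_cast; rw [hq']; ring
    rw [hcast]
    simp only [Complex.mul_re, Complex.mul_im, Complex.I_re, Complex.I_im, zero_mul, one_mul,
      zero_sub, zero_add, neg_sq]
    have ha : 0 ≤ (rhat g ξ).re ^ 2 := sq_nonneg _
    have hb : 0 ≤ (rhat g ξ).im ^ 2 := sq_nonneg _
    exact weighted_quad_le h hnn hle (by linarith) (by linarith) ha hb
  have hcast : ((2 * r + 4 : ℕ) : ℝ) = q' := by push_cast; rfl
  have j0 := hg.integrable_sq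
  have j1 := integrable_kernel_mul (d := d) (by linarith : 3 ≤ q) j0
  have j2 := integrable_fiberMass_mul (2 * r + 1) j0
  have hker : (∫ x, fiberMass d (2 * r + 1) x * g x ^ 2 ∂(ballMeasure d))
      ≤ (∫ x, kernel d q x * g x ^ 2 ∂(ballMeasure d))
        + D * |q - q'| * ballVol d * ∫ x, g x ^ 2 ∂(ballMeasure d) := by
    rw [← integral_const_mul, ← integral_add j1 (j0.const_mul _)]
    refine integral_mono j2 (j1.fun_add (j0.const_mul _)) fun x => ?_
    simp only
    have h := abs_kernel_sub_kernel_le hM hvol hq hqS (q' := q') (by linarith) hr x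
    rw [← hcast, kernel_even_eq_fiberMass, hcast] at h
    rw [← add_mul]
    refine mul_le_mul_of_nonneg_right ?_ (sq_nonneg _)
    linarith [neg_le_of_abs_le h]
  have hquad : quadForm (2 * r) g = (∫ x, fiberMass d (2 * r + 1) x * g x ^ 2 ∂(ballMeasure d))
      - ∫ ξ, ‖ballHat d ξ‖ ^ (2 * r + 2) * (((2 * r : ℕ) + 3) * (rhat g ξ).im ^ 2
          + (rhat g ξ).re ^ 2) := rfl
  rw [hquad]
  linarith

/-! ### Truncation of g and pointwise bounds for the perturbation. -/

/-- The cut-off `t ↦ t` on `[-η, η]`, extended by zero. -/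
def cut (η t : ℝ) : ℝ := if |t| ≤ η then t else 0

theorem measurable_cut (η : ℝ) : Measurable (cut η) :=
  Measurable.ite (measurableSet_le measurable_id.abs measurable_const) measurable_id
    measurable_const

theorem abs_cut_le (η t : ℝ) : |cut η t| ≤ |t| := by
  unfold cut
  split_ifs
  · exact le_rfl
  · simp

theorem memLp_cut {g : Space d → ℝ} (hg : MemLp g 2 (ballMeasure d)) (η : ℝ) :
    MemLp (fun x => cut η (g x)) 2 (ballMeasure d) :=
  hg.of_le ((measurable_cut η).comp_aemeasurable hg.aemeasurable).aestronglyMeasurable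
    (.of_forall fun x => abs_cut_le η (g x))

/-- The perturbation `f e^{ig} - 1`. -/
def perturb (f g : ℝ) : ℂ := (f : ℂ) * Complex.exp (Complex.I * (g : ℂ)) - 1

theorem perturb_re (f g : ℝ) : (perturb f g).re = f * Real.cos g - 1 := by
  simp [perturb, mul_comm Complex.I, Complex.exp_ofReal_mul_I_re]

theorem norm_perturb_le {f : ℝ} (hf : f ≤ 1) (g : ℝ) : ‖perturb f g‖ ≤ (1 - f) + |g| := by
  have e : perturb f g = ((f - 1 : ℝ) : ℂ) * Complex.exp (Complex.I * (g : ℂ))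
      + (Complex.exp (Complex.I * (g : ℂ)) - 1) := by
    unfold perturb; push_cast; ring
  rw [e]
  refine (norm_add_le _ _).trans (add_le_add ?_ ?_)
  · rw [norm_mul, Complex.norm_exp_I_mul_ofReal, mul_one, Complex.norm_real, Real.norm_eq_abs,
      abs_of_nonpos (by linarith)]
    linarith
  · exact Real.norm_exp_I_mul_ofReal_sub_one_le

theorem norm_perturb_le_two {f : ℝ} (hf0 : 0 ≤ f) (hf : f ≤ 1) (g : ℝ) : ‖perturb f g‖ ≤ 2 := by
  unfold perturb
  refine (norm_sub_le _ _).trans ?_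
  rw [norm_mul, Complex.norm_exp_I_mul_ofReal, mul_one, Complex.norm_real, Real.norm_eq_abs,
    abs_of_nonneg hf0, norm_one]
  linarith

/-- Both entries of the minimum are needed: |g| for the L² norm of the remainder, and g²/η for its
L¹ norm, which is thereby quadratic in g. -/
theorem norm_perturb_sub_le {f g η : ℝ} (hf : f ≤ 1) (hη : 0 < η) (hη1 : η ≤ 1) :
    ‖perturb f g - Complex.I * (cut η g : ℂ)‖ ≤ (1 - f) + min |g| (g ^ 2 / η) := by
  unfold cut
  split_ifs with h
  · have e : perturb f g - Complex.I * (g : ℂ)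
        = ((f - 1 : ℝ) : ℂ) * Complex.exp (Complex.I * (g : ℂ))
          + (Complex.exp (Complex.I * (g : ℂ)) - 1 - Complex.I * (g : ℂ)) := by
      unfold perturb; push_cast; ring
    have hn : ‖Complex.I * (g : ℂ)‖ = |g| := by
      rw [norm_mul, Complex.norm_I, one_mul, Complex.norm_real, Real.norm_eq_abs]
    have h1 := Complex.norm_exp_sub_one_sub_id_le (x := Complex.I * (g : ℂ)) (by rw [hn]; linarith)
    rw [hn] at h1
    rw [e]
    refine (norm_add_le _ _).trans (add_le_add ?_ (h1.trans (le_min ?_ ?_)))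
    · rw [norm_mul, Complex.norm_exp_I_mul_ofReal, mul_one, Complex.norm_real, Real.norm_eq_abs,
        abs_of_nonpos (by linarith)]
      linarith
    · rw [pow_two]
      exact mul_le_of_le_one_left (abs_nonneg g) (h.trans hη1)
    · rw [sq_abs, le_div_iff₀ hη]
      exact mul_le_of_le_one_right (sq_nonneg g) hη1
  · rw [Complex.ofReal_zero, mul_zero, sub_zero]
    refine (norm_perturb_le hf g).trans (add_le_add_right (le_min le_rfl ?_) _)
    rw [le_div_iff₀ hη, ← sq_abs, pow_two]
    exact mul_le_mul_of_nonneg_left (le_of_not_ge h) (abs_nonneg g)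

theorem sq_le_of_le_add_abs {r f g : ℝ} (hr : 0 ≤ r) (hf0 : 0 ≤ f) (hf : f ≤ 1)
    (h : r ≤ (1 - f) + |g|) : r ^ 2 ≤ 2 * (1 - f) + 2 * g ^ 2 := by
  have h1 : r ^ 2 ≤ ((1 - f) + |g|) ^ 2 := pow_le_pow_left₀ hr h 2
  nlinarith [sq_nonneg ((1 - f) - |g|), sq_abs g]

/-- Below the level η the sharp cosine bound applies, with quartic error at most η² g². Above it the
cut-off vanishes and the crude bound turns all of g² into a gain. -/
theorem mul_cos_sub_one_le_cut {K κ Km f g η : ℝ} (hκ : 0 ≤ κ) (hK : κ ≤ K) (hKm : K ≤ Km)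
    (hf0 : 0 ≤ f) (hf : f ≤ 1) (hg : |g| ≤ 5 * Real.pi / 4) (hη1 : η ≤ 1) :
    K * (f * Real.cos g - 1) ≤ -(1 / 2) * (K * cut η g ^ 2) + Km * η ^ 2 * g ^ 2
      - κ / (4 * Real.pi ^ 2) * (g - cut η g) ^ 2 - κ / 4 * (1 - f) := by
  have hK0 : 0 ≤ K := hκ.trans hK
  have hf' : κ * (1 - f) ≤ K * (1 - f) := mul_le_mul_of_nonneg_right hK (by linarith)
  unfold cut
  split_ifs with h
  · have h1 := mul_le_mul_of_nonneg_left (mul_cos_sub_one_le_of_small hf (h.trans hη1)) hK0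
    have h2 : g ^ 2 ≤ η ^ 2 := by
      rw [← sq_abs]; exact pow_le_pow_left₀ (abs_nonneg g) h 2
    have h3 : K * g ^ 4 ≤ Km * η ^ 2 * g ^ 2 := by
      have : K * g ^ 2 ≤ Km * η ^ 2 :=
        mul_le_mul hKm h2 (sq_nonneg _) (hK0.trans hKm)
      calc K * g ^ 4 = K * g ^ 2 * g ^ 2 := by ring
        _ ≤ _ := mul_le_mul_of_nonneg_right this (sq_nonneg _)
    rw [sub_self]
    linarith
  · have h1 := mul_le_mul_of_nonneg_left (mul_cos_sub_one_le hf0 hf hg) hK0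
    have h2 : 0 ≤ Km * η ^ 2 * g ^ 2 := by have := hK0.trans hKm; positivity
    have h3 : κ * (1 / (4 * Real.pi ^ 2) * g ^ 2) ≤ K * (1 / (4 * Real.pi ^ 2) * g ^ 2) :=
      mul_le_mul_of_nonneg_right hK (by positivity)
    have h4 : κ / (4 * Real.pi ^ 2) * g ^ 2 = κ * (1 / (4 * Real.pi ^ 2) * g ^ 2) := by ring
    rw [sub_zero, h4]
    linarith

/-- Used with s = ‖f - 1‖₁^{1/2} and y = ‖g‖₂^{1/2}. Only 2s³ and 2sy³ are not of an admissible
form. The first is absorbed by half of k s² because s is small, the second by the other half through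
the arithmetic–geometric mean inequality. -/
theorem remainder_le {A k s y : ℝ} (hA : 0 ≤ A) (hk : 0 < k) (hsk : 4 * A * s ≤ k)
    (hy : 0 ≤ y) (hy1 : y ≤ 1) :
    A * (y ^ 6 + (s ^ 2 + y ^ 3) * (3 * y ^ 2 + 2 * s) + (s ^ 2 + y ^ 2) * (s ^ 2 + y ^ 4))
      - k * s ^ 2 ≤ (5 * A + 2 * A ^ 2 / k) * (s ^ 2 * y ^ 2 + s ^ 4 + y ^ 5) := by
  have h1 : 2 * A * s * s ^ 2 ≤ k / 2 * s ^ 2 :=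
    mul_le_mul_of_nonneg_right (by linarith) (sq_nonneg s)
  have h2 : 2 * A * (s * y ^ 3) ≤ k / 2 * s ^ 2 + 2 * A ^ 2 / k * y ^ 6 := by
    have e : k / 2 * s ^ 2 + 2 * A ^ 2 / k * y ^ 6 - 2 * A * (s * y ^ 3)
        = k / 2 * (s - 2 * A / k * y ^ 3) ^ 2 := by
      field_simp
      ring
    have : 0 ≤ k / 2 * (s - 2 * A / k * y ^ 3) ^ 2 := by positivity
    linarith
  have h6 : y ^ 6 ≤ y ^ 5 := pow_le_pow_of_le_one hy hy1 (by norm_num)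
  have h4 : s ^ 2 * y ^ 4 ≤ s ^ 2 * y ^ 2 :=
    mul_le_mul_of_nonneg_left (pow_le_pow_of_le_one hy hy1 (by norm_num)) (sq_nonneg s)
  have hB : 0 ≤ 2 * A ^ 2 / k := by positivity
  have p1 : 0 ≤ s ^ 2 * y ^ 2 := by positivity
  have p2 : 0 ≤ s ^ 4 := by positivity
  have p3 : 0 ≤ y ^ 5 := by positivity
  have g1 := mul_le_mul_of_nonneg_left h6 hA
  have g2 := mul_le_mul_of_nonneg_left h6 hB
  have g3 := mul_le_mul_of_nonneg_left h4 hA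
  have g4 := mul_nonneg hB p1
  have g5 := mul_nonneg hB p2
  have g6 := mul_nonneg hA p2
  have g7 := mul_nonneg hA p1
  nlinarith

/-- A quasi-triangle inequality for the distance of `K^{1/2} g` to the weighted affine functions. -/
theorem norm_weighted_sub_starProjection_sq_le (r : ℕ) {Km : ℝ}
    (hKm : ∀ x, fiberMass d (2 * r + 1) x ≤ Km) {g h : Space d → ℝ}
    (hg : MemLp g 2 (ballMeasure d)) (hh : MemLp h 2 (ballMeasure d)) :
    ‖weighted d ((2 * r + 4 : ℕ) : ℝ) g hg - (affineSubspace d ((2 * r + 4 : ℕ) : ℝ)).starProjection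
        (weighted d ((2 * r + 4 : ℕ) : ℝ) g hg)‖ ^ 2
      ≤ 2 * ‖weighted d ((2 * r + 4 : ℕ) : ℝ) h hh
          - (affineSubspace d ((2 * r + 4 : ℕ) : ℝ)).starProjection
            (weighted d ((2 * r + 4 : ℕ) : ℝ) h hh)‖ ^ 2
        + 2 * Km * ∫ x, (g x - h x) ^ 2 ∂(ballMeasure d) := by
  set q : ℝ := ((2 * r + 4 : ℕ) : ℝ) with hq
  set U := affineSubspace d q
  have hsub : MemLp (fun x => g x - h x) 2 (ballMeasure d) := hg.sub hh
  have e : weighted d q g hg = weighted d q h hh + weighted d q (fun x => g x - h x) hsub := by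
    unfold weighted
    rw [← MemLp.toLp_add]
    congr 1
    funext x
    simp only [Pi.add_apply]
    ring
  have hW : ‖weighted d q (fun x => g x - h x) hsub‖ ^ 2
      ≤ Km * ∫ x, (g x - h x) ^ 2 ∂(ballMeasure d) := by
    rw [norm_sq_eq_integral, ← integral_const_mul]
    have hae := weighted_coeFn_even r hsub
    rw [integral_congr_ae (g := fun x => fiberMass d (2 * r + 1) x * (g x - h x) ^ 2)]
    · refine integral_mono (integrable_fiberMass_mul _ hsub.integrable_sq)
        (hsub.integrable_sq.const_mul _) fun x => ?_
      exact mul_le_mul_of_nonneg_right (hKm x) (sq_nonneg _)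
    · filter_upwards [hae] with x hx
      rw [hx, mul_pow, Real.sq_sqrt (fiberMass_nonneg _ _)]
  have hP : ‖weighted d q (fun x => g x - h x) hsub
      - U.starProjection (weighted d q (fun x => g x - h x) hsub)‖
        ≤ ‖weighted d q (fun x => g x - h x) hsub‖ := by
    rw [← Submodule.starProjection_orthogonal_val]
    exact Submodule.norm_starProjection_apply_le _ _
  rw [e, map_add]
  set a := weighted d q h hh
  set b := weighted d q (fun x => g x - h x) hsub
  have h1 : ‖a + b - (U.starProjection a + U.starProjection b)‖
      ≤ ‖a - U.starProjection a‖ + ‖b‖ := by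
    rw [add_sub_add_comm]
    exact (norm_add_le _ _).trans (add_le_add_right hP _)
  have h2 := pow_le_pow_left₀ (norm_nonneg _) h1 2
  nlinarith [sq_nonneg (‖a - U.starProjection a‖ - ‖b‖)]

/-! ### Integrated estimates for the perturbation. -/

section Estimates

variable {f g : Space d → ℝ}

theorem aestronglyMeasurable_perturb (hfm : AEStronglyMeasurable f (ballMeasure d))
    (hg : MemLp g 2 (ballMeasure d)) :
    AEStronglyMeasurable (fun x => perturb (f x) (g x)) (ballMeasure d) := by
  have h1 : AEMeasurable (fun x => (f x : ℂ)) (ballMeasure d) := hfm.aemeasurable.complex_ofReal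
  have h2 : AEMeasurable (fun x => (g x : ℂ)) (ballMeasure d) := hg.aemeasurable.complex_ofReal
  exact ((h1.mul (h2.const_mul Complex.I).cexp).sub aemeasurable_const).aestronglyMeasurable

theorem memLp_perturb (hfm : AEStronglyMeasurable f (ballMeasure d))
    (hf : ∀ᵐ x ∂(ballMeasure d), 0 ≤ f x ∧ f x ≤ 1) (hg : MemLp g 2 (ballMeasure d)) :
    MemLp (fun x => perturb (f x) (g x)) 2 (ballMeasure d) :=
  MemLp.of_bound (aestronglyMeasurable_perturb hfm hg) 2
    (hf.mono fun _ hx => norm_perturb_le_two hx.1 hx.2 _)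

theorem integrable_one_sub (hfm : AEStronglyMeasurable f (ballMeasure d))
    (hf : ∀ᵐ x ∂(ballMeasure d), 0 ≤ f x ∧ f x ≤ 1) :
    Integrable (fun x => 1 - f x) (ballMeasure d) :=
  Integrable.of_bound (aestronglyMeasurable_const.sub hfm) 1 (hf.mono fun x hx => by
    rw [Real.norm_eq_abs, abs_of_nonneg (by linarith [hx.2])]
    linarith [hx.1])

theorem integral_norm_perturb_le_ballVol (hfm : AEStronglyMeasurable f (ballMeasure d))
    (hf : ∀ᵐ x ∂(ballMeasure d), 0 ≤ f x ∧ f x ≤ 1) (hg : MemLp g 2 (ballMeasure d)) :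
    ∫ x, ‖perturb (f x) (g x)‖ ∂(ballMeasure d) ≤ 2 * ballVol d := by
  refine (integral_mono_ae ((memLp_perturb hfm hf hg).integrable (by norm_num)).norm
    (integrable_const 2) (hf.mono fun x hx => norm_perturb_le_two hx.1 hx.2 _)).trans_eq ?_
  rw [integral_const, smul_eq_mul, mul_comm]
  rfl

theorem integral_abs_le_sqrt (hg : MemLp g 2 (ballMeasure d)) :
    ∫ x, |g x| ∂(ballMeasure d) ≤ √(ballVol d) * √(∫ x, g x ^ 2 ∂(ballMeasure d)) := by
  have h := integral_mul_le_sqrt_mul_sqrt (μ := ballMeasure d) (a := fun _ => (1 : ℝ))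
    (b := fun x => |g x|) (memLp_const 1) hg.abs (fun _ => zero_le_one) (fun _ => abs_nonneg _)
  simpa [sq_abs, ballVol] using h

theorem integral_norm_perturb_le (hfm : AEStronglyMeasurable f (ballMeasure d))
    (hf : ∀ᵐ x ∂(ballMeasure d), 0 ≤ f x ∧ f x ≤ 1) (hg : MemLp g 2 (ballMeasure d)) :
    ∫ x, ‖perturb (f x) (g x)‖ ∂(ballMeasure d) ≤ (∫ x, (1 - f x) ∂(ballMeasure d))
      + √(ballVol d) * √(∫ x, g x ^ 2 ∂(ballMeasure d)) := by
  have i1 := integrable_one_sub hfm hf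
  have i2 : Integrable (fun x => |g x|) (ballMeasure d) := (hg.integrable (by norm_num)).abs
  have h := integral_mono_ae ((memLp_perturb hfm hf hg).integrable (by norm_num)).norm
    (i1.fun_add i2) (hf.mono fun x hx => norm_perturb_le hx.2 (g x))
  rw [integral_add i1 i2] at h
  linarith [integral_abs_le_sqrt hg]

theorem integral_sq_le_of_le_add_abs (hfm : AEStronglyMeasurable f (ballMeasure d))
    (hf : ∀ᵐ x ∂(ballMeasure d), 0 ≤ f x ∧ f x ≤ 1) (hg : MemLp g 2 (ballMeasure d))
    {w : Space d → ℂ} (hw : MemLp w 2 (ballMeasure d))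
    (hle : ∀ᵐ x ∂(ballMeasure d), ‖w x‖ ≤ (1 - f x) + |g x|) :
    ∫ x, ‖w x‖ ^ 2 ∂(ballMeasure d) ≤ 2 * (∫ x, (1 - f x) ∂(ballMeasure d))
      + 2 * ∫ x, g x ^ 2 ∂(ballMeasure d) := by
  have i1 := (integrable_one_sub hfm hf).const_mul 2
  have i2 := hg.integrable_sq.const_mul 2
  rw [← integral_const_mul, ← integral_const_mul, ← integral_add i1 i2]
  refine integral_mono_ae hw.norm.integrable_sq (i1.fun_add i2) ?_
  filter_upwards [hf, hle] with x hx hx2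
  exact sq_le_of_le_add_abs (norm_nonneg _) hx.1 hx.2 hx2

theorem memLp_perturb_sub (hfm : AEStronglyMeasurable f (ballMeasure d))
    (hf : ∀ᵐ x ∂(ballMeasure d), 0 ≤ f x ∧ f x ≤ 1) (hg : MemLp g 2 (ballMeasure d)) (η : ℝ) :
    MemLp (fun x => perturb (f x) (g x) - Complex.I * (cut η (g x) : ℂ)) 2 (ballMeasure d) :=
  (memLp_perturb hfm hf hg).sub ((memLp_cut hg η).ofReal.const_mul _)

theorem integral_norm_perturb_sub_le (hfm : AEStronglyMeasurable f (ballMeasure d))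
    (hf : ∀ᵐ x ∂(ballMeasure d), 0 ≤ f x ∧ f x ≤ 1) (hg : MemLp g 2 (ballMeasure d))
    {η : ℝ} (hη : 0 < η) (hη1 : η ≤ 1) :
    ∫ x, ‖perturb (f x) (g x) - Complex.I * (cut η (g x) : ℂ)‖ ∂(ballMeasure d)
      ≤ (∫ x, (1 - f x) ∂(ballMeasure d)) + (∫ x, g x ^ 2 ∂(ballMeasure d)) / η := by
  have i1 := integrable_one_sub hfm hf
  have i2 := hg.integrable_sq.div_const η
  rw [← integral_div, ← integral_add i1 i2]
  refine integral_mono_ae ((memLp_perturb_sub hfm hf hg η).integrable (by norm_num)).norm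
    (i1.fun_add i2) ?_
  filter_upwards [hf] with x hx
  exact (norm_perturb_sub_le hx.2 hη hη1).trans (add_le_add_right (min_le_right _ _) _)

theorem secondOrder_perturb_le {M S q η : ℝ} (hM : 1 ≤ M) (hvol : ballVol d ≤ M) (hq : 3 ≤ q)
    (hqS : q ≤ S) (hfm : AEStronglyMeasurable f (ballMeasure d))
    (hf : ∀ᵐ x ∂(ballMeasure d), 0 ≤ f x ∧ f x ≤ 1) (hg : MemLp g 2 (ballMeasure d))
    (hη : 0 < η) (hη1 : η ≤ 1) :
    secondOrder q (fun x => perturb (f x) (g x))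
      ≤ secondOrder q (fun x => Complex.I * (cut η (g x) : ℂ))
        + 2 * S * (M ^ S * √(ballVol d))
          * (((∫ x, (1 - f x) ∂(ballMeasure d)) + (∫ x, g x ^ 2 ∂(ballMeasure d)) / η)
            * (3 * √(∫ x, g x ^ 2 ∂(ballMeasure d)) + 2 * √(∫ x, (1 - f x) ∂(ballMeasure d)))) := by
  have hI : MemLp (fun x => Complex.I * (cut η (g x) : ℂ)) 2 (ballMeasure d) :=
    (memLp_cut hg η).ofReal.const_mul _
  have hR := memLp_perturb_sub hfm hf hg η
  have h := secondOrder_add_le hM hvol hq hqS hI hR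
  have e : (fun x => Complex.I * (cut η (g x) : ℂ)
      + (perturb (f x) (g x) - Complex.I * (cut η (g x) : ℂ))) = fun x => perturb (f x) (g x) := by
    funext x
    ring
  have ha : 0 ≤ ∫ x, (1 - f x) ∂(ballMeasure d) :=
    integral_nonneg_of_ae (hf.mono fun x hx => by simpa using hx.2)
  have hX : 0 ≤ ∫ x, g x ^ 2 ∂(ballMeasure d) := integral_nonneg fun x => sq_nonneg _
  have h1 := integral_norm_perturb_sub_le hfm hf hg hη hη1
  have h2 := integral_sq_le_of_le_add_abs hfm hf hg hR (hf.mono fun x hx =>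
    (norm_perturb_sub_le hx.2 hη hη1).trans (add_le_add_right (min_le_left _ _) _))
  have h3 : ∫ x, ‖Complex.I * (cut η (g x) : ℂ)‖ ^ 2 ∂(ballMeasure d)
      ≤ ∫ x, g x ^ 2 ∂(ballMeasure d) := by
    refine integral_mono hI.norm.integrable_sq hg.integrable_sq fun x => ?_
    simp only
    rw [norm_mul, Complex.norm_I, one_mul, Complex.norm_real, Real.norm_eq_abs, ← sq_abs (g x)]
    exact pow_le_pow_left₀ (abs_nonneg _) (abs_cut_le _ _) 2
  set a := ∫ x, (1 - f x) ∂(ballMeasure d)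
  set X := ∫ x, g x ^ 2 ∂(ballMeasure d)
  -- This bounds the L² norm of the remainder; the truncated main part adds one more √X, whence 3√X
  -- + 2√a.
  have h4 : √(2 * a + 2 * X) ≤ 2 * √a + 2 * √X := by
    rw [Real.sqrt_le_left (by positivity)]
    nlinarith [Real.sq_sqrt ha, Real.sq_sqrt hX, mul_nonneg (Real.sqrt_nonneg a) (Real.sqrt_nonneg X)]
  have h5 := (Real.sqrt_le_sqrt h2).trans h4
  have h6 := Real.sqrt_le_sqrt h3
  have hc : 0 ≤ 2 * S * (M ^ S * √(ballVol d)) := by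
    have : 0 ≤ S := by linarith
    positivity
  rw [e] at h
  refine h.trans (add_le_add_right (mul_le_mul_of_nonneg_left ?_ hc) _)
  refine mul_le_mul h1 (by linarith) (by positivity) (by positivity)

theorem integral_kernel_mul_perturb_le {q κ Km η : ℝ} (hq : 3 ≤ q) (hκ : 0 ≤ κ)
    (hlow : ∀ x ∈ unitBall d, κ ≤ kernel d q x) (hup : ∀ x, kernel d q x ≤ Km)
    (hfm : AEStronglyMeasurable f (ballMeasure d))
    (hf : ∀ᵐ x ∂(ballMeasure d), 0 ≤ f x ∧ f x ≤ 1) (hg : MemLp g 2 (ballMeasure d))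
    (hgb : ∀ᵐ x ∂(ballMeasure d), |g x| ≤ 5 * Real.pi / 4) (hη1 : η ≤ 1) :
    ∫ x, kernel d q x * (perturb (f x) (g x)).re ∂(ballMeasure d)
      ≤ -(1 / 2) * (∫ x, kernel d q x * cut η (g x) ^ 2 ∂(ballMeasure d))
        + Km * η ^ 2 * (∫ x, g x ^ 2 ∂(ballMeasure d))
        - κ / (4 * Real.pi ^ 2) * (∫ x, (g x - cut η (g x)) ^ 2 ∂(ballMeasure d))
        - κ / 4 * ∫ x, (1 - f x) ∂(ballMeasure d) := by
  have i1 := (integrable_kernel_mul hq (memLp_cut hg η).integrable_sq).const_mul (-(1 / 2))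
  have i2 := hg.integrable_sq.const_mul (Km * η ^ 2)
  have i3 := (hg.sub (memLp_cut hg η)).integrable_sq.const_mul (κ / (4 * Real.pi ^ 2))
  simp only [Pi.sub_apply] at i3
  have i4 := (integrable_one_sub hfm hf).const_mul (κ / 4)
  have i12 : Integrable (fun x => -(1 / 2) * (kernel d q x * cut η (g x) ^ 2)
      + Km * η ^ 2 * g x ^ 2) (ballMeasure d) := i1.add i2
  have i123 : Integrable (fun x => -(1 / 2) * (kernel d q x * cut η (g x) ^ 2)
      + Km * η ^ 2 * g x ^ 2 - κ / (4 * Real.pi ^ 2) * (g x - cut η (g x)) ^ 2)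
      (ballMeasure d) := i12.sub i3
  rw [← integral_const_mul, ← integral_const_mul, ← integral_const_mul, ← integral_const_mul,
    ← integral_add i1 i2, ← integral_sub i12 i3, ← integral_sub i123 i4]
  refine integral_mono_ae (integrable_kernel_mul hq
    ((memLp_perturb hfm hf hg).integrable (by norm_num)).re) (i123.sub i4) ?_
  filter_upwards [hf, hgb, ae_restrict_mem measurableSet_unitBall] with x hx hxg hxB
  simp only [perturb_re]
  exact mul_cos_sub_one_le_cut hκ (hlow x hxB) (hup x) hx.1 hx.2 hxg hη1

end Estimates

/-! ### Assembling the expansion. -/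

/-- For `q` close to `2 r + 4` the kernel `K_q` is bounded, and bounded below on the ball. -/
theorem exists_kernel_bounds {M S : ℝ} (r : ℕ) (hM : 1 ≤ M) (hvol : ballVol d ≤ M)
    (hS : 2 * r + 5 ≤ S) :
    ∃ ρ : ℝ, 0 < ρ ∧ ρ ≤ 1 / 4 ∧ ∃ κ : ℝ, 0 < κ ∧ ∃ Km : ℝ, 0 < Km ∧
      (∀ x, fiberMass d (2 * r + 1) x ≤ Km) ∧ ∀ q : ℝ, |q - (2 * r + 4)| < ρ →
        (∀ x ∈ unitBall d, κ ≤ kernel d q x) ∧ ∀ x, kernel d q x ≤ Km := by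
  obtain ⟨κ, hκ, hlow⟩ := exists_fiberMass_lower_bound (d := d) (2 * r + 1)
  have hr0 : (0 : ℝ) ≤ r := Nat.cast_nonneg r
  set B := 2 * (2 + M ^ S * M) * ballVol d with hB
  have hB0 : 0 ≤ B := by have := ballVol_nonneg (d := d); positivity
  have hcast : ((2 * r + 4 : ℕ) : ℝ) = 2 * r + 4 := by push_cast; rfl
  set N := ∫ ξ, ‖kernelHat d ((2 * r + 4 : ℕ) : ℝ) ξ‖ with hN
  have hN0 : 0 ≤ N := integral_nonneg fun _ => norm_nonneg _
  have hup : ∀ x, fiberMass d (2 * r + 1) x ≤ N := fun x => by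
    rw [← kernel_even_eq_fiberMass]
    exact (le_abs_self _).trans (abs_rinv_le _ x)
  -- The bound 1/4 keeps q above 7/2 and below 2r + 5. The other entry makes the change of the
  -- kernel at most κ/2, half of the lower bound at the even exponent.
  refine ⟨min (1 / 4) (κ / (2 * (B + 1))), by positivity, min_le_left _ _, κ / 2, by positivity,
    N + κ, by positivity, fun x => (hup x).trans (by linarith), fun q hq => ?_⟩
  have h1 := abs_lt.1 (hq.trans_le (min_le_left _ _))
  have h2 : B * |q - (2 * r + 4)| ≤ κ / 2 := by
    have h3 := (hq.trans_le (min_le_right _ _)).le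
    rw [le_div_iff₀ (by positivity)] at h3
    nlinarith [abs_nonneg (q - (2 * r + 4))]
  have hd : ∀ x, |kernel d q x - fiberMass d (2 * r + 1) x| ≤ κ / 2 := fun x => by
    have h := abs_kernel_sub_kernel_le hM hvol (q := q) (q' := 2 * r + 4) (S := S)
      (by linarith [h1.1]) (by linarith [h1.2]) (by linarith) (by linarith) x
    rw [← hcast, kernel_even_eq_fiberMass, hcast] at h
    refine h.trans (le_trans (le_of_eq ?_) h2)
    rw [hB]
    ring
  refine ⟨fun x hx => ?_, fun x => ?_⟩
  · linarith [hlow x hx, neg_le_of_abs_le (hd x)]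
  · linarith [hup x, le_of_abs_le (hd x)]

/-- T is the kernel paired with Re u and `Su` the quadratic term. The -Y/2 in T cancels the Y in
`Su`, leaving the form `Qf` of the truncated g. The gap for `Qf` controls the distance P₁ of the
truncation, and the gain w X₂ pays for replacing P₁ by the distance P of g itself. -/
theorem combine_expansion {S q T Su Y Qf P P₁ X X₁ X₂ a Z N H Km w κ c₀ c C₁ C₂ C₄ t : ℝ}
    (hq3 : 3 ≤ q) (hqS : q ≤ S) (hKm : 0 ≤ Km) (hw : 0 ≤ w) (hκ : 0 ≤ κ) (hc : 0 ≤ c)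
    (hC₂ : 0 ≤ C₂) (hC₄ : 0 ≤ C₄)
    (ht : 0 ≤ t) (hX₁0 : 0 ≤ X₁) (hX₁ : X₁ ≤ X) (hX₂ : 0 ≤ X₂) (ha : 0 ≤ a) (hZ : 0 ≤ Z)
    (hH : 0 ≤ H) (hP₁ : 0 ≤ P₁) (hcc : c ≤ c₀ / 2) (hcw : c * Km ≤ w)
    (hT : T ≤ -(1 / 2) * Y + Km * H - w * X₂ - κ / 4 * a)
    (hSu : Su - Y ≤ -Qf + C₄ * t * X₁ + C₂ * Z) (hQ : c₀ * P₁ ≤ Qf)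
    (hP : P ≤ 2 * P₁ + 2 * Km * X₂) :
    q * T + q / 2 * Su + C₁ * N ≤ -(c * P) + S * C₄ * t * X
      + (S * Km * H + S * C₂ * Z + C₁ * N) - κ / 4 * a := by
  have hS : 0 ≤ S := by linarith
  have e1 := mul_le_mul_of_nonneg_left hT (by linarith : 0 ≤ q)
  have e2 := mul_le_mul_of_nonneg_left hSu (by linarith : 0 ≤ q / 2)
  have e3 := mul_le_mul_of_nonneg_left hQ (by linarith : 0 ≤ q / 2)
  have e4 := mul_le_mul_of_nonneg_left hP hc
  have e5 : 2 * (c * P₁) ≤ q / 2 * (c₀ * P₁) := by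
    have := mul_le_mul_of_nonneg_right hcc hP₁
    have h0 := mul_nonneg hc hP₁
    nlinarith
  have e6 : 2 * (c * Km * X₂) ≤ q * (w * X₂) := by
    have := mul_le_mul_of_nonneg_right hcw hX₂
    have h0 := mul_nonneg hw hX₂
    nlinarith
  have e7 : q * (Km * H) ≤ S * (Km * H) := mul_le_mul_of_nonneg_right hqS (by positivity)
  have e8 : q / 2 * (C₂ * Z) ≤ S * (C₂ * Z) :=
    mul_le_mul_of_nonneg_right (by linarith) (by positivity)
  have e9 : q / 2 * (C₄ * t * X₁) ≤ S * (C₄ * t * X) :=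
    mul_le_mul (by linarith) (mul_le_mul_of_nonneg_left hX₁ (by positivity)) (by positivity) hS
  have e10 : κ / 4 * a ≤ q * (κ / 4 * a) := by
    have : 0 ≤ κ / 4 * a := by positivity
    nlinarith
  linarith

/-- The expansion of the `q`-th power of the `L^q` norm of the Fourier transform of `f e^{ig} 1_B`
around `f = 1`, `g = 0`, with a free truncation level `η`. -/
theorem exists_expansion (r : ℕ) :
    ∃ ρ : ℝ, 0 < ρ ∧ ρ ≤ 1 / 4 ∧ ∃ c : ℝ, 0 < c ∧ ∃ k : ℝ, 0 < k ∧ ∃ A : ℝ, 0 ≤ A ∧ ∃ L : ℝ,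
    ∀ (q : ℝ) (f g : Space d → ℝ) (hg : MemLp g 2 (ballMeasure d)), |q - (2 * r + 4)| < ρ →
      AEStronglyMeasurable f (ballMeasure d) →
      (∀ᵐ x ∂(ballMeasure d), 0 ≤ f x ∧ f x ≤ 1) →
      (∀ᵐ x ∂(ballMeasure d), |g x| ≤ 5 * Real.pi / 4) → ∀ η : ℝ, 0 < η → η ≤ 1 →
      ∫ ξ, ‖ballHat d ξ + hat (fun x => perturb (f x) (g x)) ξ‖ ^ q
        ≤ (∫ ξ, ‖ballHat d ξ‖ ^ q)
        - c * ‖weighted d ((2 * r + 4 : ℕ) : ℝ) g hg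
            - (affineSubspace d ((2 * r + 4 : ℕ) : ℝ)).starProjection
              (weighted d ((2 * r + 4 : ℕ) : ℝ) g hg)‖ ^ 2
        + L * |q - (2 * r + 4)| * (∫ x, g x ^ 2 ∂(ballMeasure d))
        + A * (η ^ 2 * (∫ x, g x ^ 2 ∂(ballMeasure d))
          + ((∫ x, (1 - f x) ∂(ballMeasure d)) + (∫ x, g x ^ 2 ∂(ballMeasure d)) / η)
            * (3 * √(∫ x, g x ^ 2 ∂(ballMeasure d)) + 2 * √(∫ x, (1 - f x) ∂(ballMeasure d)))
          + ((∫ x, (1 - f x) ∂(ballMeasure d)) + √(∫ x, g x ^ 2 ∂(ballMeasure d)))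
            * ((∫ x, (1 - f x) ∂(ballMeasure d)) + ∫ x, g x ^ 2 ∂(ballMeasure d)))
        - k * ∫ x, (1 - f x) ∂(ballMeasure d) := by
  have hV := ballVol_nonneg (d := d)
  have hr0 : (0 : ℝ) ≤ r := Nat.cast_nonneg r
  -- M bounds F and also ‖u‖₁, since ‖u‖ ≤ 2 pointwise; adding 1 gives M ≥ 1.
  set M := 2 * ballVol d + 1 with hMdef
  have hM : 1 ≤ M := by linarith
  have hvol : ballVol d ≤ M := by linarith
  set S : ℝ := 2 * r + 5 with hS
  have hS0 : 0 ≤ S := by linarith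
  obtain ⟨ρ, hρ, hρ4, κ, hκ, Km, hKm, hfKm, hker⟩ := exists_kernel_bounds (d := d) r hM hvol hS.ge
  obtain ⟨C₁, hC₁, hexp⟩ := exists_integral_norm_add_rpow_le (d := d) hM hvol hS0
  obtain ⟨c₀, hc₀, hgap⟩ := exists_quadForm_gap (d := d) r
  set C₂ := 2 * S * (M ^ S * √(ballVol d)) with hC₂def
  have hC₂ : 0 ≤ C₂ := by positivity
  set C₄ := 2 * (2 + M ^ S * M) * (S + ballVol d) + M ^ S with hC₄def
  have hC₄ : 0 ≤ C₄ := by positivity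
  set w := κ / (4 * Real.pi ^ 2) with hw
  have hw0 : 0 < w := by positivity
  set A := S * Km + S * C₂ + C₁ * (2 * (1 + √(ballVol d))) with hA
  -- The two entries cover the two terms of the quasi-triangle inequality: c₀/2 the distance of the
  -- truncated function, w/Km the part cut away.
  have hc : 0 < min (c₀ / 2) (w / Km) := by positivity
  refine ⟨ρ, hρ, hρ4, min (c₀ / 2) (w / Km), hc, κ / 4, by positivity, A, by positivity, S * C₄,
    fun q f g hg hq hfm hf hgb η hη hη1 => ?_⟩
  have hq' := abs_lt.1 (hq.trans_le hρ4)
  obtain ⟨hlow, hup⟩ := hker q hq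
  have hq3 : 3 ≤ q := by linarith [hq'.1]
  have hqS : q ≤ S := by linarith [hq'.2]
  have hu := memLp_perturb hfm hf hg
  have hcut := memLp_cut hg η
  have E0 := hexp q _ hq3 hqS hu
    ((integral_norm_perturb_le_ballVol hfm hf hg).trans (by linarith))
  have E1 := integral_norm_perturb_le hfm hf hg
  have E2 := integral_sq_le_of_le_add_abs hfm hf hg hu (hf.mono fun x hx => norm_perturb_le hx.2 _)
  have E3 := secondOrder_perturb_le hM hvol hq3 hqS hfm hf hg hη hη1
  have E4 := integral_kernel_mul_perturb_le hq3 hκ.le hlow hup hfm hf hg hgb hη1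
  have E5 := secondOrder_I_mul_le (r := r) hM hvol (by linarith [hq'.1]) hqS (by linarith) hcut
  have E6 := hgap _ hcut
  have E7 := norm_weighted_sub_starProjection_sq_le r hfKm hg hcut
  have hX₁ : ∫ x, cut η (g x) ^ 2 ∂(ballMeasure d) ≤ ∫ x, g x ^ 2 ∂(ballMeasure d) := by
    refine integral_mono hcut.integrable_sq hg.integrable_sq fun x => ?_
    exact sq_le_sq.2 (abs_cut_le η (g x))
  have hX₁0 : 0 ≤ ∫ x, cut η (g x) ^ 2 ∂(ballMeasure d) := integral_nonneg fun _ => sq_nonneg _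
  have hX₂ : 0 ≤ ∫ x, (g x - cut η (g x)) ^ 2 ∂(ballMeasure d) :=
    integral_nonneg fun _ => sq_nonneg _
  have ha : 0 ≤ ∫ x, (1 - f x) ∂(ballMeasure d) :=
    integral_nonneg_of_ae (hf.mono fun x hx => by simpa using hx.2)
  have hN₁ : 0 ≤ ∫ x, ‖perturb (f x) (g x)‖ ∂(ballMeasure d) :=
    integral_nonneg fun _ => norm_nonneg _
  have hN₂ : 0 ≤ ∫ x, ‖perturb (f x) (g x)‖ ^ 2 ∂(ballMeasure d) :=
    integral_nonneg fun _ => by positivity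
  set X := ∫ x, g x ^ 2 ∂(ballMeasure d)
  set a := ∫ x, (1 - f x) ∂(ballMeasure d)
  have hX : 0 ≤ X := hX₁0.trans hX₁
  set Z := (a + X / η) * (3 * √X + 2 * √a) with hZ
  have hZ0 : 0 ≤ Z := by positivity
  have hcomb := combine_expansion (S := S) (N := (∫ x, ‖perturb (f x) (g x)‖ ∂(ballMeasure d))
      * ∫ x, ‖perturb (f x) (g x)‖ ^ 2 ∂(ballMeasure d)) (H := η ^ 2 * X) (Z := Z) (C₁ := C₁)
    (T := ∫ x, kernel d q x * (perturb (f x) (g x)).re ∂(ballMeasure d))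
    (Su := secondOrder q fun x => perturb (f x) (g x))
    (Y := ∫ x, kernel d q x * cut η (g x) ^ 2 ∂(ballMeasure d))
    hq3 hqS hKm.le hw0.le hκ.le hc.le hC₂ hC₄ (abs_nonneg (q - (2 * r + 4))) hX₁0 hX₁ hX₂ ha
    hZ0 (by positivity) (sq_nonneg _) (min_le_left _ _)
    ((le_div_iff₀ hKm).1 (min_le_right _ _)) (by linarith) (by linarith) E6 E7
  have hNN : (∫ x, ‖perturb (f x) (g x)‖ ∂(ballMeasure d))
      * (∫ x, ‖perturb (f x) (g x)‖ ^ 2 ∂(ballMeasure d))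
        ≤ 2 * (1 + √(ballVol d)) * ((a + √X) * (a + X)) := by
    have h1 : a + √(ballVol d) * √X ≤ (1 + √(ballVol d)) * (a + √X) := by
      have := mul_nonneg (Real.sqrt_nonneg (ballVol d)) ha
      have := Real.sqrt_nonneg X
      linarith
    have := mul_le_mul (E1.trans h1) E2 hN₂ (by positivity)
    linarith
  have hNN' := mul_le_mul_of_nonneg_left hNN hC₁
  have hN0 : 0 ≤ (a + √X) * (a + X) := by positivity
  have hH0 : 0 ≤ η ^ 2 * X := by positivity
  have hAb : S * Km * (η ^ 2 * X) + S * C₂ * Z + C₁ * (2 * (1 + √(ballVol d)) * ((a + √X) * (a + X)))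
      ≤ A * (η ^ 2 * X + Z + (a + √X) * (a + X)) := by
    have b1 : 0 ≤ S * Km := by positivity
    have b2 : 0 ≤ S * C₂ := by positivity
    have b3 : 0 ≤ C₁ * (2 * (1 + √(ballVol d))) := by positivity
    have d1 := mul_nonneg b1 (add_nonneg hZ0 hN0)
    have d2 := mul_nonneg b2 (add_nonneg hH0 hN0)
    have d3 := mul_nonneg b3 (add_nonneg hH0 hZ0)
    rw [hA]
    linarith
  linarith

/-! ### Translation to L^p norms and the conclusion. -/

theorem fourier_modulated {f g : Space d → ℝ} (hfm : AEStronglyMeasurable f (ballMeasure d))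
    (hf : ∀ᵐ x ∂(ballMeasure d), 0 ≤ f x ∧ f x ≤ 1) (hg : MemLp g 2 (ballMeasure d)) :
    𝓕 (modulated d f g) = fun ξ => ballHat d ξ + hat (fun x => perturb (f x) (g x)) ξ := by
  funext ξ
  have h1 : Integrable (fun _ : Space d => (1 : ℂ)) (ballMeasure d) := integrable_const 1
  have h := hat_add h1 ((memLp_perturb hfm hf hg).integrable (by norm_num)) ξ
  have e : hat (fun _ : Space d => (1 : ℂ)) = ballHat d := by
    rw [← rhat_one, rhat]
    simp
  rw [e] at h
  rw [← h]
  have e2 : (fun x => (1 : ℂ) + perturb (f x) (g x))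
      = fun x => (f x : ℂ) * Complex.exp (Complex.I * (g x : ℂ)) := by
    funext x
    rw [perturb]
    ring
  rw [e2]
  rfl

theorem lpNorm_sub_one_eq {f : Space d → ℝ} (hfm : AEStronglyMeasurable f (ballMeasure d))
    (hf : ∀ᵐ x ∂(ballMeasure d), 0 ≤ f x ∧ f x ≤ 1) :
    lpNorm (fun x => f x - 1) 1 (ballMeasure d) = ∫ x, (1 - f x) ∂(ballMeasure d) := by
  have hm : AEStronglyMeasurable (fun x => f x - 1) (ballMeasure d) :=
    hfm.sub aestronglyMeasurable_const
  rw [lpNorm_one_eq_integral_norm hm]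
  refine integral_congr_ae (hf.mono fun x hx => ?_)
  simp only
  rw [Real.norm_eq_abs, abs_of_nonpos (by linarith [hx.2])]
  ring

theorem lpNorm_two_sq_eq {g : Space d → ℝ} (hg : MemLp g 2 (ballMeasure d)) :
    lpNorm g 2 (ballMeasure d) ^ 2 = ∫ x, g x ^ 2 ∂(ballMeasure d) := by
  rw [lpNorm_eq_integral_norm_rpow_toReal (by norm_num) (by norm_num) hg.1, ← Real.rpow_natCast,
    ← Real.rpow_mul (integral_nonneg fun _ => by positivity)]
  simp

/-- A truncation level `η` balancing `η² X` against `X / η`, where `X = y⁴`. -/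
theorem exists_truncation_level {y : ℝ} (hy : 0 ≤ y) (hy1 : y ≤ 1) :
    ∃ η : ℝ, 0 < η ∧ η ≤ 1 ∧ η ^ 2 * y ^ 4 ≤ y ^ 6 ∧ y ^ 4 / η ≤ y ^ 3 := by
  rcases hy.eq_or_lt with rfl | h
  · exact ⟨1, one_pos, le_rfl, by norm_num, by norm_num⟩
  · exact ⟨y, h, hy1, le_of_eq (by ring), le_of_eq (by field_simp)⟩

end BallFourier

end

theorem mainTheorem3 (d : ℕ) (hd : 1 ≤ d) (qbar : ℕ) (hqbar : 4 ≤ qbar) (heven : Even qbar) :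
    ∃ δ₀ : ℝ, 0 < δ₀ ∧ ∃ ρ : ℝ, 0 < ρ ∧ ∃ c : ℝ, 0 < c ∧ ∃ C : ℝ, 0 < C ∧
    ∃ ω : ℝ → ℝ, Filter.Tendsto ω (𝓝 0) (𝓝 0) ∧
    ∀ (q : ℝ) (f g : EuclideanSpace ℝ (Fin d) → ℝ)
      (hg : MemLp g 2 (BallFourier.ballMeasure d)),
      3 < q → |q - qbar| < ρ →
      AEStronglyMeasurable f (BallFourier.ballMeasure d) →
      (∀ᵐ x ∂(BallFourier.ballMeasure d), 0 ≤ f x ∧ f x ≤ 1) →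
      (∀ᵐ x ∂(BallFourier.ballMeasure d), |g x| ≤ 5 * Real.pi / 4) →
      lpNorm (fun x => f x - 1) 1 (BallFourier.ballMeasure d) ≤ δ₀ →
      lpNorm g 2 (BallFourier.ballMeasure d) ≤ δ₀ →
      MemLp (𝓕 (BallFourier.modulated d f g)) (ENNReal.ofReal q) volume ∧
      MemLp (𝓕 (BallFourier.ballIndicator d)) (ENNReal.ofReal q) volume ∧
      lpNorm (𝓕 (BallFourier.modulated d f g)) (ENNReal.ofReal q) volume ^ q ≤
        lpNorm (𝓕 (BallFourier.ballIndicator d)) (ENNReal.ofReal q) volume ^ q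
        - c * ‖BallFourier.weighted d qbar g hg
            - (BallFourier.affineSubspace d qbar).starProjection
                (BallFourier.weighted d qbar g hg)‖ ^ 2
        + ω (q - qbar) * lpNorm g 2 (BallFourier.ballMeasure d) ^ 2
        + C * (lpNorm (fun x => f x - 1) 1 (BallFourier.ballMeasure d)
            * lpNorm g 2 (BallFourier.ballMeasure d))
        + C * (lpNorm (fun x => f x - 1) 1 (BallFourier.ballMeasure d) ^ 2
            + lpNorm g 2 (BallFourier.ballMeasure d) ^ (5 / 2 : ℝ)) := by
  obtain ⟨r, rfl⟩ : ∃ r, qbar = 2 * r + 4 := by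
    obtain ⟨m, hm⟩ := heven
    exact ⟨m - 2, by omega⟩
  have hcast : ((2 * r + 4 : ℕ) : ℝ) = 2 * r + 4 := by push_cast; rfl
  obtain ⟨ρ, hρ, hρ4, c, hc, k, hk, A, hA, L, hexp⟩ := BallFourier.exists_expansion (d := d) r
  -- The second entry of the minimum is the smallness of √a required by `remainder_le`. The extra 1
  -- in both constants guards against A = 0.
  refine ⟨min 1 ((k / (4 * (A + 1))) ^ 2), by positivity, ρ, hρ, c, hc, 5 * A + 2 * A ^ 2 / k + 1,
    by positivity, fun t => L * |t|, ?_, ?_⟩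
  · have : Continuous fun t : ℝ => L * |t| := by fun_prop
    simpa using this.tendsto 0
  intro q f g hg hq3 hq hfm hf hgb hfδ hgδ
  have hu := BallFourier.memLp_perturb hfm hf hg
  have hF := BallFourier.fourier_modulated hfm hf hg
  have hFm : MemLp (fun ξ => BallFourier.ballHat d ξ
      + BallFourier.hat (fun x => BallFourier.perturb (f x) (g x)) ξ) 2 :=
    BallFourier.memLp_ballHat.add (BallFourier.memLp_hat hu)
  have hm1 : MemLp (𝓕 (BallFourier.modulated d f g)) (ENNReal.ofReal q) volume := by
    rw [hF]
    exact BallFourier.memLp_of_bound hFm (fun ξ => (norm_add_le _ _).trans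
      (add_le_add (BallFourier.norm_ballHat_le ξ) (BallFourier.norm_hat_le _ ξ))) (by linarith)
  have hm2 : MemLp (BallFourier.ballHat d) (ENNReal.ofReal q) volume :=
    BallFourier.memLp_of_bound BallFourier.memLp_ballHat BallFourier.norm_ballHat_le (by linarith)
  refine ⟨hm1, hm2, ?_⟩
  set a := lpNorm (fun x => f x - 1) 1 (BallFourier.ballMeasure d) with ha
  set G := lpNorm g 2 (BallFourier.ballMeasure d) with hG
  have ha0 : 0 ≤ a := lpNorm_nonneg
  have hG0 : 0 ≤ G := lpNorm_nonneg
  have hG1 : G ≤ 1 := hgδ.trans (min_le_left _ _)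
  -- For G > 0 the level is η = √G. The product of G²/η with 3G then produces the exponent 5/2, and
  -- η² G² = G³ is smaller.
  obtain ⟨η, hη, hη1, hη2, hη3⟩ := BallFourier.exists_truncation_level (Real.sqrt_nonneg G)
    (Real.sqrt_le_one.2 hG1)
  have hy2 : √G ^ 2 = G := Real.sq_sqrt hG0
  have hs2 : √a ^ 2 = a := Real.sq_sqrt ha0
  have hy4 : √G ^ 4 = G ^ 2 := by rw [show (4 : ℕ) = 2 * 2 from rfl, pow_mul, hy2]
  have hy5 : √G ^ 5 = G ^ (5 / 2 : ℝ) := by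
    rw [Real.sqrt_eq_rpow, ← Real.rpow_natCast, ← Real.rpow_mul hG0]
    norm_num
  have hsk : 4 * A * √a ≤ k := by
    have h1 : √a ≤ k / (4 * (A + 1)) :=
      Real.sqrt_le_iff.2 ⟨by positivity, hfδ.trans (min_le_right _ _)⟩
    rw [le_div_iff₀ (by positivity)] at h1
    nlinarith [Real.sqrt_nonneg a]
  have hrem := BallFourier.remainder_le hA hk hsk (Real.sqrt_nonneg G) (Real.sqrt_le_one.2 hG1)
  have hmain := hexp q f g hg (by rwa [hcast] at hq) hfm hf hgb η hη hη1
  rw [← BallFourier.lpNorm_two_sq_eq hg, ← BallFourier.lpNorm_sub_one_eq hfm hf, ← ha, ← hG,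
    Real.sqrt_sq hG0] at hmain
  have e1 : lpNorm (𝓕 (BallFourier.modulated d f g)) (ENNReal.ofReal q) volume ^ q
      = ∫ ξ, ‖BallFourier.ballHat d ξ
        + BallFourier.hat (fun x => BallFourier.perturb (f x) (g x)) ξ‖ ^ q := by
    rw [hF]
    exact BallFourier.lpNorm_rpow_eq_integral hFm.1 (by linarith)
  have e2 : lpNorm (𝓕 (BallFourier.ballIndicator d)) (ENNReal.ofReal q) volume ^ q
      = ∫ ξ, ‖BallFourier.ballHat d ξ‖ ^ q :=
    BallFourier.lpNorm_rpow_eq_integral BallFourier.memLp_ballHat.1 (by linarith)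
  rw [e1, e2]
  rw [hy4] at hη2 hη3 hrem
  rw [hs2, hy2, hy5, show √a ^ 4 = a ^ 2 by
    rw [show (4 : ℕ) = 2 * 2 from rfl, pow_mul, hs2]] at hrem
  have hbr : A * (η ^ 2 * G ^ 2 + (a + G ^ 2 / η) * (3 * G + 2 * √a) + (a + G) * (a + G ^ 2))
      ≤ A * (√G ^ 6 + (a + √G ^ 3) * (3 * G + 2 * √a) + (a + G) * (a + G ^ 2)) := by
    refine mul_le_mul_of_nonneg_left ?_ hA
    have : (a + G ^ 2 / η) * (3 * G + 2 * √a) ≤ (a + √G ^ 3) * (3 * G + 2 * √a) :=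
      mul_le_mul_of_nonneg_right (by linarith) (by positivity)
    linarith
  have hpos : 0 ≤ a * G + a ^ 2 + G ^ (5 / 2 : ℝ) := by positivity
  rw [hcast] at *
  linarith
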